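/- Let $\mathcal G : G_1 \rightrightarrows G_0$ be a strict Lie 2-group, i.e. a groupoid object in the category of (finite-dimensional, real) Lie groups, with source, target and unit maps $\mathtt s,\mathtt t,\mathtt u$. Let $\mathfrak g_1,\mathfrak g$ be the Lie algebras of $G_1, G_0$, let $\mathfrak h=\ker T_1\mathtt s\subset\mathfrak g_1$, so that $\mathfrak g_1=\mathfrak h\rtimes\mathfrak g$ via $T_1\mathtt u$, and let $\phi=T_1\mathtt t|_{\mathfrak h}:\mathfrak h\to\mathfrak g$. The dual $\mathfrak G^*$ of the Lie 2-algebra is the groupoid $\mathfrak g_1^*=\mathfrak h^*\oplus\mathfrak g^*\rightrightarrows\mathfrak h^*$ with $$\mathtt s(\alpha,\theta)=\alpha-\phi^*\theta,\quad \mathtt t(\alpha,\theta)=\alpha,\quad (\alpha,\theta)(\alpha',\theta')=(\alpha,\theta+\theta')\ \text{ if }\ \alpha'=\alpha-\phi^*\theta,\quad 1_\alpha=(\alpha,0).$$ $G_1$ acts on $\mathfrak g_1^*$ by the right coadjoint action $\xi\cdot g=\xi\circ \mathrm{Ad}_g$, and $G_0$ acts on $\mathfrak h^*$ by $\alpha\cdot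 g=\alpha\circ \mathrm{Ad}_{\mathtt u(g)}|_{\mathfrak h}$. Then: 1. With addition as group structure and with the Lie–Poisson bracket $\{f,g\}(\xi)=\xi([d_\xi f,d_\xi g])$, $\mathfrak G^*$ is a Poisson 2-group: it is a Lie 2-group, the graph of the groupoid multiplication is coisotropic in $\mathfrak g_1^*\times\mathfrak g_1^*\times\overline{\mathfrak g_1^*}$, and so is the graph of the addition. 2. The action groupoids of these two actions are the horizontal sides of a double Lie groupoid with vertical sides $\mathfrak G^*\times\mathcal G\rightrightarrows\mathfrak h^*\times G_0$ and $\mathfrak G^*\rightrightarrows\mathfrak h^*$; in particular the coadjoint action map $\mathfrak G^*\times\mathcal G\to\mathfrak G^*$ is a groupoid morphism. 3. For every $\alpha\in\mathfrak h^*$ the whole coadjoint orbit $\mathcal O_1=1_\alpha\cdot G_1$ is a subgroupoid of $\mathfrak G^*$ over the orbit $\mathcal O_0=\alpha\cdot G_0$. With the smooth structures of $\mathcal O_1$ and $\mathcal O_0$ as orbits (for which the orbit maps are submersions and the inclusions are injective immersions), $\mathcal O_1\rightrightarrows\mathcal O_0$ is a Lie groupoid, and with the Kostant–Kirillov–Souriau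 form $\omega_\xi(\xi\circ\mathrm{ad}_X,\xi\circ\mathrm{ad}_Y)=\xi([X,Y])$ it is a symplectic groupoid: $\omega$ is a symplectic form, it is multiplicative ($\mathtt m^*\omega=\mathrm{pr}_1^*\omega+\mathrm{pr}_2^*\omega$), and the graph of the multiplication is coisotropic in $\mathcal O_1\times\mathcal O_1\times\overline{\mathcal O_1}$. For the Poisson structure defined by $\omega$, the inclusion $\mathcal O_1\to\mathfrak g_1^*$ and the map $\mathtt t:\mathcal O_1\to\mathcal O_0\subset\mathfrak h^*$ are Poisson maps to the Lie–Poisson structures of $\mathfrak g_1^*$ and $\mathfrak h^*$; that is, the symplectic groupoid integrates the Poisson structure of the orbit $\mathcal O_0$. -/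

import Mathlib

open scoped Manifold ContDiff Topology

noncomputable section

namespace LieTwo

/-! ### Groupoids -/

/-- The structure maps of a groupoid with arrows `M₁` and objects `M₀`.  The product `mul x y`
(first `y`, then `x`) is meaningful only if `src x = tgt y`; other values are irrelevant. -/
structure GroupoidData (M₁ M₀ : Type*) where
  src : M₁ → M₀
  tgt : M₁ → M₀
  unit : M₀ → M₁
  mul : M₁ → M₁ → M₁
  inv : M₁ → M₁

namespace GroupoidData

variable {M₁ M₀ N₁ N₀ : Type*}

/-- The set of composable pairs. -/
def composable (𝒢 : GroupoidData M₁ M₀) : Set (M₁ × M₁) := {p | 𝒢.src p.1 = 𝒢.tgt p.2}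

/-- The groupoid axioms. -/
structure IsGroupoid (𝒢 : GroupoidData M₁ M₀) : Prop where
  src_unit : ∀ a, 𝒢.src (𝒢.unit a) = a
  tgt_unit : ∀ a, 𝒢.tgt (𝒢.unit a) = a
  src_mul : ∀ x y, 𝒢.src x = 𝒢.tgt y → 𝒢.src (𝒢.mul x y) = 𝒢.src y
  tgt_mul : ∀ x y, 𝒢.src x = 𝒢.tgt y → 𝒢.tgt (𝒢.mul x y) = 𝒢.tgt x
  mul_assoc : ∀ x y z, 𝒢.src x = 𝒢.tgt y → 𝒢.src y = 𝒢.tgt z →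
    𝒢.mul (𝒢.mul x y) z = 𝒢.mul x (𝒢.mul y z)
  unit_mul : ∀ x, 𝒢.mul (𝒢.unit (𝒢.tgt x)) x = x
  mul_unit : ∀ x, 𝒢.mul x (𝒢.unit (𝒢.src x)) = x
  src_inv : ∀ x, 𝒢.src (𝒢.inv x) = 𝒢.tgt x
  tgt_inv : ∀ x, 𝒢.tgt (𝒢.inv x) = 𝒢.src x
  inv_mul : ∀ x, 𝒢.mul (𝒢.inv x) x = 𝒢.unit (𝒢.src x)
  mul_inv : ∀ x, 𝒢.mul x (𝒢.inv x) = 𝒢.unit (𝒢.tgt x)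

/-- `(F₁, F₀)` is a morphism of groupoids. -/
structure IsMorphism (𝒢 : GroupoidData M₁ M₀) (ℋ : GroupoidData N₁ N₀)
    (F₁ : M₁ → N₁) (F₀ : M₀ → N₀) : Prop where
  src : ∀ x, ℋ.src (F₁ x) = F₀ (𝒢.src x)
  tgt : ∀ x, ℋ.tgt (F₁ x) = F₀ (𝒢.tgt x)
  unit : ∀ a, F₁ (𝒢.unit a) = ℋ.unit (F₀ a)
  mul : ∀ x y, 𝒢.src x = 𝒢.tgt y → F₁ (𝒢.mul x y) = ℋ.mul (F₁ x) (F₁ y)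
  inv : ∀ x, F₁ (𝒢.inv x) = ℋ.inv (F₁ x)

/-- The arrows in `S₁` form a subgroupoid with set of objects `S₀`. -/
structure IsSubgroupoid (𝒢 : GroupoidData M₁ M₀) (S₁ : Set M₁) (S₀ : Set M₀) : Prop where
  src_mem : ∀ x ∈ S₁, 𝒢.src x ∈ S₀
  tgt_mem : ∀ x ∈ S₁, 𝒢.tgt x ∈ S₀
  unit_mem : ∀ a ∈ S₀, 𝒢.unit a ∈ S₁
  mul_mem : ∀ x ∈ S₁, ∀ y ∈ S₁, 𝒢.src x = 𝒢.tgt y → 𝒢.mul x y ∈ S₁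
  inv_mem : ∀ x ∈ S₁, 𝒢.inv x ∈ S₁

/-- All structure maps are homomorphisms for binary operations on arrows and on objects, that is,
these operations are groupoid morphisms `𝒢 × 𝒢 → 𝒢`. -/
structure PreservesOp (𝒢 : GroupoidData M₁ M₀) (op₁ : M₁ → M₁ → M₁) (op₀ : M₀ → M₀ → M₀) :
    Prop where
  src : ∀ x y, 𝒢.src (op₁ x y) = op₀ (𝒢.src x) (𝒢.src y)
  tgt : ∀ x y, 𝒢.tgt (op₁ x y) = op₀ (𝒢.tgt x) (𝒢.tgt y)
  unit : ∀ a b, 𝒢.unit (op₀ a b) = op₁ (𝒢.unit a) (𝒢.unit b)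
  mul : ∀ x x' y y', 𝒢.src x = 𝒢.tgt x' → 𝒢.src y = 𝒢.tgt y' →
    𝒢.mul (op₁ x y) (op₁ x' y') = op₁ (𝒢.mul x x') (𝒢.mul y y')
  inv : ∀ x y, 𝒢.inv (op₁ x y) = op₁ (𝒢.inv x) (𝒢.inv y)

/-- The product groupoid. -/
def prod (𝒢 : GroupoidData M₁ M₀) (ℋ : GroupoidData N₁ N₀) :
    GroupoidData (M₁ × N₁) (M₀ × N₀) where
  src p := (𝒢.src p.1, ℋ.src p.2)
  tgt p := (𝒢.tgt p.1, ℋ.tgt p.2)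
  unit a := (𝒢.unit a.1, ℋ.unit a.2)
  mul p q := (𝒢.mul p.1 q.1, ℋ.mul p.2 q.2)
  inv p := (𝒢.inv p.1, ℋ.inv p.2)

/-- The action groupoid of a right action of a group `A` on `X`; the arrow `(x, g)` goes from `x`
to `x · g`. -/
def action {X A : Type*} [Group A] (act : X → A → X) : GroupoidData (X × A) X where
  src p := p.1
  tgt p := act p.1 p.2
  unit x := (x, 1)
  mul p q := (q.1, q.2 * p.2)
  inv p := (act p.1 p.2, p.2⁻¹)

end GroupoidData

/-! ### Lie groupoids

All manifolds below are finite-dimensional, smooth and without boundary. -/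

section Manifolds

variable {E₁ H₁ M₁ E₀ H₀ M₀ E₂ H₂ M₂ E₃ H₃ M₃ : Type*}
  [NormedAddCommGroup E₁] [NormedSpace ℝ E₁] [TopologicalSpace H₁]
  [TopologicalSpace M₁] [ChartedSpace H₁ M₁]
  [NormedAddCommGroup E₀] [NormedSpace ℝ E₀] [TopologicalSpace H₀]
  [TopologicalSpace M₀] [ChartedSpace H₀ M₀]
  [NormedAddCommGroup E₂] [NormedSpace ℝ E₂] [TopologicalSpace H₂]
  [TopologicalSpace M₂] [ChartedSpace H₂ M₂]
  [NormedAddCommGroup E₃] [NormedSpace ℝ E₃] [TopologicalSpace H₃]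
  [TopologicalSpace M₃] [ChartedSpace H₃ M₃]

/-- Smooth submersions (between finite-dimensional manifolds). -/
def IsSmoothSubmersion (I₁ : ModelWithCorners ℝ E₁ H₁) (I₀ : ModelWithCorners ℝ E₀ H₀)
    (f : M₁ → M₀) : Prop :=
  ContMDiff I₁ I₀ ∞ f ∧ ∀ x, Function.Surjective (mfderiv I₁ I₀ f x)

/-- Smooth immersions (between finite-dimensional manifolds). -/
def IsSmoothImmersion (I₁ : ModelWithCorners ℝ E₁ H₁) (I₀ : ModelWithCorners ℝ E₀ H₀)
    (f : M₁ → M₀) : Prop :=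
  ContMDiff I₁ I₀ ∞ f ∧ ∀ x, Function.Injective (mfderiv I₁ I₀ f x)

/-- A smooth groupoid: a groupoid in smooth (possibly non-Hausdorff) manifolds whose source map is
a submersion.  As the set of composable pairs is then an embedded submanifold of `M₁ × M₁`,
smoothness of the multiplication is smoothness on that subset. -/
structure IsSmoothGroupoid (I₁ : ModelWithCorners ℝ E₁ H₁) (I₀ : ModelWithCorners ℝ E₀ H₀)
    (𝒢 : GroupoidData M₁ M₀) : Prop where
  isGroupoid : 𝒢.IsGroupoid
  manifold_arrows : IsManifold I₁ ∞ M₁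
  manifold_objects : IsManifold I₀ ∞ M₀
  src_submersion : IsSmoothSubmersion I₁ I₀ 𝒢.src
  smooth_tgt : ContMDiff I₁ I₀ ∞ 𝒢.tgt
  smooth_unit : ContMDiff I₀ I₁ ∞ 𝒢.unit
  smooth_mul : ContMDiffOn (I₁.prod I₁) I₁ ∞ (fun p : M₁ × M₁ => 𝒢.mul p.1 p.2) 𝒢.composable
  smooth_inv : ContMDiff I₁ I₁ ∞ 𝒢.inv

/-- A Lie groupoid: a smooth groupoid whose base and source fibres are Hausdorff. -/
structure IsLieGroupoid (I₁ : ModelWithCorners ℝ E₁ H₁) (I₀ : ModelWithCorners ℝ E₀ H₀)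
    (𝒢 : GroupoidData M₁ M₀) : Prop extends IsSmoothGroupoid I₁ I₀ 𝒢 where
  hausdorff_base : T2Space M₀
  hausdorff_fibres : ∀ a : M₀, T2Space {x : M₁ // 𝒢.src x = a}

/-- A double Lie groupoid, that is, a square
`Q ⇉ M₁` (`top`), `Q ⇉ M₂` (`left`), `M₁ ⇉ M₀` (`right`), `M₂ ⇉ M₀` (`bottom`)
in which the structure maps of the horizontal groupoids are groupoid morphisms for the vertical
ones, the side groupoids are Lie groupoids, and the double source map
`Q → M₁ ×_{M₀} M₂` is a submersion. -/
structure IsDoubleLieGroupoid (I₃ : ModelWithCorners ℝ E₃ H₃) (I₁ : ModelWithCorners ℝ E₁ H₁)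
    (I₂ : ModelWithCorners ℝ E₂ H₂) (I₀ : ModelWithCorners ℝ E₀ H₀)
    (top : GroupoidData M₃ M₁) (left : GroupoidData M₃ M₂)
    (right : GroupoidData M₁ M₀) (bottom : GroupoidData M₂ M₀) : Prop where
  top_smooth : IsSmoothGroupoid I₃ I₁ top
  left_smooth : IsSmoothGroupoid I₃ I₂ left
  right_lie : IsLieGroupoid I₁ I₀ right
  bottom_lie : IsLieGroupoid I₂ I₀ bottom
  src_morphism : left.IsMorphism right top.src bottom.src
  tgt_morphism : left.IsMorphism right top.tgt bottom.tgt
  unit_morphism : right.IsMorphism left top.unit bottom.unit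
  inv_morphism : left.IsMorphism left top.inv bottom.inv
  mul_src : ∀ p q, top.src p = top.tgt q →
    left.src (top.mul p q) = bottom.mul (left.src p) (left.src q)
  mul_tgt : ∀ p q, top.src p = top.tgt q →
    left.tgt (top.mul p q) = bottom.mul (left.tgt p) (left.tgt q)
  mul_unit : ∀ a b, bottom.src a = bottom.tgt b →
    left.unit (bottom.mul a b) = top.mul (left.unit a) (left.unit b)
  interchange : ∀ p q p' q', top.src p = top.tgt q → top.src p' = top.tgt q' →
    left.src p = left.tgt p' → left.src q = left.tgt q' →
    left.mul (top.mul p q) (top.mul p' q') = top.mul (left.mul p p') (left.mul q q')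
  double_source : ∀ (q : M₃) (u : TangentSpace I₁ (top.src q)) (v : TangentSpace I₂ (left.src q)),
    (mfderiv I₁ I₀ right.src (top.src q) u : E₀) = (mfderiv I₂ I₀ bottom.src (left.src q) v : E₀) →
    ∃ w : TangentSpace I₃ q,
      mfderiv I₃ I₁ top.src q w = u ∧ mfderiv I₃ I₂ left.src q w = v

/-! ### Graphs of operations and coisotropy -/

/-- `γ` is smooth near `0` with `γ 0 = x` and `γ' 0 = v`. -/
def HasVelocity (I : ModelWithCorners ℝ E₁ H₁) (γ : ℝ → M₁) (x : M₁) (v : TangentSpace I x) :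
    Prop :=
  ContMDiffAt 𝓘(ℝ, ℝ) I ∞ γ 0 ∧ γ 0 = x ∧ (mfderiv 𝓘(ℝ, ℝ) I γ 0 (1 : ℝ) : E₁) = v

/-- `(u, v, w)` is tangent at `(x, y, op x y)` to the graph
`{(x, y, op x y) | (x, y) ∈ C} ⊆ M × M × M`: it is the velocity of a smooth curve in the graph. -/
def GraphTangent (I : ModelWithCorners ℝ E₁ H₁) (op : M₁ → M₁ → M₁) (C : Set (M₁ × M₁)) (x y : M₁)
    (u : TangentSpace I x) (v : TangentSpace I y) (w : TangentSpace I (op x y)) : Prop :=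
  ∃ γ₁ γ₂ : ℝ → M₁, HasVelocity I γ₁ x u ∧ HasVelocity I γ₂ y v ∧
    (∀ᶠ τ in 𝓝 (0 : ℝ), (γ₁ τ, γ₂ τ) ∈ C) ∧
    HasVelocity I (fun τ => op (γ₁ τ) (γ₂ τ)) (op x y) w

/-- Fields of linear maps `Π♯ : T*M → TM`. -/
abbrev SharpField (I : ModelWithCorners ℝ E₁ H₁) (M₁ : Type*) [TopologicalSpace M₁]
    [ChartedSpace H₁ M₁] :=
  ∀ x : M₁, (TangentSpace I x →L[ℝ] ℝ) →ₗ[ℝ] TangentSpace I x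

/-- The graph of `op` on `C` is coisotropic in `(M × M × M, Π ⊕ Π ⊖ Π)`: whenever the covector
`(ξ, η, ζ)` annihilates the tangent space of the graph, `(Π♯ξ, Π♯η, -Π♯ζ)` is tangent to it. -/
def IsCoisotropicGraph (I : ModelWithCorners ℝ E₁ H₁) (P : SharpField I M₁)
    (op : M₁ → M₁ → M₁) (C : Set (M₁ × M₁)) : Prop :=
  ∀ x y, (x, y) ∈ C → ∀ (ξ : TangentSpace I x →L[ℝ] ℝ) (η : TangentSpace I y →L[ℝ] ℝ)
    (ζ : TangentSpace I (op x y) →L[ℝ] ℝ),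
    (∀ u v w, GraphTangent I op C x y u v w → ξ u + η v + ζ w = 0) →
    GraphTangent I op C x y (P x ξ) (P y η) (-(P (op x y) ζ))

/-! ### Poisson structures -/

/-- The differential of a real function. -/
def differential (I : ModelWithCorners ℝ E₁ H₁) (f : M₁ → ℝ) (x : M₁) : TangentSpace I x →L[ℝ] ℝ :=
  (mfderiv I 𝓘(ℝ, ℝ) f x : TangentSpace I x →L[ℝ] TangentSpace 𝓘(ℝ, ℝ) (f x))

/-- The bracket `{f, g} = dg (Π♯ df) = Π (df, dg)`. -/
def poissonBracket {I : ModelWithCorners ℝ E₁ H₁} (P : SharpField I M₁) (f g : M₁ → ℝ) (x : M₁) :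
    ℝ :=
  differential I g x (P x (differential I f x))

/-- `Π♯` is the contraction map of a Poisson bivector field (on a Hausdorff manifold).  The Leibniz
rule is automatic for `poissonBracket`. -/
structure IsPoisson (I : ModelWithCorners ℝ E₁ H₁) (P : SharpField I M₁) : Prop where
  skew : ∀ x (ξ η : TangentSpace I x →L[ℝ] ℝ), η (P x ξ) = -(ξ (P x η))
  smooth : ∀ f g : M₁ → ℝ, ContMDiff I 𝓘(ℝ, ℝ) ∞ f → ContMDiff I 𝓘(ℝ, ℝ) ∞ g →
    ContMDiff I 𝓘(ℝ, ℝ) ∞ (poissonBracket P f g)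
  jacobi : ∀ f g h : M₁ → ℝ, ContMDiff I 𝓘(ℝ, ℝ) ∞ f → ContMDiff I 𝓘(ℝ, ℝ) ∞ g →
    ContMDiff I 𝓘(ℝ, ℝ) ∞ h → ∀ x,
    poissonBracket P f (poissonBracket P g h) x + poissonBracket P g (poissonBracket P h f) x +
      poissonBracket P h (poissonBracket P f g) x = 0

/-- `F` is smooth and maps the first bivector field to the second one. -/
def IsPoissonMap (I₁ : ModelWithCorners ℝ E₁ H₁) (I₀ : ModelWithCorners ℝ E₀ H₀)
    (P₁ : SharpField I₁ M₁) (P₀ : SharpField I₀ M₀) (F : M₁ → M₀) : Prop :=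
  ContMDiff I₁ I₀ ∞ F ∧ ∀ x (η : TangentSpace I₀ (F x) →L[ℝ] ℝ),
    mfderiv I₁ I₀ F x (P₁ x (η.comp (mfderiv I₁ I₀ F x))) = P₀ (F x) η

/-- A Poisson groupoid: a Lie groupoid with a Poisson structure on the arrows for which the graph
of the multiplication is coisotropic in `M₁ × M₁ × M₁⁻`. -/
structure IsPoissonGroupoid (I₁ : ModelWithCorners ℝ E₁ H₁) (I₀ : ModelWithCorners ℝ E₀ H₀)
    (𝒢 : GroupoidData M₁ M₀) (P : SharpField I₁ M₁) : Prop where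
  lie : IsLieGroupoid I₁ I₀ 𝒢
  poisson : IsPoisson I₁ P
  coisotropic : IsCoisotropicGraph I₁ P 𝒢.mul 𝒢.composable

/-- A Poisson 2-group whose group structures are written additively: a Lie 2-group that is a
Poisson groupoid and whose group of arrows is a Poisson group (a Poisson groupoid over a point)
for the same bivector field. -/
structure IsAddPoissonTwoGroup [AddGroup M₁] [AddGroup M₀] (I₁ : ModelWithCorners ℝ E₁ H₁)
    (I₀ : ModelWithCorners ℝ E₀ H₀) (𝒢 : GroupoidData M₁ M₀) (P : SharpField I₁ M₁) : Prop where
  lieGroup_arrows : LieAddGroup I₁ ∞ M₁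
  lieGroup_objects : LieAddGroup I₀ ∞ M₀
  preserves_add : 𝒢.PreservesOp (· + ·) (· + ·)
  poissonGroupoid : IsPoissonGroupoid I₁ I₀ 𝒢 P
  poissonGroup : IsCoisotropicGraph I₁ P (· + ·) Set.univ

/-! ### Symplectic forms and symplectic groupoids -/

/-- Fields of alternating 2-forms on the tangent spaces. -/
abbrev TwoForm (I : ModelWithCorners ℝ E₁ H₁) (M₁ : Type*) [TopologicalSpace M₁]
    [ChartedSpace H₁ M₁] :=
  ∀ x : M₁, TangentSpace I x [⋀^Fin 2]→L[ℝ] ℝ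

/-- The expression of a 2-form in the preferred chart at `x₀`. -/
def chartForm (I : ModelWithCorners ℝ E₁ H₁) (Ω : TwoForm I M₁) (x₀ : M₁) (y : E₁) :
    E₁ [⋀^Fin 2]→L[ℝ] ℝ :=
  (Ω ((extChartAt I x₀).symm y)).compContinuousLinearMap
    (mfderiv 𝓘(ℝ, E₁) I (extChartAt I x₀).symm y : TangentSpace 𝓘(ℝ, E₁) y →L[ℝ] _)

/-- Smooth, closed and nondegenerate. -/
structure IsSymplectic (I : ModelWithCorners ℝ E₁ H₁) (Ω : TwoForm I M₁) : Prop where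
  smooth : ∀ x₀, ContDiffOn ℝ ∞ (chartForm I Ω x₀) (extChartAt I x₀).target
  closed : ∀ x₀, ∀ y ∈ (extChartAt I x₀).target, extDeriv (chartForm I Ω x₀) y = 0
  nondegenerate : ∀ x (u : TangentSpace I x), (∀ v, Ω x ![u, v] = 0) → u = 0

/-- `P` is the Poisson structure induced by the symplectic form `Ω`, with the sign for which
`Ω (Π♯ξ, Π♯η) = Π (ξ, η) = η (Π♯ξ)`. -/
def IsInverse (I : ModelWithCorners ℝ E₁ H₁) (Ω : TwoForm I M₁) (P : SharpField I M₁) : Prop :=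
  ∀ x (ξ : TangentSpace I x →L[ℝ] ℝ) (v : TangentSpace I x), Ω x ![P x ξ, v] = -(ξ v)

/-- A symplectic groupoid: a Lie groupoid whose arrows carry a symplectic form `Ω`, with induced
Poisson structure `P`, such that the graph of the multiplication is coisotropic in
`M₁ × M₁ × M₁⁻`; moreover `Ω` is multiplicative, `mul^* Ω = pr₁^* Ω + pr₂^* Ω`. -/
structure IsSymplecticGroupoid (I₁ : ModelWithCorners ℝ E₁ H₁) (I₀ : ModelWithCorners ℝ E₀ H₀)
    (𝒢 : GroupoidData M₁ M₀) (Ω : TwoForm I₁ M₁) (P : SharpField I₁ M₁) : Prop where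
  lie : IsLieGroupoid I₁ I₀ 𝒢
  symplectic : IsSymplectic I₁ Ω
  inverse : IsInverse I₁ Ω P
  coisotropic : IsCoisotropicGraph I₁ P 𝒢.mul 𝒢.composable
  multiplicative : ∀ x y, (x, y) ∈ 𝒢.composable → ∀ u v w u' v' w',
    GraphTangent I₁ 𝒢.mul 𝒢.composable x y u v w →
    GraphTangent I₁ 𝒢.mul 𝒢.composable x y u' v' w' →
    Ω (𝒢.mul x y) ![w, w'] = Ω x ![u, u'] + Ω y ![v, v']

end Manifolds

/-! ### Orbits -/

/-- The orbit of `x₀` under a right action, as a bare type without a topology. -/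
structure Orbit {X A : Type*} (act : X → A → X) (x₀ : X) where
  val : X
  mem : ∃ g, act x₀ g = val

/-- The orbit map `g ↦ x₀ · g`. -/
def orbitMap {X A : Type*} (act : X → A → X) (x₀ : X) (g : A) : Orbit act x₀ := ⟨act x₀ g, g, rfl⟩

/-- The given topology and charts are the canonical ones of the orbit of a Lie group action, for
which the orbit map is a submersion and the orbit is an immersed submanifold. -/
structure IsOrbitManifold {E G F : Type*} [NormedAddCommGroup E] [NormedSpace ℝ E]
    [TopologicalSpace G] [ChartedSpace E G] [NormedAddCommGroup F] [NormedSpace ℝ F]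
    (act : F → G → F) (x₀ : F) (d : ℕ) [TopologicalSpace (Orbit act x₀)]
    [ChartedSpace (EuclideanSpace ℝ (Fin d)) (Orbit act x₀)] : Prop where
  manifold : IsManifold (𝓡 d) ∞ (Orbit act x₀)
  hausdorff : T2Space (Orbit act x₀)
  orbitMap_submersion : IsSmoothSubmersion 𝓘(ℝ, E) (𝓡 d) (orbitMap act x₀)
  val_immersion : IsSmoothImmersion (𝓡 d) 𝓘(ℝ, F) (Orbit.val : Orbit act x₀ → F)

/-! ### The Lie algebra of a Lie group and its dual

The Lie algebra of a Lie group `G` modelled on `E` is Mathlib's `GroupLieAlgebra`, the tangent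
space at `1`, whose underlying vector space is `E`; we identify the two. -/

section LieAlgebra

variable {E : Type*} [NormedAddCommGroup E] [NormedSpace ℝ E] [FiniteDimensional ℝ E]

/-- The canonical isomorphism from the bidual of a finite-dimensional space to the space. -/
def predual (E : Type*) [NormedAddCommGroup E] [NormedSpace ℝ E] [FiniteDimensional ℝ E] :
    ((E →L[ℝ] ℝ) →L[ℝ] ℝ) ≃ₗ[ℝ] E :=
  (LinearEquiv.ofInjectiveOfFinrankEq
    (NormedSpace.inclusionInDoubleDual ℝ E : E →ₗ[ℝ] StrongDual ℝ (StrongDual ℝ E))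
    (NormedSpace.inclusionInDoubleDualLi (E := E) ℝ).injective
    (by
      have h : ∀ (F : Type _) [NormedAddCommGroup F] [NormedSpace ℝ F] [FiniteDimensional ℝ F],
          Module.finrank ℝ (StrongDual ℝ F) = Module.finrank ℝ F := fun F _ _ _ =>
        ((LinearMap.toContinuousLinearMap (𝕜 := ℝ) (E := F) (F' := ℝ)).finrank_eq).symm.trans
          Subspace.dual_finrank_eq
      rw [h, h])).symm

theorem predual_spec (Φ : (E →L[ℝ] ℝ) →L[ℝ] ℝ) (ξ : E →L[ℝ] ℝ) : ξ (predual E Φ) = Φ ξ :=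
  DFunLike.congr_fun ((predual E).symm_apply_apply Φ) ξ

variable (G : Type*) [TopologicalSpace G] [ChartedSpace E G] [Group G] [LieGroup 𝓘(ℝ, E) ∞ G]

/-- The bracket of the Lie algebra of `G`. -/
def bracket : E →ₗ[ℝ] E →ₗ[ℝ] E :=
  haveI : CompleteSpace E := FiniteDimensional.complete ℝ E
  haveI : LieGroup 𝓘(ℝ, E) (minSmoothness ℝ 3) G := LieGroup.of_le (n := ∞) (by simpa using ENat.LEInfty.out)
  (LinearMap.mk₂ ℝ (fun X Y : GroupLieAlgebra 𝓘(ℝ, E) G => ⁅X, Y⁆)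
    add_lie smul_lie lie_add lie_smul :
    GroupLieAlgebra 𝓘(ℝ, E) G →ₗ[ℝ] GroupLieAlgebra 𝓘(ℝ, E) G →ₗ[ℝ] GroupLieAlgebra 𝓘(ℝ, E) G)

/-- `ξ ∘ ad_X`, the infinitesimal right coadjoint action. -/
def coad (ξ : E →L[ℝ] ℝ) (X : E) : E →L[ℝ] ℝ :=
  ξ.comp (LinearMap.toContinuousLinearMap (bracket (E := E) G X))

variable {G}

/-- The adjoint action of `g` on the Lie algebra. -/
def Ad (g : G) : E →L[ℝ] E := mfderiv 𝓘(ℝ, E) 𝓘(ℝ, E) (fun x : G => g * x * g⁻¹) 1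

/-- The right coadjoint action `ξ · g = ξ ∘ Ad_g`. -/
def coAd (ξ : E →L[ℝ] ℝ) (g : G) : E →L[ℝ] ℝ := ξ.comp (Ad g)

variable (G)

/-- The Lie–Poisson structure on `𝔤^*`: at `ξ` it maps `X ∈ 𝔤 ≅ T^*_ξ 𝔤^*` to `ξ ∘ ad_X`, so that
`{f, g} (ξ) = ξ ([df, dg])`. -/
def liePoisson : SharpField 𝓘(ℝ, E →L[ℝ] ℝ) (E →L[ℝ] ℝ) := fun ξ =>
  ({ toFun := fun Φ => coad G ξ (predual E Φ)
     map_add' := fun Φ Ψ => by ext; simp [coad]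
     map_smul' := fun c Φ => by ext; simp [coad] } :
    ((E →L[ℝ] ℝ) →L[ℝ] ℝ) →ₗ[ℝ] (E →L[ℝ] ℝ))

variable {G}

/-- `Ω` is the Kostant–Kirillov–Souriau form of the coadjoint orbit of `ξ₀`: the tangent space at `ξ`
consists of the vectors `ξ ∘ ad_X`, and `Ω (ξ ∘ ad_X, ξ ∘ ad_Y) = ξ ([X, Y])`. -/
structure IsKKSForm (ξ₀ : E →L[ℝ] ℝ) {d : ℕ}
    [TopologicalSpace (Orbit (coAd (G := G)) ξ₀)]
    [ChartedSpace (EuclideanSpace ℝ (Fin d)) (Orbit (coAd (G := G)) ξ₀)]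
    (Ω : TwoForm (𝓡 d) (Orbit (coAd (G := G)) ξ₀)) : Prop where
  tangent : ∀ x : Orbit (coAd (G := G)) ξ₀,
    Set.range (fun u : TangentSpace (𝓡 d) x =>
      (mfderiv (𝓡 d) 𝓘(ℝ, E →L[ℝ] ℝ) Orbit.val x u : E →L[ℝ] ℝ)) = Set.range (coad G x.val)
  formula : ∀ (x : Orbit (coAd (G := G)) ξ₀) (X Y : E) (u v : TangentSpace (𝓡 d) x),
    mfderiv (𝓡 d) 𝓘(ℝ, E →L[ℝ] ℝ) Orbit.val x u = coad G x.val X →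
    mfderiv (𝓡 d) 𝓘(ℝ, E →L[ℝ] ℝ) Orbit.val x v = coad G x.val Y →
    Ω x ![u, v] = x.val (bracket G X Y)

end LieAlgebra

/-! ### Lie 2-groups and the dual of the Lie 2-algebra -/

/-- A strict Lie 2-group: a groupoid object in the category of Lie groups. -/
structure LieTwoGroup (E₁ G₁ E₀ G₀ : Type*)
    [NormedAddCommGroup E₁] [NormedSpace ℝ E₁] [TopologicalSpace G₁] [ChartedSpace E₁ G₁]
    [Group G₁] [LieGroup 𝓘(ℝ, E₁) ∞ G₁]
    [NormedAddCommGroup E₀] [NormedSpace ℝ E₀] [TopologicalSpace G₀] [ChartedSpace E₀ G₀]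
    [Group G₀] [LieGroup 𝓘(ℝ, E₀) ∞ G₀] extends GroupoidData G₁ G₀ where
  lie : IsLieGroupoid 𝓘(ℝ, E₁) 𝓘(ℝ, E₀) toGroupoidData
  preserves_mul : toGroupoidData.PreservesOp (· * ·) (· * ·)

namespace LieTwoGroup

variable {E₁ G₁ E₀ G₀ : Type*}
  [NormedAddCommGroup E₁] [NormedSpace ℝ E₁] [TopologicalSpace G₁] [ChartedSpace E₁ G₁]
  [Group G₁] [LieGroup 𝓘(ℝ, E₁) ∞ G₁]
  [NormedAddCommGroup E₀] [NormedSpace ℝ E₀] [TopologicalSpace G₀] [ChartedSpace E₀ G₀]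
  [Group G₀] [LieGroup 𝓘(ℝ, E₀) ∞ G₀]
  (𝒢 : LieTwoGroup E₁ G₁ E₀ G₀)

/-- Source map of the Lie 2-algebra. -/
def dsrc : E₁ →L[ℝ] E₀ := mfderiv 𝓘(ℝ, E₁) 𝓘(ℝ, E₀) 𝒢.src 1

/-- Target map of the Lie 2-algebra. -/
def dtgt : E₁ →L[ℝ] E₀ := mfderiv 𝓘(ℝ, E₁) 𝓘(ℝ, E₀) 𝒢.tgt 1

/-- Unit map of the Lie 2-algebra. -/
def dunit : E₀ →L[ℝ] E₁ := mfderiv 𝓘(ℝ, E₀) 𝓘(ℝ, E₁) 𝒢.unit 1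

theorem unit_one : 𝒢.unit 1 = 1 := by
  have h := 𝒢.preserves_mul.unit 1 1
  simpa using h

theorem src_one : 𝒢.src 1 = 1 := by
  have h := 𝒢.preserves_mul.src 1 1
  simpa using h

theorem src_inv_mul (x : G₁) : 𝒢.src x⁻¹ = (𝒢.src x)⁻¹ := by
  have h := 𝒢.preserves_mul.src x⁻¹ x
  simp only [inv_mul_cancel, 𝒢.src_one] at h
  exact eq_inv_of_mul_eq_one_left h.symm

theorem dsrc_dunit (x : E₀) : 𝒢.dsrc (𝒢.dunit x) = x := by
  have h₁ : MDifferentiableAt 𝓘(ℝ, E₁) 𝓘(ℝ, E₀) 𝒢.src (𝒢.unit 1) :=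
    (𝒢.lie.src_submersion.1 _).mdifferentiableAt (by simp)
  have h₂ : MDifferentiableAt 𝓘(ℝ, E₀) 𝓘(ℝ, E₁) 𝒢.unit 1 :=
    (𝒢.lie.smooth_unit _).mdifferentiableAt (by simp)
  have h := mfderiv_comp (1 : G₀) h₁ h₂
  have hid : 𝒢.src ∘ 𝒢.unit = id := funext 𝒢.lie.isGroupoid.src_unit
  rw [hid, mfderiv_id] at h
  have h' := congrArg (fun L : E₀ →L[ℝ] E₀ => L x) h
  have e : (mfderiv 𝓘(ℝ, E₁) 𝓘(ℝ, E₀) 𝒢.src (𝒢.unit 1) : E₁ →L[ℝ] E₀) = 𝒢.dsrc := by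
    rw [𝒢.unit_one]; rfl
  exact (h'.trans (congrArg (fun L : E₁ →L[ℝ] E₀ => L (𝒢.dunit x)) e)).symm

theorem dsrc_Ad (g : G₁) (X : E₁) : 𝒢.dsrc (Ad g X) = Ad (𝒢.src g) (𝒢.dsrc X) := by
  have hs : ∀ x, MDifferentiableAt 𝓘(ℝ, E₁) 𝓘(ℝ, E₀) 𝒢.src x := fun x =>
    (𝒢.lie.src_submersion.1 x).mdifferentiableAt (by simp)
  have hc₁ : MDifferentiableAt 𝓘(ℝ, E₁) 𝓘(ℝ, E₁) (fun x : G₁ => g * x * g⁻¹) 1 :=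
    ((contMDiff_const.mul contMDiff_id).mul contMDiff_const :
      ContMDiff 𝓘(ℝ, E₁) 𝓘(ℝ, E₁) ∞ (fun x : G₁ => g * x * g⁻¹)).contMDiffAt.mdifferentiableAt
        (by simp)
  have hc₀ : ∀ y, MDifferentiableAt 𝓘(ℝ, E₀) 𝓘(ℝ, E₀)
      (fun y : G₀ => 𝒢.src g * y * (𝒢.src g)⁻¹) y := fun y =>
    ((contMDiff_const.mul contMDiff_id).mul contMDiff_const :
      ContMDiff 𝓘(ℝ, E₀) 𝓘(ℝ, E₀) ∞
        (fun y : G₀ => 𝒢.src g * y * (𝒢.src g)⁻¹)).contMDiffAt.mdifferentiableAt (by simp)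
  have hcomp : 𝒢.src ∘ (fun x : G₁ => g * x * g⁻¹) =
      (fun y : G₀ => 𝒢.src g * y * (𝒢.src g)⁻¹) ∘ 𝒢.src := by
    funext x
    have h₁ := 𝒢.preserves_mul.src (g * x) g⁻¹
    have h₂ := 𝒢.preserves_mul.src g x
    simp only [Function.comp_apply]
    rw [h₁, h₂, 𝒢.src_inv_mul]
  have hl := mfderiv_comp (1 : G₁) (hs _) hc₁
  have hr := mfderiv_comp (1 : G₁) (hc₀ _) (hs 1)
  have e₁ : (mfderiv 𝓘(ℝ, E₁) 𝓘(ℝ, E₀) 𝒢.src (g * 1 * g⁻¹) : E₁ →L[ℝ] E₀) = 𝒢.dsrc := by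
    rw [show g * 1 * g⁻¹ = 1 by group]; rfl
  have e₂ : (mfderiv 𝓘(ℝ, E₀) 𝓘(ℝ, E₀) (fun y : G₀ => 𝒢.src g * y * (𝒢.src g)⁻¹) (𝒢.src 1) :
      E₀ →L[ℝ] E₀) = Ad (E := E₀) (𝒢.src g) := by
    rw [𝒢.src_one]; rfl
  have hl' := congrArg (fun L : E₁ →L[ℝ] E₀ => L X) hl
  have hr' := congrArg (fun L : E₁ →L[ℝ] E₀ => L X) hr
  have hm := congrArg (fun f : G₁ → G₀ => (mfderiv 𝓘(ℝ, E₁) 𝓘(ℝ, E₀) f 1 : E₁ →L[ℝ] E₀) X) hcomp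
  have k₁ := congrArg (fun L : E₁ →L[ℝ] E₀ => L (Ad g X)) e₁
  have k₂ := congrArg (fun L : E₀ →L[ℝ] E₀ => L (𝒢.dsrc X)) e₂
  exact k₁.symm.trans (hl'.symm.trans (hm.trans (hr'.trans k₂)))

/-- The ideal `𝔥 = ker ds` of the Lie algebra of `G₁`. -/
abbrev core : Submodule ℝ E₁ := LinearMap.ker (𝒢.dsrc : E₁ →ₗ[ℝ] E₀)

/-- The projection of `𝔤₁ = 𝔥 ⋊ 𝔤` onto `𝔥`. -/
def proj : E₁ →L[ℝ] 𝒢.core :=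
  (ContinuousLinearMap.id ℝ E₁ - 𝒢.dunit.comp 𝒢.dsrc).codRestrict 𝒢.core (fun X => by
    simp [𝒢.dsrc_dunit])

/-- The crossed module morphism `φ : 𝔥 → 𝔤`, the restriction of the target map. -/
def phi : 𝒢.core →L[ℝ] E₀ := 𝒢.dtgt.comp 𝒢.core.subtypeL

/-- The functional `(α, θ) ∈ 𝔥^* × 𝔤^* ≅ 𝔤₁^*`. -/
def pair (α : 𝒢.core →L[ℝ] ℝ) (θ : E₀ →L[ℝ] ℝ) : E₁ →L[ℝ] ℝ := α.comp 𝒢.proj + θ.comp 𝒢.dsrc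

/-- The component `α` of `ξ = (α, θ)`. -/
def fstComp (ξ : E₁ →L[ℝ] ℝ) : 𝒢.core →L[ℝ] ℝ := ξ.comp 𝒢.core.subtypeL

/-- The component `θ` of `ξ = (α, θ)`. -/
def sndComp (ξ : E₁ →L[ℝ] ℝ) : E₀ →L[ℝ] ℝ := ξ.comp 𝒢.dunit

/-- The dual `𝔊^*` of the Lie 2-algebra: arrows `(α, θ) ∈ 𝔤₁^*`, objects `𝔥^*`,
`s (α, θ) = α - φ^* θ`, `t (α, θ) = α`, and `(α, θ) (α', θ') = (α, θ + θ')`. -/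
def dual : GroupoidData (E₁ →L[ℝ] ℝ) (𝒢.core →L[ℝ] ℝ) where
  src ξ := 𝒢.fstComp ξ - (𝒢.sndComp ξ).comp 𝒢.phi
  tgt ξ := 𝒢.fstComp ξ
  unit α := 𝒢.pair α 0
  mul ξ η := 𝒢.pair (𝒢.fstComp ξ) (𝒢.sndComp ξ + 𝒢.sndComp η)
  inv ξ := 𝒢.pair (𝒢.fstComp ξ - (𝒢.sndComp ξ).comp 𝒢.phi) (-(𝒢.sndComp ξ))

/-- The action of `g : G₀` on `𝔥`, by the adjoint action of the unit at `g`. -/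
def coreAct (g : G₀) : 𝒢.core →L[ℝ] 𝒢.core :=
  ((Ad (𝒢.unit g)).comp 𝒢.core.subtypeL).codRestrict 𝒢.core (fun a => by
    have ha : 𝒢.dsrc (a : E₁) = 0 := a.2
    simp [𝒢.dsrc_Ad, ha])

/-- The dual right action of `G₀` on `𝔥^*`. -/
def coreCoAct (α : 𝒢.core →L[ℝ] ℝ) (g : G₀) : 𝒢.core →L[ℝ] ℝ := α.comp (𝒢.coreAct g)

variable [FiniteDimensional ℝ E₁]

/-- The Lie–Poisson structure on `𝔥^*`.  The ideal `𝔥 ⊆ 𝔤₁` is closed under the bracket, so that the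
projection onto `𝔥` does nothing here. -/
def liePoissonCore : SharpField 𝓘(ℝ, 𝒢.core →L[ℝ] ℝ) (𝒢.core →L[ℝ] ℝ) := fun α =>
  ({ toFun := fun Φ =>
      𝒢.fstComp (coad G₁ (α.comp 𝒢.proj) (predual 𝒢.core Φ : E₁))
     map_add' := fun Φ Ψ => by ext; simp [coad, fstComp]
     map_smul' := fun c Φ => by ext; simp [coad, fstComp] } :
    ((𝒢.core →L[ℝ] ℝ) →L[ℝ] ℝ) →ₗ[ℝ] (𝒢.core →L[ℝ] ℝ))

end LieTwoGroup

end LieTwo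

end

open LieTwo

/-! Algebra. The interchange law makes `ker s` and `ker t` commute inside `G₁` and expresses the
groupoid product by the group product, `g ∘ h = g u(t h)⁻¹ h` (`commute_of_src_of_tgt`, `mul_eq`).
Differentiating gives `[ker dt, ker ds] = 0` (`bracket_sub_utgt_sub_usrc`). Everything is then read
on `𝔤₁` through the endomorphisms `usrc = u ∘ s` and `utgt = u ∘ t`. Composable elements, `usrc A =
utgt B`, have the product `A ∗ B = A + B - utgt B`, and functionals multiply by `x y = x + y ∘
usrc`. For composable arguments, pairing is additive, `(x y)(A ∗ B) = x A + y B`, and `∗` respects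
brackets, `[A ∗ B, A' ∗ B'] = [A, A'] ∗ [B, B']`; the second fact uses the commuting kernels. Hence
`(x y)[A ∗ B, A' ∗ B'] = x[A, A'] + y[B, B']` (`dual_mul_bracket_star`). This is multiplicativity of
the Kostant–Kirillov–Souriau form. Tested on enough composable pairs it also yields coisotropy of
the graph, on `𝔤₁^*` and on the orbits alike (`coad_of_annihilates`).

The group-level counterpart is `dual_mul_coAd`: the coadjoint action is multiplicative. It is the
essential axiom of the double groupoid. It also shows that the orbit of `1_α` is closed under
multiplication: if `1_α · g` and `1_α · h` are composable, then `k = s(g) t(h)⁻¹` fixes `α`, so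
`u(k)` fixes `1_α`, and `h` may be replaced by `u(k) h`, which is composable with `g`
(`exists_composable`). The infinitesimal version is `exists_coad_eq_zero`. These two arguments are
where it matters that the orbit passes through a unit.

Analysis. The bracket comes from left-invariant vector fields, so it must be identified with the
derivative of `Ad` (`tder_Ad_one`). The orbits become manifolds by the constant rank theorem
(`exists_section_of_constant_rank`), and local sections of the orbit map turn smoothness on an orbit
into smoothness on the group. The orbit form is closed because its exterior derivative, evaluated
with lifts of the infinitesimal action, reduces to the Jacobi identity
(`IsCoadParam.extDeriv_eq_zero`). -/

theorem natCast_le_infty (n : ℕ) : (n : ℕ∞ω) ≤ ∞ := by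
  exact_mod_cast (le_top : (n : ℕ∞) ≤ ⊤)

theorem one_add_one_le_infty : (1 + 1 : ℕ∞ω) ≤ ∞ := by
  rw [one_add_one_eq_two]; exact natCast_le_infty 2

/-! ### Derivatives of maps between manifolds, read in the model spaces. -/

section TangentMaps

variable {E H M E' H' M' E'' H'' M'' : Type*}
  [NormedAddCommGroup E] [NormedSpace ℝ E] [TopologicalSpace H]
  [TopologicalSpace M] [ChartedSpace H M]
  [NormedAddCommGroup E'] [NormedSpace ℝ E'] [TopologicalSpace H']
  [TopologicalSpace M'] [ChartedSpace H' M']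
  [NormedAddCommGroup E''] [NormedSpace ℝ E''] [TopologicalSpace H'']
  [TopologicalSpace M''] [ChartedSpace H'' M'']
  {I : ModelWithCorners ℝ E H} {I' : ModelWithCorners ℝ E' H'} {I'' : ModelWithCorners ℝ E'' H''}

/-- The derivative of a map between manifolds, as a map between the model vector spaces. -/
noncomputable def tder (I : ModelWithCorners ℝ E H) (I' : ModelWithCorners ℝ E' H') (f : M → M')
    (x : M) : E →L[ℝ] E' :=
  mfderiv I I' f x

/-- The base point `y` of the outer derivative is a separate variable, so the chain rule also
applies when `f x` equals `y` only propositionally. -/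
theorem tder_comp {f : M → M'} {g : M' → M''} {x : M} {y : M'} (h : f x = y)
    (hg : MDifferentiableAt I' I'' g y) (hf : MDifferentiableAt I I' f x) :
    tder I I'' (fun z => g (f z)) x = (tder I' I'' g y).comp (tder I I' f x) := by
  subst h
  exact mfderiv_comp x hg hf

theorem tder_congr {f g : M → M'} {x : M} (h : f =ᶠ[𝓝 x] g) :
    tder I I' f x = tder I I' g x := by
  have := h.mfderiv_eq (I := I) (I' := I')
  exact this

theorem tder_id (x : M) : tder I I (fun z : M => z) x = ContinuousLinearMap.id ℝ E :=
  mfderiv_id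

theorem tder_const (x : M) (y : M') : tder I I' (fun _ : M => y) x = 0 :=
  mfderiv_const

theorem tder_eq_fderiv (f : E → E') (x : E) : tder 𝓘(ℝ, E) 𝓘(ℝ, E') f x = fderiv ℝ f x :=
  mfderiv_eq_fderiv

theorem tder_prodMk {f : M → M'} {g : M → M''} {x : M}
    (hf : MDifferentiableAt I I' f x) (hg : MDifferentiableAt I I'' g x) :
    tder I (I'.prod I'') (fun z => (f z, g z)) x = (tder I I' f x).prod (tder I I'' g x) :=
  (hf.hasMFDerivAt.prodMk hg.hasMFDerivAt).mfderiv

theorem tder_prod {f : M × M' → M''} {p : M × M'} (hf : MDifferentiableAt (I.prod I') I'' f p)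
    (u : E) (v : E') :
    tder (I.prod I') I'' f p (u, v) =
      tder I I'' (fun z => f (z, p.2)) p.1 u + tder I' I'' (fun z => f (p.1, z)) p.2 v :=
  mfderiv_prod_eq_add_apply hf (v := (u, v))

end TangentMaps

/-! ### The adjoint representation and Lie groups in the chart at the identity. -/

section LieGroups

variable {E G E' G' : Type*} [NormedAddCommGroup E] [NormedSpace ℝ E]
  [TopologicalSpace G] [ChartedSpace E G] [Group G] [LieGroup 𝓘(ℝ, E) ∞ G]
  [NormedAddCommGroup E'] [NormedSpace ℝ E']
  [TopologicalSpace G'] [ChartedSpace E' G'] [Group G'] [LieGroup 𝓘(ℝ, E') ∞ G']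

theorem ContMDiff.mdAt {E H M E' H' M' : Type*}
    [NormedAddCommGroup E] [NormedSpace ℝ E] [TopologicalSpace H]
    [TopologicalSpace M] [ChartedSpace H M]
    [NormedAddCommGroup E'] [NormedSpace ℝ E'] [TopologicalSpace H']
    [TopologicalSpace M'] [ChartedSpace H' M']
    {I : ModelWithCorners ℝ E H} {I' : ModelWithCorners ℝ E' H'} {f : M → M'}
    (hf : ContMDiff I I' ∞ f) (x : M) : MDifferentiableAt I I' f x :=
  (hf x).mdifferentiableAt (by simp)

theorem contMDiff_mulLeft (g : G) : ContMDiff 𝓘(ℝ, E) 𝓘(ℝ, E) ∞ (fun x : G => g * x) :=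
  contMDiff_const.mul contMDiff_id

theorem contMDiff_conj : ContMDiff (𝓘(ℝ, E).prod 𝓘(ℝ, E)) 𝓘(ℝ, E) ∞
    (fun p : G × G => p.1 * p.2 * p.1⁻¹) :=
  (contMDiff_fst.mul contMDiff_snd).mul contMDiff_fst.inv

theorem contMDiff_conj_right (g : G) : ContMDiff 𝓘(ℝ, E) 𝓘(ℝ, E) ∞ (fun x : G => g * x * g⁻¹) :=
  (contMDiff_const.mul contMDiff_id).mul contMDiff_const

omit [LieGroup 𝓘(ℝ, E) ∞ G] in
theorem Ad_eq (g : G) : Ad (E := E) g = tder 𝓘(ℝ, E) 𝓘(ℝ, E) (fun x : G => g * x * g⁻¹) 1 := rfl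

omit [LieGroup 𝓘(ℝ, E) ∞ G] in
theorem Ad_one : Ad (E := E) (1 : G) = ContinuousLinearMap.id ℝ E := by
  rw [Ad_eq]
  simpa using tder_id (I := 𝓘(ℝ, E)) (1 : G)

theorem Ad_mul (g h : G) : Ad (E := E) (g * h) = (Ad g).comp (Ad h) := by
  simp only [Ad_eq]
  rw [← tder_comp (by simp) ((contMDiff_conj_right g).mdAt _) ((contMDiff_conj_right h).mdAt _)]
  congr 1
  funext x
  simp [mul_assoc]

/-- Differentiate `f (g x g⁻¹) = f(g) f(x) f(g)⁻¹` at `x = 1`. -/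
theorem map_Ad {f : G → G'} (hf : ContMDiff 𝓘(ℝ, E) 𝓘(ℝ, E') ∞ f)
    (hmul : ∀ x y, f (x * y) = f x * f y) (g : G) :
    (tder 𝓘(ℝ, E) 𝓘(ℝ, E') f 1).comp (Ad g) =
      (Ad (f g)).comp (tder 𝓘(ℝ, E) 𝓘(ℝ, E') f 1) := by
  have h1 : f 1 = 1 := by simpa using hmul 1 1
  have hinv : f g⁻¹ = (f g)⁻¹ := eq_inv_of_mul_eq_one_left (by rw [← hmul, inv_mul_cancel, h1])
  simp only [Ad_eq]
  rw [← tder_comp h1 ((contMDiff_conj_right (f g)).mdAt _) (hf.mdAt _),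
    ← tder_comp (by simp) (hf.mdAt _) ((contMDiff_conj_right g).mdAt _)]
  congr 1
  funext x
  rw [hmul, hmul, hinv]

/-- The expression of an operation on `G` near `1` in the chart at `1`. -/
noncomputable def opChart (E : Type*) {G : Type*} [NormedAddCommGroup E] [NormedSpace ℝ E]
    [TopologicalSpace G] [ChartedSpace E G] [Group G] (op : G → G → G) (x y : E) : E :=
  extChartAt 𝓘(ℝ, E) (1 : G) (op ((extChartAt 𝓘(ℝ, E) (1 : G)).symm x)
    ((extChartAt 𝓘(ℝ, E) (1 : G)).symm y))

theorem contMDiffAt_symm_one {x : E} (hx : x ∈ (extChartAt 𝓘(ℝ, E) (1 : G)).target) :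
    ContMDiffAt 𝓘(ℝ, E) 𝓘(ℝ, E) ∞ (extChartAt 𝓘(ℝ, E) (1 : G)).symm x :=
  (contMDiffOn_extChartAt_symm (1 : G)).contMDiffAt
    ((isOpen_extChartAt_target (1 : G)).mem_nhds hx)

theorem contDiffAt_opChart {op : G → G → G}
    (hop : ContMDiff (𝓘(ℝ, E).prod 𝓘(ℝ, E)) 𝓘(ℝ, E) ∞ (Function.uncurry op))
    (h1 : op 1 1 = 1) :
    ContDiffAt ℝ ∞ (Function.uncurry (opChart E op))
      (extChartAt 𝓘(ℝ, E) (1 : G) 1, extChartAt 𝓘(ℝ, E) (1 : G) 1) := by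
  rw [← contMDiffAt_iff_contDiffAt, modelWithCornersSelf_prod, ← chartedSpaceSelf_prod]
  have hs := contMDiffAt_symm_one (mem_extChartAt_target (I := 𝓘(ℝ, E)) (1 : G))
  have h2 : ContMDiffAt (𝓘(ℝ, E).prod 𝓘(ℝ, E)) (𝓘(ℝ, E).prod 𝓘(ℝ, E)) ∞
      (Prod.map (extChartAt 𝓘(ℝ, E) (1 : G)).symm (extChartAt 𝓘(ℝ, E) (1 : G)).symm)
      (extChartAt 𝓘(ℝ, E) (1 : G) 1, extChartAt 𝓘(ℝ, E) (1 : G) 1) := hs.prodMap hs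
  have h3 := (hop _).comp _ h2
  have h4 : ContMDiffAt 𝓘(ℝ, E) 𝓘(ℝ, E) ∞ (extChartAt 𝓘(ℝ, E) (1 : G)) 1 :=
    contMDiffAt_extChartAt
  have h5 := ContMDiffAt.comp_of_eq h4 h3 (by simp [h1])
  exact h5

end LieGroups

/-! ### Mixed second derivatives of maps of two variables. -/

section SecondDerivatives

variable {E F : Type*} [NormedAddCommGroup E] [NormedSpace ℝ E]
  [NormedAddCommGroup F] [NormedSpace ℝ F]

theorem ContDiffAt.differentiableAt_fderiv_partial {M : E → E → F} {a : E}
    (hM : ContDiffAt ℝ ∞ (Function.uncurry M) (a, a)) :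
    DifferentiableAt ℝ (fun x => fderiv ℝ (M x) a) a :=
  ((ContDiffAt.fderiv hM contDiffAt_const one_add_one_le_infty).differentiableAt
    (by simp))

theorem ContDiffAt.eventually_differentiableAt {f : E → F} {a : E} (h : ContDiffAt ℝ ∞ f a) :
    ∀ᶠ x in 𝓝 a, DifferentiableAt ℝ f x :=
  ((h.of_le (m := 1) (natCast_le_infty 1)).eventually (by simp)).mono
    fun _ hx => hx.differentiableAt (by simp)

theorem fderiv_partial_snd {M : E → E → F} {a : E}
    (hM : ContDiffAt ℝ ∞ (Function.uncurry M) (a, a)) (u v : E) :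
    fderiv ℝ (fun x => fderiv ℝ (M x) a) a u v =
      fderiv ℝ (fderiv ℝ (Function.uncurry M)) (a, a) (u, 0) (0, v) := by
  have h1 : (fun x => fderiv ℝ (M x) a) =ᶠ[𝓝 a]
      fun x => (fderiv ℝ (Function.uncurry M) (x, a)).comp (ContinuousLinearMap.inr ℝ E E) := by
    have hc : Filter.Tendsto (fun x : E => (x, a)) (𝓝 a) (𝓝 (a, a)) :=
      (Continuous.prodMk_left a).tendsto a
    filter_upwards [hc.eventually hM.eventually_differentiableAt] with x hx
    exact (HasFDerivAt.comp a (f := fun y => (x, y)) hx.hasFDerivAt (hasFDerivAt_prodMk_right x a)).fderiv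
  rw [h1.fderiv_eq]
  have h2 : HasFDerivAt (fderiv ℝ (Function.uncurry M))
      (fderiv ℝ (fderiv ℝ (Function.uncurry M)) (a, a)) (a, a) :=
    ((hM.fderiv_right one_add_one_le_infty).differentiableAt
      (by simp)).hasFDerivAt
  have h3 := HasFDerivAt.comp a (f := fun x => (x, a)) h2 (hasFDerivAt_prodMk_left a a)
  have h4 := (h3.clm_comp (hasFDerivAt_const (ContinuousLinearMap.inr ℝ E E) a)).fderiv
  have h5 := congrArg (fun L => L u v) h4
  simpa [Function.comp_def] using h5

/-- Both iterated partial derivatives are blocks of the second derivative of the uncurried map,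
which is symmetric. -/
theorem fderiv_partial_comm {M : E → E → F} {a : E}
    (hM : ContDiffAt ℝ ∞ (Function.uncurry M) (a, a)) (u v : E) :
    fderiv ℝ (fun x => fderiv ℝ (M x) a) a u v =
      fderiv ℝ (fun y => fderiv ℝ (fun x => M x y) a) a v u := by
  have hM' : ContDiffAt ℝ ∞ (Function.uncurry fun y x => M x y) (a, a) :=
    hM.comp (a, a) (f := fun p : E × E => (p.2, p.1)) (contDiffAt_snd.prodMk contDiffAt_fst)
  have h1 : (fun x => fderiv ℝ (fun z => M z x) a) =ᶠ[𝓝 a]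
      fun x => (fderiv ℝ (Function.uncurry M) (a, x)).comp (ContinuousLinearMap.inl ℝ E E) := by
    have hc : Filter.Tendsto (fun x : E => (a, x)) (𝓝 a) (𝓝 (a, a)) :=
      (Continuous.prodMk_right a).tendsto a
    filter_upwards [hc.eventually hM.eventually_differentiableAt] with x hx
    exact (HasFDerivAt.comp a (f := fun z => (z, x)) hx.hasFDerivAt (hasFDerivAt_prodMk_left a x)).fderiv
  have h2 : HasFDerivAt (fderiv ℝ (Function.uncurry M))
      (fderiv ℝ (fderiv ℝ (Function.uncurry M)) (a, a)) (a, a) :=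
    ((hM.fderiv_right one_add_one_le_infty).differentiableAt
      (by simp)).hasFDerivAt
  have h3 := HasFDerivAt.comp a (f := fun x => (a, x)) h2 (hasFDerivAt_prodMk_right a a)
  have h4 := (h3.clm_comp (hasFDerivAt_const (ContinuousLinearMap.inl ℝ E E) a)).fderiv
  have h5 := congrArg (fun L => L v u) h4
  have hs := (hM.isSymmSndFDerivAt (by simpa using natCast_le_infty 2)) (u, 0) (0, v)
  rw [fderiv_partial_snd hM, h1.fderiv_eq, hs]
  simpa [Function.comp_def] using h5.symm

end SecondDerivatives

/-! ### Smoothness of the adjoint representation and its derivative. -/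

section LieGroups

variable {E G E' G' : Type*} [NormedAddCommGroup E] [NormedSpace ℝ E]
  [TopologicalSpace G] [ChartedSpace E G] [Group G] [LieGroup 𝓘(ℝ, E) ∞ G]
  [NormedAddCommGroup E'] [NormedSpace ℝ E']
  [TopologicalSpace G'] [ChartedSpace E' G'] [Group G'] [LieGroup 𝓘(ℝ, E') ∞ G']

local notation "e₁" => extChartAt 𝓘(ℝ, E) (1 : G)

theorem tder_extChartAt_one : tder 𝓘(ℝ, E) 𝓘(ℝ, E) e₁ 1 = ContinuousLinearMap.id ℝ E :=
  mfderiv_extChartAt_self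

theorem tder_extChartAt_one_symm :
    tder 𝓘(ℝ, E) 𝓘(ℝ, E) (e₁).symm (e₁ 1) = ContinuousLinearMap.id ℝ E := by
  have h := mfderivWithin_range_extChartAt_symm (I := 𝓘(ℝ, E)) (x := (1 : G))
  rw [modelWithCornersSelf_coe, Set.range_id, mfderivWithin_univ] at h
  exact h

theorem fderiv_opChart {op : G → G → G} {x : E} {z : G} (hz : op ((e₁).symm x) 1 = z)
    (hze : z ∈ (chartAt E (1 : G)).source)
    (hop : ContMDiff 𝓘(ℝ, E) 𝓘(ℝ, E) ∞ (op ((e₁).symm x))) :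
    fderiv ℝ (opChart E op x) (e₁ 1) = (tder 𝓘(ℝ, E) 𝓘(ℝ, E) e₁ z).comp
      (tder 𝓘(ℝ, E) 𝓘(ℝ, E) (op ((e₁).symm x)) 1) := by
  have h1 : (e₁).symm (e₁ 1) = 1 := by simp
  have hs : MDifferentiableAt 𝓘(ℝ, E) 𝓘(ℝ, E) (e₁).symm (e₁ 1) :=
    (contMDiffAt_symm_one (mem_extChartAt_target (I := 𝓘(ℝ, E)) (1 : G))).mdifferentiableAt
      (by simp)
  have hop' : MDifferentiableAt 𝓘(ℝ, E) 𝓘(ℝ, E) (op ((e₁).symm x)) 1 := hop.mdAt _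
  have he : MDifferentiableAt 𝓘(ℝ, E) 𝓘(ℝ, E) e₁ z := mdifferentiableAt_extChartAt hze
  have h2 := tder_comp (g := op ((e₁).symm x)) h1 hop' hs
  rw [tder_extChartAt_one_symm, ContinuousLinearMap.comp_id] at h2
  rw [← tder_eq_fderiv, ← h2]
  refine tder_comp (f := fun y => op ((e₁).symm x) ((e₁).symm y)) (by rw [h1, hz]) he ?_
  exact MDifferentiableAt.comp_of_eq (x := e₁ 1) (y := (1 : G)) hop' hs h1

/-- In the chart at `1`, `Ad` is a partial derivative of conjugation, hence smooth in its parameter.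
-/
theorem Ad_symm (x : E) :
    (Ad ((e₁).symm x) : E →L[ℝ] E) = fderiv ℝ (opChart E (fun g h : G => g * h * g⁻¹) x) (e₁ 1) := by
  rw [fderiv_opChart (z := 1) (by simp) (mem_chart_source _ _) (contMDiff_conj_right _),
    tder_extChartAt_one, Ad_eq]
  rfl

theorem contDiffAt_Ad_symm : ContDiffAt ℝ ∞ (fun x => (Ad ((e₁).symm x) : E →L[ℝ] E)) (e₁ 1) := by
  simp_rw [Ad_symm]
  exact ContDiffAt.fderiv (n := ∞) (contDiffAt_opChart contMDiff_conj (by simp)) contDiffAt_const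
    (by simp)

theorem contMDiffAt_Ad_one : ContMDiffAt 𝓘(ℝ, E) 𝓘(ℝ, E →L[ℝ] E) ∞ (Ad : G → E →L[ℝ] E) 1 := by
  have h := (contDiffAt_Ad_symm (E := E) (G := G)).contMDiffAt.comp (1 : G) contMDiffAt_extChartAt
  refine h.congr_of_eventuallyEq ?_
  filter_upwards [extChartAt_source_mem_nhds (I := 𝓘(ℝ, E)) (1 : G)] with g hg
  simp only [Function.comp_apply, (e₁).left_inv hg]

/-- Multiplicativity writes `Ad x = Ad g ∘ Ad (g⁻¹ x)`, which transports smoothness from `1` to `g`.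
-/
theorem contMDiff_Ad : ContMDiff 𝓘(ℝ, E) 𝓘(ℝ, E →L[ℝ] E) ∞ (Ad : G → E →L[ℝ] E) := by
  intro g
  have h1 : (Ad : G → E →L[ℝ] E) = fun x => (Ad g).comp (Ad (g⁻¹ * x)) := by
    funext x
    rw [← Ad_mul, mul_inv_cancel_left]
  rw [h1]
  have h2 : ContMDiffAt 𝓘(ℝ, E) 𝓘(ℝ, E →L[ℝ] E) ∞ (fun x : G => (Ad (g⁻¹ * x) : E →L[ℝ] E)) g :=
    ContMDiffAt.comp_of_eq contMDiffAt_Ad_one (contMDiff_mulLeft g⁻¹ g) (by simp)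
  exact contMDiffAt_const.clm_comp h2

theorem mulInvariantVectorField_chart {x : E} (hx : x ∈ (e₁).target) (X : E) :
    VectorField.mpullbackWithin 𝓘(ℝ, E) 𝓘(ℝ, E) (e₁).symm
      (mulInvariantVectorField (I := 𝓘(ℝ, E)) (G := G) X) (Set.range 𝓘(ℝ, E)) x =
      fderiv ℝ (opChart E (fun g h : G => g * h) x) (e₁ 1) X := by
  rw [VectorField.mpullbackWithin_apply]
  have hi := ContinuousLinearMap.inverse_eq
    (mfderivWithin_extChartAt_symm_comp_mfderiv_extChartAt (I := 𝓘(ℝ, E)) hx)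
    (mfderiv_extChartAt_comp_mfderivWithin_extChartAt_symm (I := 𝓘(ℝ, E)) hx)
  rw [hi, fderiv_opChart (z := (e₁).symm x) (by simp)
    (by simpa using (e₁).map_target hx) (contMDiff_mulLeft _)]
  rfl

variable [FiniteDimensional ℝ E]

/-- In the chart, with `m` the multiplication and `e` the image of `1`, the left-invariant field of
`X` is `x ↦ ∂₂m(x, e) X`, with value `X` at `e`. The bracket of two such fields is therefore the
antisymmetrized mixed derivative of `m`. -/
theorem bracket_eq_sub (X Y : E) :
    bracket G X Y =
      fderiv ℝ (fun x => fderiv ℝ (opChart E (fun g h : G => g * h) x) (e₁ 1)) (e₁ 1) X Y -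
      fderiv ℝ (fun x => fderiv ℝ (opChart E (fun g h : G => g * h) x) (e₁ 1)) (e₁ 1) Y X := by
  have h0 : bracket G X Y = VectorField.mlieBracket 𝓘(ℝ, E)
      (mulInvariantVectorField (I := 𝓘(ℝ, E)) (G := G) X)
      (mulInvariantVectorField (I := 𝓘(ℝ, E)) (G := G) Y) (1 : G) := rfl
  have hev : ∀ Z : E, VectorField.mpullbackWithin 𝓘(ℝ, E) 𝓘(ℝ, E) (e₁).symm
      (mulInvariantVectorField (I := 𝓘(ℝ, E)) (G := G) Z) (Set.range 𝓘(ℝ, E)) =ᶠ[𝓝 (e₁ 1)]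
      fun x => fderiv ℝ (opChart E (fun g h : G => g * h) x) (e₁ 1) Z := fun Z =>
    Filter.eventuallyEq_of_mem (extChartAt_target_mem_nhds (1 : G))
      fun x hx => mulInvariantVectorField_chart hx Z
  have hd : DifferentiableAt ℝ (fun x => fderiv ℝ (opChart E (fun g h : G => g * h) x) (e₁ 1))
      (e₁ 1) := (contDiffAt_opChart (contMDiff_mul 𝓘(ℝ, E) ∞ (G := G))
    (mul_one 1)).differentiableAt_fderiv_partial
  have hd' : ∀ Z, fderiv ℝ (fun x => fderiv ℝ (opChart E (fun g h : G => g * h) x) (e₁ 1) Z)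
      (e₁ 1) = (fderiv ℝ (fun x => fderiv ℝ (opChart E (fun g h : G => g * h) x) (e₁ 1))
        (e₁ 1)).flip Z := fun Z => by
    ext W
    have := (hd.hasFDerivAt.clm_apply (hasFDerivAt_const Z (e₁ 1))).fderiv
    exact (congrArg (fun L => L W) this).trans (by
      rw [ContinuousLinearMap.comp_zero, zero_add])
  have hone : ∀ Z : E, fderiv ℝ (opChart E (fun g h : G => g * h) (e₁ 1)) (e₁ 1) Z = Z := fun Z => by
    rw [fderiv_opChart (z := 1) (by simp) (mem_chart_source _ _) (contMDiff_mulLeft _),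
      tder_extChartAt_one]
    simpa using DFunLike.congr_fun (tder_id (I := 𝓘(ℝ, E)) (1 : G)) Z
  have hinv : ∀ v, (mfderiv 𝓘(ℝ, E) 𝓘(ℝ, E) e₁ (1 : G)).inverse v = v :=
    fun v => by
      rw [mfderiv_extChartAt_self]
      exact DFunLike.congr_fun (ContinuousLinearMap.inverse_id (R := ℝ) (M := E)) v
  have hset : (e₁).symm ⁻¹' Set.univ ∩ Set.range 𝓘(ℝ, E) = Set.univ := by simp
  refine (h0.trans (VectorField.mlieBracketWithin_apply ..)).trans ((hinv _).trans ?_)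
  rw [hset]
  have h1 := Filter.EventuallyEq.lieBracket_vectorField_eq (𝕜 := ℝ) (hev X) (hev Y)
  refine (congrFun (VectorField.lieBracketWithin_univ (𝕜 := ℝ) (E := E)) _).trans (h1.trans ?_)
  simp only [VectorField.lieBracket, hd', hone]
  rfl

/-- Writing `x y = (x y x⁻¹) x` gives `∂₂m(x, e) = ∂₁m(e, x) ∘ Ad_x`. The product rule at `x = e`
and the symmetry of mixed derivatives then leave the antisymmetrization of `bracket_eq_sub`. -/
theorem fderiv_Ad_symm (X Y : E) :
    fderiv ℝ (fun x => (Ad ((e₁).symm x) : E →L[ℝ] E)) (e₁ 1) X Y = bracket G X Y := by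
  have hm := contDiffAt_opChart (contMDiff_mul 𝓘(ℝ, E) ∞ (G := G)) (mul_one 1)
  have h1 : (fun x => fderiv ℝ (opChart E (fun g h : G => g * h) x) (e₁ 1)) =ᶠ[𝓝 (e₁ 1)]
      fun x => (fderiv ℝ (fun y => opChart E (fun g h : G => g * h) y x) (e₁ 1)).comp
        (Ad ((e₁).symm x)) := by
    filter_upwards [extChartAt_target_mem_nhds (I := 𝓘(ℝ, E)) (1 : G)] with x hx
    have hz : (e₁).symm x ∈ (chartAt E (1 : G)).source := by simpa using (e₁).map_target hx
    have h2 := fderiv_opChart (op := fun g h : G => h * g) (x := x) (z := (e₁).symm x) (by simp)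
      hz (contMDiff_id.mul contMDiff_const)
    have h3 : (fun y => opChart E (fun g h : G => g * h) y x) =
      opChart E (fun g h : G => h * g) x := rfl
    rw [h3, h2, fderiv_opChart (z := (e₁).symm x) (by simp) hz (contMDiff_mulLeft _),
      ContinuousLinearMap.comp_assoc, Ad_eq]
    congr 1
    rw [← tder_comp (f := fun y : G => (e₁).symm x * y * ((e₁).symm x)⁻¹)
      (g := fun y : G => y * (e₁).symm x) (x := 1) (y := 1) (by simp)
      ((contMDiff_id.mul contMDiff_const : ContMDiff 𝓘(ℝ, E) 𝓘(ℝ, E) ∞ _).mdAt _)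
      ((contMDiff_conj_right _).mdAt _)]
    congr 1
    funext y
    simp
  have hd2 : DifferentiableAt ℝ
      (fun x => fderiv ℝ (fun y => opChart E (fun g h : G => g * h) y x) (e₁ 1)) (e₁ 1) :=
    ContDiffAt.differentiableAt_fderiv_partial (M := fun x y => opChart E (fun g h : G => g * h) y x)
      (hm.comp (e₁ 1, e₁ 1) (f := fun p : E × E => (p.2, p.1)) (contDiffAt_snd.prodMk contDiffAt_fst))
  have hdA : DifferentiableAt ℝ (fun x => (Ad ((e₁).symm x) : E →L[ℝ] E)) (e₁ 1) :=
    contDiffAt_Ad_symm.differentiableAt (by simp)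
  have h4 := congrArg (fun L => L X Y) (hd2.hasFDerivAt.clm_comp hdA.hasFDerivAt).fderiv
  have h5 : fderiv ℝ (fun y => opChart E (fun g h : G => g * h) y (e₁ 1)) (e₁ 1) =
      ContinuousLinearMap.id ℝ E := by
    have h6 := fderiv_opChart (op := fun g h : G => h * g) (x := e₁ 1) (z := 1) (by simp)
      (mem_chart_source _ _) (contMDiff_id.mul contMDiff_const)
    refine h6.trans ?_
    rw [tder_extChartAt_one]
    simpa using tder_id (I := 𝓘(ℝ, E)) (1 : G)
  have h7 : (Ad ((e₁).symm (e₁ 1)) : E →L[ℝ] E) = ContinuousLinearMap.id ℝ E := by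
    rw [(e₁).left_inv (mem_extChartAt_source _), Ad_one]
  have h8 := fderiv_partial_comm hm Y X
  have h9 : fderiv ℝ (fun x => fderiv ℝ (opChart E (fun g h : G => g * h) x) (e₁ 1)) (e₁ 1) Y X =
      fderiv ℝ (fun y => fderiv ℝ (fun x => opChart E (fun g h : G => g * h) x y) (e₁ 1)) (e₁ 1)
        X Y := h8
  rw [bracket_eq_sub, h9, h1.fderiv_eq]
  refine eq_sub_of_add_eq ?_
  rw [h4, h5, h7]
  simp


end LieGroups

/-! ### Homomorphisms, the Lie algebra identities and the coadjoint action. -/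

section LieGroups

variable {E G E' G' : Type*} [NormedAddCommGroup E] [NormedSpace ℝ E]
  [TopologicalSpace G] [ChartedSpace E G] [Group G] [LieGroup 𝓘(ℝ, E) ∞ G]
  [NormedAddCommGroup E'] [NormedSpace ℝ E']
  [TopologicalSpace G'] [ChartedSpace E' G'] [Group G'] [LieGroup 𝓘(ℝ, E') ∞ G']
  [FiniteDimensional ℝ E] [FiniteDimensional ℝ E']

theorem tder_Ad_one (X Y : E) :
    tder 𝓘(ℝ, E) 𝓘(ℝ, E →L[ℝ] E) (Ad : G → E →L[ℝ] E) 1 X Y = bracket G X Y := by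
  have h0 : tder 𝓘(ℝ, E) 𝓘(ℝ, E →L[ℝ] E) (Ad : G → E →L[ℝ] E) 1 =
      tder 𝓘(ℝ, E) 𝓘(ℝ, E →L[ℝ] E) (fun g : G => (Ad ((extChartAt 𝓘(ℝ, E) (1 : G)).symm
        (extChartAt 𝓘(ℝ, E) (1 : G) g)) : E →L[ℝ] E)) 1 := by
    refine tder_congr ?_
    filter_upwards [extChartAt_source_mem_nhds (I := 𝓘(ℝ, E)) (1 : G)] with g hg
    rw [(extChartAt 𝓘(ℝ, E) (1 : G)).left_inv hg]
  have hd : DifferentiableAt ℝ (fun x => (Ad ((extChartAt 𝓘(ℝ, E) (1 : G)).symm x) : E →L[ℝ] E))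
      (extChartAt 𝓘(ℝ, E) (1 : G) 1) := contDiffAt_Ad_symm.differentiableAt (by simp)
  rw [h0, tder_comp (g := fun x => (Ad ((extChartAt 𝓘(ℝ, E) (1 : G)).symm x) : E →L[ℝ] E)) rfl
    hd.mdifferentiableAt (mdifferentiableAt_extChartAt (mem_chart_source _ _)),
    tder_extChartAt_one, tder_eq_fderiv, ContinuousLinearMap.comp_id, fderiv_Ad_symm]

/-- Differentiate the identity `map_Ad` with respect to `g` at `1`; the derivative of `Ad` is the
bracket on both sides. -/
theorem map_bracket {f : G → G'} (hf : ContMDiff 𝓘(ℝ, E) 𝓘(ℝ, E') ∞ f)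
    (hmul : ∀ x y, f (x * y) = f x * f y) (X Y : E) :
    tder 𝓘(ℝ, E) 𝓘(ℝ, E') f 1 (bracket G X Y) =
      bracket G' (tder 𝓘(ℝ, E) 𝓘(ℝ, E') f 1 X) (tder 𝓘(ℝ, E) 𝓘(ℝ, E') f 1 Y) := by
  have h1 : f 1 = 1 := by simpa using hmul 1 1
  set D := tder 𝓘(ℝ, E) 𝓘(ℝ, E') f 1
  have h2 : (fun g : G => ContinuousLinearMap.compL ℝ E E E' D (Ad g)) =
      fun g : G => (ContinuousLinearMap.compL ℝ E E' E').flip D (Ad (f g)) :=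
    funext fun g => map_Ad hf hmul g
  have h3 := congrArg (fun F => tder 𝓘(ℝ, E) 𝓘(ℝ, E →L[ℝ] E') F (1 : G) X Y) h2
  rw [tder_comp rfl (ContinuousLinearMap.differentiableAt _).mdifferentiableAt
      (contMDiff_Ad.mdAt _),
    tder_comp (f := fun g : G => Ad (f g)) rfl
      (ContinuousLinearMap.differentiableAt _).mdifferentiableAt
      ((contMDiff_Ad.comp hf).mdAt _),
    tder_comp h1 (contMDiff_Ad.mdAt _) (hf.mdAt _), tder_eq_fderiv, tder_eq_fderiv,
    ContinuousLinearMap.fderiv, ContinuousLinearMap.fderiv] at h3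
  simpa [tder_Ad_one] using h3

variable (G)

theorem bracket_self (X : E) : bracket G X X = 0 := by
  have : CompleteSpace E := FiniteDimensional.complete ℝ E
  have : LieGroup 𝓘(ℝ, E) (minSmoothness ℝ 3) G :=
    LieGroup.of_le (n := ∞) (by simpa using ENat.LEInfty.out)
  exact lie_self (L := GroupLieAlgebra 𝓘(ℝ, E) G) X

theorem bracket_skew (X Y : E) : bracket G Y X = -bracket G X Y := by
  have h := bracket_self G (X + Y)
  simp only [map_add, LinearMap.add_apply, bracket_self, zero_add, add_zero] at h
  exact eq_neg_of_add_eq_zero_left h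

theorem bracket_jacobi (X Y Z : E) :
    bracket G X (bracket G Y Z) = bracket G (bracket G X Y) Z + bracket G Y (bracket G X Z) := by
  have : CompleteSpace E := FiniteDimensional.complete ℝ E
  have : LieGroup 𝓘(ℝ, E) (minSmoothness ℝ 3) G :=
    LieGroup.of_le (n := ∞) (by simpa using ENat.LEInfty.out)
  exact leibniz_lie (L₁ := GroupLieAlgebra 𝓘(ℝ, E) G) (L₂ := GroupLieAlgebra 𝓘(ℝ, E) G)
    (M := GroupLieAlgebra 𝓘(ℝ, E) G) X Y Z

variable {G}

@[simp] theorem coad_apply (ξ : E →L[ℝ] ℝ) (X Y : E) : coad G ξ X Y = ξ (bracket G X Y) := rfl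

omit [LieGroup 𝓘(ℝ, E) ∞ G] [FiniteDimensional ℝ E] in
@[simp] theorem coAd_apply (ξ : E →L[ℝ] ℝ) (g : G) (X : E) : coAd ξ g X = ξ (Ad g X) := rfl

omit [LieGroup 𝓘(ℝ, E) ∞ G] [FiniteDimensional ℝ E] in
theorem coAd_one (ξ : E →L[ℝ] ℝ) : coAd ξ (1 : G) = ξ := by
  rw [coAd, Ad_one, ContinuousLinearMap.comp_id]

omit [FiniteDimensional ℝ E] in
theorem coAd_mul (ξ : E →L[ℝ] ℝ) (g h : G) : coAd ξ (g * h) = coAd (coAd ξ g) h := by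
  rw [coAd, Ad_mul]; rfl

omit [FiniteDimensional ℝ E] in
theorem contMDiff_coAd : ContMDiff (𝓘(ℝ, E →L[ℝ] ℝ).prod 𝓘(ℝ, E)) 𝓘(ℝ, E →L[ℝ] ℝ) ∞
    (fun p : (E →L[ℝ] ℝ) × G => coAd p.1 p.2) :=
  ContMDiff.clm_comp contMDiff_fst (contMDiff_Ad.comp contMDiff_snd)

omit [FiniteDimensional ℝ E] in
theorem contMDiff_coAd_right (ξ : E →L[ℝ] ℝ) :
    ContMDiff 𝓘(ℝ, E) 𝓘(ℝ, E →L[ℝ] ℝ) ∞ (fun g : G => coAd ξ g) :=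
  contMDiff_coAd.comp (contMDiff_const.prodMk contMDiff_id)

theorem tder_coAd_one (ξ : E →L[ℝ] ℝ) (X : E) :
    tder 𝓘(ℝ, E) 𝓘(ℝ, E →L[ℝ] ℝ) (fun g : G => coAd ξ g) 1 X = coad G ξ X := by
  have h := tder_comp (I'' := 𝓘(ℝ, E →L[ℝ] ℝ)) (f := (Ad : G → E →L[ℝ] E)) (x := 1)
    (g := ContinuousLinearMap.compL ℝ E E ℝ ξ) rfl
    (ContinuousLinearMap.differentiableAt _).mdifferentiableAt (contMDiff_Ad.mdAt _)
  have h' := congrArg (fun L => L X) h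
  refine h'.trans ?_
  rw [tder_eq_fderiv, ContinuousLinearMap.fderiv]
  ext Y
  simp [tder_Ad_one]

omit [FiniteDimensional ℝ E] in
theorem tder_mulLeft_inv_comp (g : G) :
    (tder 𝓘(ℝ, E) 𝓘(ℝ, E) (fun x : G => g * x) 1).comp
      (tder 𝓘(ℝ, E) 𝓘(ℝ, E) (fun x : G => g⁻¹ * x) g) = ContinuousLinearMap.id ℝ E := by
  rw [← tder_comp (by simp) ((contMDiff_mulLeft g).mdAt _) ((contMDiff_mulLeft g⁻¹).mdAt _)]
  simpa using tder_id (I := 𝓘(ℝ, E)) g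

/-- Since `ξ · (g x) = (ξ · g) · x`, the derivative at `g` along a left translate reduces to the
derivative at `1` for the functional `ξ · g`. -/
theorem tder_coAd_mulLeft (ξ : E →L[ℝ] ℝ) (g : G) (X : E) :
    tder 𝓘(ℝ, E) 𝓘(ℝ, E →L[ℝ] ℝ) (fun g : G => coAd ξ g) g
      (tder 𝓘(ℝ, E) 𝓘(ℝ, E) (fun x : G => g * x) 1 X) = coad G (coAd ξ g) X := by
  rw [← tder_coAd_one, ← ContinuousLinearMap.comp_apply,
    ← tder_comp (by simp) ((contMDiff_coAd_right ξ).mdAt _) ((contMDiff_mulLeft g).mdAt _)]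
  simp_rw [coAd_mul]

theorem range_tder_coAd (ξ : E →L[ℝ] ℝ) (g : G) :
    Set.range (tder 𝓘(ℝ, E) 𝓘(ℝ, E →L[ℝ] ℝ) (fun g : G => coAd ξ g) g) =
      Set.range (coad G (coAd ξ g)) := by
  ext v
  constructor
  · rintro ⟨u, rfl⟩
    refine ⟨tder 𝓘(ℝ, E) 𝓘(ℝ, E) (fun x : G => g⁻¹ * x) g u, ?_⟩
    rw [← tder_coAd_mulLeft]
    congr 1
    exact DFunLike.congr_fun (tder_mulLeft_inv_comp g) u
  · rintro ⟨X, rfl⟩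
    exact ⟨_, tder_coAd_mulLeft ξ g X⟩

theorem Ad_bracket (g : G) (X Y : E) : Ad g (bracket G X Y) = bracket G (Ad g X) (Ad g Y) :=
  map_bracket (contMDiff_conj_right g) (fun x y => by group) X Y

theorem coad_coAd (ξ : E →L[ℝ] ℝ) (g : G) (X : E) :
    coad G (coAd ξ g) X = coAd (coad G ξ (Ad g X)) g := by
  ext Y
  simp [Ad_bracket]

end LieGroups

/-! ### Lie 2-groups: the commuting kernels of source and target. -/

namespace LieTwo.LieTwoGroup

variable {E₁ G₁ E₀ G₀ : Type*}
  [NormedAddCommGroup E₁] [NormedSpace ℝ E₁] [TopologicalSpace G₁] [ChartedSpace E₁ G₁]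
  [Group G₁] [LieGroup 𝓘(ℝ, E₁) ∞ G₁]
  [NormedAddCommGroup E₀] [NormedSpace ℝ E₀] [TopologicalSpace G₀] [ChartedSpace E₀ G₀]
  [Group G₀] [LieGroup 𝓘(ℝ, E₀) ∞ G₀]
  (𝒢 : LieTwoGroup E₁ G₁ E₀ G₀)

theorem contMDiff_src : ContMDiff 𝓘(ℝ, E₁) 𝓘(ℝ, E₀) ∞ 𝒢.src := 𝒢.lie.src_submersion.1

theorem contMDiff_tgt : ContMDiff 𝓘(ℝ, E₁) 𝓘(ℝ, E₀) ∞ 𝒢.tgt := 𝒢.lie.smooth_tgt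

theorem contMDiff_unit : ContMDiff 𝓘(ℝ, E₀) 𝓘(ℝ, E₁) ∞ 𝒢.unit := 𝒢.lie.smooth_unit

theorem src_mul (x y : G₁) : 𝒢.src (x * y) = 𝒢.src x * 𝒢.src y := 𝒢.preserves_mul.src x y

theorem tgt_mul (x y : G₁) : 𝒢.tgt (x * y) = 𝒢.tgt x * 𝒢.tgt y := 𝒢.preserves_mul.tgt x y

theorem unit_mul (x y : G₀) : 𝒢.unit (x * y) = 𝒢.unit x * 𝒢.unit y := 𝒢.preserves_mul.unit x y

theorem tgt_one : 𝒢.tgt 1 = 1 := by simpa using 𝒢.tgt_mul 1 1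

theorem tgt_inv (x : G₁) : 𝒢.tgt x⁻¹ = (𝒢.tgt x)⁻¹ :=
  eq_inv_of_mul_eq_one_left (by rw [← tgt_mul, inv_mul_cancel, tgt_one])

theorem unit_inv (x : G₀) : 𝒢.unit x⁻¹ = (𝒢.unit x)⁻¹ :=
  eq_inv_of_mul_eq_one_left (by rw [← unit_mul, inv_mul_cancel, unit_one])

theorem src_unit (x : G₀) : 𝒢.src (𝒢.unit x) = x := 𝒢.lie.isGroupoid.src_unit x

theorem tgt_unit (x : G₀) : 𝒢.tgt (𝒢.unit x) = x := 𝒢.lie.isGroupoid.tgt_unit x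

theorem mul_one_one_of_src {x : G₁} (hx : 𝒢.src x = 1) : 𝒢.mul x 1 = x := by
  have := 𝒢.lie.isGroupoid.mul_unit x
  rwa [hx, unit_one] at this

theorem one_mul_of_tgt {x : G₁} (hx : 𝒢.tgt x = 1) : 𝒢.mul 1 x = x := by
  have := 𝒢.lie.isGroupoid.unit_mul x
  rwa [hx, unit_one] at this

/-- Eckmann–Hilton: by the interchange law both products equal the groupoid product of `x` and `y`.
-/
theorem commute_of_src_of_tgt {x y : G₁} (hx : 𝒢.src x = 1) (hy : 𝒢.tgt y = 1) :
    x * y = y * x := by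
  have h1 := 𝒢.preserves_mul.mul x 1 1 y (by rw [hx, tgt_one]) (by rw [hy, src_one])
  have h2 := 𝒢.preserves_mul.mul 1 y x 1 (by rw [hy, src_one]) (by rw [hx, tgt_one])
  simp only [mul_one, one_mul, 𝒢.mul_one_one_of_src hx, 𝒢.one_mul_of_tgt hy] at h1 h2
  rw [← h1, h2]

/-- Interchange, applied to `g = (g a⁻¹) a` and `h = 1 h` with `a = u(t h)`. The groupoid product
thus becomes an expression in the group that makes sense for arbitrary pairs. -/
theorem mul_eq {g h : G₁} (hgh : 𝒢.src g = 𝒢.tgt h) :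
    𝒢.mul g h = g * (𝒢.unit (𝒢.tgt h))⁻¹ * h := by
  have hs : 𝒢.src (g * (𝒢.unit (𝒢.tgt h))⁻¹) = 1 := by
    rw [src_mul, src_inv_mul, src_unit, hgh, mul_inv_cancel]
  have h1 := 𝒢.preserves_mul.mul (g * (𝒢.unit (𝒢.tgt h))⁻¹) 1 (𝒢.unit (𝒢.tgt h)) h
    (by rw [hs, tgt_one]) (by rw [src_unit])
  simpa [𝒢.lie.isGroupoid.unit_mul, 𝒢.mul_one_one_of_src hs] using h1

/-- The endomorphism `u ∘ s` of `𝔤₁`. -/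
noncomputable def usrc : E₁ →L[ℝ] E₁ := 𝒢.dunit.comp 𝒢.dsrc

/-- The endomorphism `u ∘ t` of `𝔤₁`. -/
noncomputable def utgt : E₁ →L[ℝ] E₁ := 𝒢.dunit.comp 𝒢.dtgt

theorem usrc_apply (X : E₁) : 𝒢.usrc X = 𝒢.dunit (𝒢.dsrc X) := rfl

theorem dtgt_dunit (x : E₀) : 𝒢.dtgt (𝒢.dunit x) = x := by
  have h := tder_comp (x := (1 : G₀)) 𝒢.unit_one (𝒢.contMDiff_tgt.mdAt _) (𝒢.contMDiff_unit.mdAt _)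
  simp only [tgt_unit, tder_id] at h
  exact (DFunLike.congr_fun h x).symm

theorem dunit_injective : Function.Injective 𝒢.dunit :=
  Function.LeftInverse.injective 𝒢.dsrc_dunit

@[simp] theorem usrc_usrc (X : E₁) : 𝒢.usrc (𝒢.usrc X) = 𝒢.usrc X := by
  simp [usrc, dsrc_dunit]

@[simp] theorem usrc_utgt (X : E₁) : 𝒢.usrc (𝒢.utgt X) = 𝒢.utgt X := by
  simp [usrc, utgt, dsrc_dunit]

@[simp] theorem utgt_usrc (X : E₁) : 𝒢.utgt (𝒢.usrc X) = 𝒢.usrc X := by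
  simp [usrc, utgt, dtgt_dunit]

@[simp] theorem utgt_utgt (X : E₁) : 𝒢.utgt (𝒢.utgt X) = 𝒢.utgt X := by
  simp [utgt, dtgt_dunit]

theorem mem_core_iff {X : E₁} : X ∈ 𝒢.core ↔ 𝒢.usrc X = 0 := by
  rw [LinearMap.mem_ker, usrc_apply]
  exact (map_eq_zero_iff 𝒢.dunit 𝒢.dunit_injective).symm

theorem tder_unit_src :
    tder 𝓘(ℝ, E₁) 𝓘(ℝ, E₁) (fun g => 𝒢.unit (𝒢.src g)) 1 = 𝒢.usrc :=
  tder_comp 𝒢.src_one (𝒢.contMDiff_unit.mdAt _) (𝒢.contMDiff_src.mdAt _)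

theorem tder_unit_tgt :
    tder 𝓘(ℝ, E₁) 𝓘(ℝ, E₁) (fun g => 𝒢.unit (𝒢.tgt g)) 1 = 𝒢.utgt :=
  tder_comp 𝒢.tgt_one (𝒢.contMDiff_unit.mdAt _) (𝒢.contMDiff_tgt.mdAt _)

theorem usrc_Ad (g : G₁) (X : E₁) :
    𝒢.usrc (Ad g X) = Ad (𝒢.unit (𝒢.src g)) (𝒢.usrc X) := by
  have h := map_Ad (𝒢.contMDiff_unit.comp 𝒢.contMDiff_src)
    (fun x y => by simp [src_mul, unit_mul]) g
  have h' := DFunLike.congr_fun h X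
  simpa [Function.comp_def, tder_unit_src] using h'

theorem utgt_Ad (g : G₁) (X : E₁) :
    𝒢.utgt (Ad g X) = Ad (𝒢.unit (𝒢.tgt g)) (𝒢.utgt X) := by
  have h := map_Ad (𝒢.contMDiff_unit.comp 𝒢.contMDiff_tgt)
    (fun x y => by simp [tgt_mul, unit_mul]) g
  have h' := DFunLike.congr_fun h X
  simpa [Function.comp_def, tder_unit_tgt] using h'

theorem tder_mul_inv {f : G₁ → G₁} (hf : ContMDiff 𝓘(ℝ, E₁) 𝓘(ℝ, E₁) ∞ f) (h1 : f 1 = 1) :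
    tder 𝓘(ℝ, E₁) 𝓘(ℝ, E₁) (fun x => x * (f x)⁻¹) 1 =
      ContinuousLinearMap.id ℝ E₁ - tder 𝓘(ℝ, E₁) 𝓘(ℝ, E₁) f 1 := by
  have hc : ContMDiff 𝓘(ℝ, E₁) 𝓘(ℝ, E₁) ∞ (fun x => x * (f x)⁻¹) := contMDiff_id.mul hf.inv
  have hm : ContMDiff (𝓘(ℝ, E₁).prod 𝓘(ℝ, E₁)) 𝓘(ℝ, E₁) ∞ (fun p : G₁ × G₁ => p.1 * p.2) :=
    contMDiff_mul _ _
  have h2 : tder 𝓘(ℝ, E₁) 𝓘(ℝ, E₁) (fun x => (x * (f x)⁻¹) * f x) 1 =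
      ContinuousLinearMap.id ℝ E₁ := by simpa using tder_id (I := 𝓘(ℝ, E₁)) (1 : G₁)
  have h3 := tder_comp (f := fun x => (x * (f x)⁻¹, f x)) (x := 1) (y := (1, 1)) (by simp [h1])
    (hm.mdAt _) ((hc.prodMk hf).mdAt _)
  rw [tder_prodMk (hc.mdAt _) (hf.mdAt _), h2] at h3
  refine eq_sub_of_add_eq ?_
  ext X
  have h4 := DFunLike.congr_fun h3 X
  rw [ContinuousLinearMap.comp_apply, ContinuousLinearMap.prod_apply, tder_prod (hm.mdAt _)] at h4
  simp only [mul_one, one_mul, tder_id] at h4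
  exact h4.symm

/-- `X - usrc X` is the velocity of `x ↦ x u(s x)⁻¹`, a map into `ker s`; conjugation by `g ∈ ker t`
fixes this map pointwise. No Lie group structure on the kernel is needed. -/
theorem Ad_sub_usrc {g : G₁} (hg : 𝒢.tgt g = 1) (X : E₁) :
    Ad g (X - 𝒢.usrc X) = X - 𝒢.usrc X := by
  have hf := 𝒢.contMDiff_unit.comp 𝒢.contMDiff_src
  have h1 := tder_mul_inv hf (by simp [src_one, unit_one])
  have hc : ContMDiff 𝓘(ℝ, E₁) 𝓘(ℝ, E₁) ∞ (fun x => x * ((𝒢.unit ∘ 𝒢.src) x)⁻¹) :=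
    contMDiff_id.mul hf.inv
  have h2 := tder_comp (f := fun x => x * ((𝒢.unit ∘ 𝒢.src) x)⁻¹) (x := 1) (y := 1)
    (by simp [src_one, unit_one]) ((contMDiff_conj_right g).mdAt _) (hc.mdAt _)
  have h3 : (fun z => g * (z * ((𝒢.unit ∘ 𝒢.src) z)⁻¹) * g⁻¹) =
      fun z => z * ((𝒢.unit ∘ 𝒢.src) z)⁻¹ := by
    funext z
    rw [← 𝒢.commute_of_src_of_tgt (x := z * ((𝒢.unit ∘ 𝒢.src) z)⁻¹) (y := g) (by
      simp [src_mul, src_inv_mul, src_unit]) hg, mul_inv_cancel_right]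
  rw [h3, h1, show tder 𝓘(ℝ, E₁) 𝓘(ℝ, E₁) (𝒢.unit ∘ 𝒢.src) 1 = 𝒢.usrc from 𝒢.tder_unit_src] at h2
  exact (DFunLike.congr_fun h2 X).symm

theorem Ad_sub_utgt {g : G₁} (hg : 𝒢.src g = 1) (X : E₁) :
    Ad g (X - 𝒢.utgt X) = X - 𝒢.utgt X := by
  have hf := 𝒢.contMDiff_unit.comp 𝒢.contMDiff_tgt
  have h1 := tder_mul_inv hf (by simp [tgt_one, unit_one])
  have hc : ContMDiff 𝓘(ℝ, E₁) 𝓘(ℝ, E₁) ∞ (fun x => x * ((𝒢.unit ∘ 𝒢.tgt) x)⁻¹) :=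
    contMDiff_id.mul hf.inv
  have h2 := tder_comp (f := fun x => x * ((𝒢.unit ∘ 𝒢.tgt) x)⁻¹) (x := 1) (y := 1)
    (by simp [tgt_one, unit_one]) ((contMDiff_conj_right g).mdAt _) (hc.mdAt _)
  have h3 : (fun z => g * (z * ((𝒢.unit ∘ 𝒢.tgt) z)⁻¹) * g⁻¹) =
      fun z => z * ((𝒢.unit ∘ 𝒢.tgt) z)⁻¹ := by
    funext z
    rw [𝒢.commute_of_src_of_tgt (x := g) (y := z * ((𝒢.unit ∘ 𝒢.tgt) z)⁻¹) hg (by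
      simp [tgt_mul, tgt_inv, tgt_unit]), mul_inv_cancel_right]
  rw [h3, h1, show tder 𝓘(ℝ, E₁) 𝓘(ℝ, E₁) (𝒢.unit ∘ 𝒢.tgt) 1 = 𝒢.utgt from 𝒢.tder_unit_tgt] at h2
  exact (DFunLike.congr_fun h2 X).symm

variable [FiniteDimensional ℝ E₁]

theorem usrc_bracket (X Y : E₁) :
    𝒢.usrc (bracket G₁ X Y) = bracket G₁ (𝒢.usrc X) (𝒢.usrc Y) := by
  have h := map_bracket (𝒢.contMDiff_unit.comp 𝒢.contMDiff_src)
    (fun x y => by simp [src_mul, unit_mul]) X Y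
  simpa [Function.comp_def, tder_unit_src] using h

theorem utgt_bracket (X Y : E₁) :
    𝒢.utgt (bracket G₁ X Y) = bracket G₁ (𝒢.utgt X) (𝒢.utgt Y) := by
  have h := map_bracket (𝒢.contMDiff_unit.comp 𝒢.contMDiff_tgt)
    (fun x y => by simp [tgt_mul, unit_mul]) X Y
  simpa [Function.comp_def, tder_unit_tgt] using h

/-- The kernels of source and target commute. -/
theorem bracket_sub_utgt_sub_usrc (X Y : E₁) :
    bracket G₁ (X - 𝒢.utgt X) (Y - 𝒢.usrc Y) = 0 := by
  have hf := 𝒢.contMDiff_unit.comp 𝒢.contMDiff_tgt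
  have h1 := tder_mul_inv hf (by simp [tgt_one, unit_one])
  have hc : ContMDiff 𝓘(ℝ, E₁) 𝓘(ℝ, E₁) ∞ (fun x => x * ((𝒢.unit ∘ 𝒢.tgt) x)⁻¹) :=
    contMDiff_id.mul hf.inv
  set V := Y - 𝒢.usrc Y with hV
  -- The element `g u(t g)⁻¹` lies in `ker t` and so fixes `V`; the derivative of this constant
  -- function at `g = 1` is the bracket in question.
  have h2 : (fun g : G₁ => ContinuousLinearMap.apply ℝ E₁ V
      (Ad (g * ((𝒢.unit ∘ 𝒢.tgt) g)⁻¹))) = fun _ => V :=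
    funext fun g => 𝒢.Ad_sub_usrc (by simp [tgt_mul, tgt_inv, tgt_unit]) Y
  have h3 := congrArg (fun F => tder 𝓘(ℝ, E₁) 𝓘(ℝ, E₁) F (1 : G₁) X) h2
  simp only [tder_const] at h3
  rw [tder_comp (f := fun g : G₁ => (Ad (g * ((𝒢.unit ∘ 𝒢.tgt) g)⁻¹) : E₁ →L[ℝ] E₁)) rfl
      (ContinuousLinearMap.differentiableAt _).mdifferentiableAt
      ((contMDiff_Ad.comp hc).mdAt _),
    tder_comp (y := 1) (by simp [tgt_one, unit_one]) (contMDiff_Ad.mdAt _) (hc.mdAt _),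
    tder_eq_fderiv, ContinuousLinearMap.fderiv, h1] at h3
  simp only [ContinuousLinearMap.comp_apply, ContinuousLinearMap.apply_apply, tder_Ad_one] at h3
  simpa [Function.comp_def, tder_unit_tgt] using h3

end LieTwo.LieTwoGroup

/-! ### The dual groupoid, the coadjoint action and its linearization. -/

namespace LieTwo.LieTwoGroup

variable {E₁ G₁ E₀ G₀ : Type*}
  [NormedAddCommGroup E₁] [NormedSpace ℝ E₁] [TopologicalSpace G₁] [ChartedSpace E₁ G₁]
  [Group G₁] [LieGroup 𝓘(ℝ, E₁) ∞ G₁]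
  [NormedAddCommGroup E₀] [NormedSpace ℝ E₀] [TopologicalSpace G₀] [ChartedSpace E₀ G₀]
  [Group G₀] [LieGroup 𝓘(ℝ, E₀) ∞ G₀]
  (𝒢 : LieTwoGroup E₁ G₁ E₀ G₀)

theorem usrc_core (h : 𝒢.core) : 𝒢.usrc h = 0 := 𝒢.mem_core_iff.1 h.2

theorem coe_proj (X : E₁) : (𝒢.proj X : E₁) = X - 𝒢.usrc X := rfl

theorem dual_tgt_apply (ξ : E₁ →L[ℝ] ℝ) (h : 𝒢.core) : 𝒢.dual.tgt ξ h = ξ h := rfl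

theorem dual_src_apply (ξ : E₁ →L[ℝ] ℝ) (h : 𝒢.core) :
    𝒢.dual.src ξ h = ξ (h - 𝒢.utgt h) := by
  rw [map_sub]; rfl

theorem dual_unit_apply (α : 𝒢.core →L[ℝ] ℝ) (X : E₁) :
    𝒢.dual.unit α X = α (𝒢.proj X) := by
  simp [dual, pair]

theorem dual_unit_core (α : 𝒢.core →L[ℝ] ℝ) (h : 𝒢.core) : 𝒢.dual.unit α h = α h := by
  rw [dual_unit_apply]
  congr 1
  ext
  simp [coe_proj, usrc_core]

/-- This form, free of the splitting into components, makes the product linear in the pair and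
visibly associative and right cancellative. -/
theorem dual_mul (ξ η : E₁ →L[ℝ] ℝ) : 𝒢.dual.mul ξ η = ξ + η.comp 𝒢.usrc := by
  ext X
  have h1 : 𝒢.dual.mul ξ η X = ξ (𝒢.proj X : E₁) + (ξ (𝒢.usrc X) + η (𝒢.usrc X)) := rfl
  rw [h1, coe_proj]
  simp
  ring

theorem dual_inv_apply (ξ : E₁ →L[ℝ] ℝ) (X : E₁) :
    𝒢.dual.inv ξ X = ξ (X - 𝒢.utgt X - 𝒢.usrc X) := by
  have h1 : 𝒢.dual.inv ξ X = ξ (𝒢.proj X : E₁) - ξ (𝒢.utgt (𝒢.proj X : E₁)) + -ξ (𝒢.usrc X) := rfl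
  rw [h1, coe_proj]
  simp
  ring

theorem dual_src_eq_tgt_iff {ξ η : E₁ →L[ℝ] ℝ} :
    𝒢.dual.src ξ = 𝒢.dual.tgt η ↔ ∀ h ∈ 𝒢.core, ξ (h - 𝒢.utgt h) = η h := by
  constructor
  · intro H h hh
    have := DFunLike.congr_fun H (⟨h, hh⟩ : 𝒢.core)
    rwa [dual_src_apply, dual_tgt_apply] at this
  · intro H
    ext h
    rw [dual_src_apply, dual_tgt_apply]
    exact H h h.2

theorem sub_usrc_mem_core (X : E₁) : X - 𝒢.usrc X ∈ 𝒢.core := by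
  rw [mem_core_iff]; simp

theorem dual_isGroupoid : 𝒢.dual.IsGroupoid where
  src_unit α := by
    ext h
    rw [dual_src_apply, map_sub, dual_unit_core, dual_unit_apply]
    have h1 : 𝒢.proj (𝒢.utgt h) = 0 := by
      ext; simp [coe_proj]
    rw [h1, map_zero, sub_zero]
  tgt_unit α := by
    ext h
    rw [dual_tgt_apply, dual_unit_core]
  src_mul x y hxy := by
    ext h
    have := 𝒢.dual_src_eq_tgt_iff.1 hxy h h.2
    rw [dual_src_apply, dual_src_apply, dual_mul]
    simp [usrc_core] at this ⊢
    rw [this]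
    ring
  tgt_mul x y _ := by
    ext h
    simp [dual_tgt_apply, dual_mul, usrc_core]
  mul_assoc x y z _ _ := by
    ext X
    simp [dual_mul, add_assoc]
  unit_mul x := by
    ext X
    rw [dual_mul, add_apply, dual_unit_apply, dual_tgt_apply, coe_proj]
    simp
  mul_unit x := by
    ext X
    have h1 : 𝒢.proj (𝒢.usrc X) = 0 := by
      ext; simp [coe_proj]
    rw [dual_mul, add_apply, ContinuousLinearMap.comp_apply, dual_unit_apply,
      h1]
    simp
  src_inv x := by
    ext h
    rw [dual_src_apply, dual_inv_apply, dual_tgt_apply]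
    simp [usrc_core]
  tgt_inv x := by
    ext h
    rw [dual_src_apply, dual_tgt_apply, dual_inv_apply]
    simp [usrc_core]
  inv_mul x := by
    ext X
    rw [dual_mul, add_apply, ContinuousLinearMap.comp_apply, dual_unit_apply,
      dual_src_apply, dual_inv_apply, coe_proj]
    simp
  mul_inv x := by
    ext X
    rw [dual_mul, add_apply, ContinuousLinearMap.comp_apply, dual_unit_apply,
      dual_tgt_apply, dual_inv_apply, coe_proj]
    simp
    ring

theorem dual_src_add (ξ η : E₁ →L[ℝ] ℝ) :
    𝒢.dual.src (ξ + η) = 𝒢.dual.src ξ + 𝒢.dual.src η := by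
  ext h; simp [dual_src_apply]

theorem dual_preservesOp_add : 𝒢.dual.PreservesOp (· + ·) (· + ·) where
  src := 𝒢.dual_src_add
  tgt x y := rfl
  unit a b := by ext X; simp [dual_unit_apply]
  mul x x' y y' _ _ := by ext X; simp [dual_mul]; ring
  inv x y := by ext X; simp [dual_inv_apply]

/-! ### The coadjoint action and the groupoid structure -/

theorem coe_coreAct (g : G₀) (h : 𝒢.core) : (𝒢.coreAct g h : E₁) = Ad (𝒢.unit g) (h : E₁) := rfl

theorem coreCoAct_apply (α : 𝒢.core →L[ℝ] ℝ) (g : G₀) (h : 𝒢.core) :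
    𝒢.coreCoAct α g h = α (𝒢.coreAct g h) := rfl

theorem coreCoAct_one (α : 𝒢.core →L[ℝ] ℝ) : 𝒢.coreCoAct α 1 = α := by
  ext h
  rw [coreCoAct_apply]
  congr 1
  ext
  rw [coe_coreAct, unit_one, Ad_one]
  rfl

theorem coreCoAct_mul (α : 𝒢.core →L[ℝ] ℝ) (g h : G₀) :
    𝒢.coreCoAct α (g * h) = 𝒢.coreCoAct (𝒢.coreCoAct α g) h := by
  ext X
  simp only [coreCoAct_apply]
  congr 1
  ext
  simp only [coe_coreAct, unit_mul, Ad_mul]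
  rfl

/-- An arrow and the unit at its source act in the same way on the kernel of the target. -/
theorem Ad_sub_utgt_eq (g : G₁) (X : E₁) :
    Ad g (X - 𝒢.utgt X) = Ad (𝒢.unit (𝒢.src g)) (X - 𝒢.utgt X) := by
  have h1 : g = (𝒢.unit (𝒢.src g)) * ((𝒢.unit (𝒢.src g))⁻¹ * g) := by group
  conv_lhs => rw [h1]
  rw [Ad_mul, ContinuousLinearMap.comp_apply, 𝒢.Ad_sub_utgt]
  rw [src_mul, src_inv_mul, src_unit, inv_mul_cancel]

/-- An arrow and the unit at its target act in the same way on the kernel of the source. -/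
theorem Ad_sub_usrc_eq (g : G₁) (X : E₁) :
    Ad g (X - 𝒢.usrc X) = Ad (𝒢.unit (𝒢.tgt g)) (X - 𝒢.usrc X) := by
  have h1 : g = (𝒢.unit (𝒢.tgt g)) * ((𝒢.unit (𝒢.tgt g))⁻¹ * g) := by group
  conv_lhs => rw [h1]
  rw [Ad_mul, ContinuousLinearMap.comp_apply, 𝒢.Ad_sub_usrc]
  rw [tgt_mul, tgt_inv, tgt_unit, inv_mul_cancel]

theorem Ad_core (g : G₁) (h : 𝒢.core) : Ad g (h : E₁) = Ad (𝒢.unit (𝒢.tgt g)) (h : E₁) := by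
  simpa [usrc_core] using 𝒢.Ad_sub_usrc_eq g h

theorem dual_src_coAd (ξ : E₁ →L[ℝ] ℝ) (g : G₁) :
    𝒢.dual.src (coAd ξ g) = 𝒢.coreCoAct (𝒢.dual.src ξ) (𝒢.src g) := by
  ext h
  rw [dual_src_apply, coAd_apply, coreCoAct_apply, dual_src_apply, coe_coreAct, utgt_Ad,
    Ad_sub_utgt_eq, map_sub, tgt_unit]

theorem dual_tgt_coAd (ξ : E₁ →L[ℝ] ℝ) (g : G₁) :
    𝒢.dual.tgt (coAd ξ g) = 𝒢.coreCoAct (𝒢.dual.tgt ξ) (𝒢.tgt g) := by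
  ext h
  rw [dual_tgt_apply, coAd_apply, coreCoAct_apply, dual_tgt_apply, coe_coreAct, Ad_core]

theorem dual_unit_coAd (α : 𝒢.core →L[ℝ] ℝ) (g : G₀) :
    coAd (𝒢.dual.unit α) (𝒢.unit g) = 𝒢.dual.unit (𝒢.coreCoAct α g) := by
  ext X
  rw [coAd_apply, dual_unit_apply, dual_unit_apply, coreCoAct_apply]
  congr 1
  ext
  rw [coe_coreAct, coe_proj, coe_proj, usrc_Ad, map_sub, src_unit]

/-- Split `X` into its core part and `Y = usrc X`, and put `a = u(t h)`, so that the product is `g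
a⁻¹ h`. On the core part `a⁻¹ h ∈ ker t` acts trivially. On `Y`, the element `g a⁻¹ ∈ ker s` fixes
`Ad h Y - Ad a Y`, which is killed by `utgt`. Composability of `ξ` and `η` converts the remaining
values of `η` into values of `ξ`. -/
theorem dual_mul_coAd {ξ η : E₁ →L[ℝ] ℝ} {g h : G₁} (hξη : 𝒢.dual.src ξ = 𝒢.dual.tgt η)
    (hgh : 𝒢.src g = 𝒢.tgt h) :
    coAd (𝒢.dual.mul ξ η) (𝒢.mul g h) = 𝒢.dual.mul (coAd ξ g) (coAd η h) := by
  set a := 𝒢.unit (𝒢.tgt h) with ha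
  have hmul : 𝒢.mul g h = g * (a⁻¹ * h) := by rw [𝒢.mul_eq hgh, mul_assoc]
  have hk : 𝒢.tgt (a⁻¹ * h) = 1 := by rw [tgt_mul, tgt_inv, ha, tgt_unit, inv_mul_cancel]
  have hl : 𝒢.src (g * a⁻¹) = 1 := by
    rw [src_mul, src_inv_mul, ha, src_unit, hgh, mul_inv_cancel]
  have hsrc : 𝒢.src (𝒢.mul g h) = 𝒢.src h := 𝒢.lie.isGroupoid.src_mul g h hgh
  ext X
  have e1 : Ad (𝒢.mul g h) (X - 𝒢.usrc X) = Ad g (X - 𝒢.usrc X) := by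
    rw [hmul, Ad_mul, ContinuousLinearMap.comp_apply, 𝒢.Ad_sub_usrc hk]
  have e2 : 𝒢.usrc (Ad (𝒢.mul g h) X) = Ad (𝒢.unit (𝒢.src h)) (𝒢.usrc X) := by
    rw [usrc_Ad, hsrc]
  set Y := 𝒢.usrc X with hY
  have huY : 𝒢.usrc Y = Y := by rw [hY, usrc_usrc]
  have htY : 𝒢.utgt Y = Y := by rw [hY, utgt_usrc]
  have e3 : η (Ad h Y - Ad (𝒢.unit (𝒢.src h)) Y) = ξ (Ad h Y - Ad a Y) := by
    have hc : Ad h Y - Ad (𝒢.unit (𝒢.src h)) Y ∈ 𝒢.core := by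
      rw [mem_core_iff, map_sub, usrc_Ad, usrc_Ad, src_unit, huY, sub_self]
    rw [← 𝒢.dual_src_eq_tgt_iff.1 hξη _ hc]
    congr 1
    rw [map_sub, utgt_Ad, utgt_Ad, tgt_unit, htY]
    abel
  have e4 : Ad (g * a⁻¹) (Ad h Y - Ad a Y) = Ad h Y - Ad a Y := by
    have h0 : 𝒢.utgt (Ad h Y - Ad a Y) = 0 := by
      rw [map_sub, utgt_Ad, utgt_Ad, ha, tgt_unit, sub_self]
    simpa [h0] using 𝒢.Ad_sub_utgt hl (Ad h Y - Ad a Y)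
  have e5 : Ad (𝒢.mul g h) Y - Ad g Y = Ad h Y - Ad a Y := by
    have e6 : Ad (𝒢.mul g h) Y = Ad (g * a⁻¹) (Ad h Y) := by rw [hmul, ← mul_assoc, Ad_mul]; rfl
    have e7 : Ad g Y = Ad (g * a⁻¹) (Ad a Y) := by
      rw [← ContinuousLinearMap.comp_apply (Ad (g * a⁻¹)) (Ad a), ← Ad_mul, inv_mul_cancel_right]
    rw [← e4, map_sub, e6, e7]
  simp only [dual_mul, coAd_apply, add_apply, ContinuousLinearMap.comp_apply]
  rw [e2]
  rw [map_sub, map_sub, sub_eq_iff_eq_add] at e1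
  rw [map_sub, ← e5, map_sub] at e3
  rw [e1, map_add, map_sub]
  linarith [e3]

theorem unit_src_mul_inv_inv (g : G₁) :
    𝒢.inv g = 𝒢.unit (𝒢.src g) * g⁻¹ * 𝒢.unit (𝒢.tgt g) := by
  have h1 := 𝒢.lie.isGroupoid.mul_inv g
  rw [𝒢.mul_eq (𝒢.lie.isGroupoid.tgt_inv g).symm, 𝒢.lie.isGroupoid.tgt_inv] at h1
  rw [← h1]
  group

theorem dual_inv_coAd (ξ : E₁ →L[ℝ] ℝ) (g : G₁) :
    coAd (𝒢.dual.inv ξ) (𝒢.inv g) = 𝒢.dual.inv (coAd ξ g) := by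
  have hG := 𝒢.dual_isGroupoid
  have hg := 𝒢.lie.isGroupoid
  have h1 : coAd (𝒢.dual.mul (𝒢.dual.inv ξ) ξ) (𝒢.mul (𝒢.inv g) g) =
      𝒢.dual.mul (coAd (𝒢.dual.inv ξ) (𝒢.inv g)) (coAd ξ g) :=
    𝒢.dual_mul_coAd (hG.src_inv ξ) (hg.src_inv g)
  rw [hG.inv_mul, hg.inv_mul, dual_unit_coAd, ← dual_src_coAd, ← hG.inv_mul] at h1
  rw [dual_mul, dual_mul] at h1
  -- Products with the same right factor differ only in the left summand, so right cancellation is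
  -- cancellation in the vector space.
  exact (add_right_cancel h1).symm

theorem coAd_isMorphism :
    (𝒢.dual.prod 𝒢.toGroupoidData).IsMorphism 𝒢.dual (fun p => coAd p.1 p.2)
      (fun p => 𝒢.coreCoAct p.1 p.2) where
  src p := 𝒢.dual_src_coAd p.1 p.2
  tgt p := 𝒢.dual_tgt_coAd p.1 p.2
  unit a := 𝒢.dual_unit_coAd a.1 a.2
  mul _ _ h := 𝒢.dual_mul_coAd (congrArg Prod.fst h) (congrArg Prod.snd h)
  inv p := 𝒢.dual_inv_coAd p.1 p.2

/-! ### The infinitesimal coadjoint action -/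

section Infinitesimal

variable [FiniteDimensional ℝ E₁]

theorem bracket_of_utgt_eq_zero {K H : E₁} (hK : 𝒢.utgt K = 0) (hH : 𝒢.usrc H = 0) :
    bracket G₁ K H = 0 := by
  simpa [hK, hH] using 𝒢.bracket_sub_utgt_sub_usrc K H

theorem bracket_core_of_utgt (B : E₁) {H : E₁} (hH : 𝒢.usrc H = 0) :
    bracket G₁ B H = bracket G₁ (𝒢.utgt B) H := by
  have := 𝒢.bracket_of_utgt_eq_zero (K := B - 𝒢.utgt B) (by simp) hH
  rwa [map_sub, LinearMap.sub_apply, sub_eq_zero] at this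

theorem bracket_of_usrc (A : E₁) {K : E₁} (hK : 𝒢.utgt K = 0) :
    bracket G₁ A K = bracket G₁ (𝒢.usrc A) K := by
  have := 𝒢.bracket_of_utgt_eq_zero (H := A - 𝒢.usrc A) hK (by simp)
  rw [bracket_skew, neg_eq_zero, map_sub, LinearMap.sub_apply, sub_eq_zero] at this
  exact this

variable {x y : E₁ →L[ℝ] ℝ}

omit [FiniteDimensional ℝ E₁] in
-- Here `C + D - utgt D` is the groupoid product `C ∗ D` in the Lie 2-algebra: the product of
-- functionals is dual to the product of vectors.
theorem dual_mul_apply_star (hxy : 𝒢.dual.src x = 𝒢.dual.tgt y) {C D : E₁}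
    (hCD : 𝒢.usrc C = 𝒢.utgt D) : 𝒢.dual.mul x y (C + D - 𝒢.utgt D) = x C + y D := by
  have h := 𝒢.dual_src_eq_tgt_iff.1 hxy _ (𝒢.sub_usrc_mem_core D)
  simp only [map_sub, utgt_usrc] at h
  simp only [dual_mul, add_apply, ContinuousLinearMap.comp_apply, map_sub,
    map_add, usrc_utgt, hCD]
  linarith

/-- `B' - utgt B'` lies in `ker dt`, which commutes with `ker ds`; hence in the cross term `A` may
be replaced by `usrc A = utgt B`. The other cross term is symmetric, and what is left matches term
by term. -/
theorem bracket_star {A B A' B' : E₁} (h : 𝒢.usrc A = 𝒢.utgt B) (h' : 𝒢.usrc A' = 𝒢.utgt B') :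
    bracket G₁ (A + B - 𝒢.utgt B) (A' + B' - 𝒢.utgt B') =
      bracket G₁ A A' + bracket G₁ B B' - 𝒢.utgt (bracket G₁ B B') := by
  have e1 := 𝒢.bracket_of_usrc A (K := B' - 𝒢.utgt B') (by simp)
  have e2 := 𝒢.bracket_of_usrc A' (K := B - 𝒢.utgt B) (by simp)
  rw [bracket_skew G₁, bracket_skew G₁ (Y := 𝒢.usrc A'), neg_inj] at e2
  rw [h] at e1
  rw [h'] at e2
  rw [utgt_bracket]
  simp only [map_sub, map_add, LinearMap.sub_apply, LinearMap.add_apply] at *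
  rw [sub_eq_iff_eq_add] at e1 e2
  rw [e1, e2]
  abel

theorem dual_mul_bracket_star (hxy : 𝒢.dual.src x = 𝒢.dual.tgt y) {A B A' B' : E₁}
    (h : 𝒢.usrc A = 𝒢.utgt B) (h' : 𝒢.usrc A' = 𝒢.utgt B') :
    𝒢.dual.mul x y (bracket G₁ (A + B - 𝒢.utgt B) (A' + B' - 𝒢.utgt B')) =
      x (bracket G₁ A A') + y (bracket G₁ B B') := by
  rw [𝒢.bracket_star h h', 𝒢.dual_mul_apply_star hxy]
  rw [usrc_bracket, utgt_bracket, h, h']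

theorem coad_dual_mul (hxy : 𝒢.dual.src x = 𝒢.dual.tgt y) {A B : E₁}
    (h : 𝒢.usrc A = 𝒢.utgt B) :
    coad G₁ (𝒢.dual.mul x y) (A + B - 𝒢.utgt B) =
      𝒢.dual.mul (coad G₁ x A) (coad G₁ y B) := by
  ext W
  -- Every `W` is a product, `W = W ∗ usrc W`, so testing on products suffices.
  have := 𝒢.dual_mul_bracket_star hxy h (A' := W) (B' := 𝒢.usrc W) (by simp)
  simp only [utgt_usrc, add_sub_cancel_right] at this
  rw [coad_apply, this, dual_mul]
  rfl

/-- Composability of `(x, y)` on the core element `[usrc A, h]` turns `x [A, h - utgt h]` into `y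
[usrc A, h]`, while `[B, h] = [utgt B, h]`. Only the defect `utgt B - usrc A` remains, and it need
not vanish: it has to stabilize the restriction of `y` to the core. -/
theorem coad_composable_iff (hxy : 𝒢.dual.src x = 𝒢.dual.tgt y) (A B : E₁) :
    𝒢.dual.src (coad G₁ x A) = 𝒢.dual.tgt (coad G₁ y B) ↔
      ∀ h ∈ 𝒢.core, y (bracket G₁ (𝒢.utgt B - 𝒢.usrc A) h) = 0 := by
  rw [dual_src_eq_tgt_iff]
  refine forall₂_congr fun h hh => ?_
  have hh' := 𝒢.mem_core_iff.1 hh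
  have hc : bracket G₁ (𝒢.usrc A) h ∈ 𝒢.core := by
    rw [mem_core_iff, usrc_bracket, hh', map_zero]
  have e := 𝒢.dual_src_eq_tgt_iff.1 hxy _ hc
  rw [utgt_bracket, utgt_usrc, ← map_sub, ← 𝒢.bracket_of_usrc A (by simp)] at e
  rw [coad_apply, coad_apply, e, map_sub, LinearMap.sub_apply, map_sub,
    ← 𝒢.bracket_core_of_utgt B hh', sub_eq_zero]
  exact eq_comm

theorem coad_composable (hxy : 𝒢.dual.src x = 𝒢.dual.tgt y) {A B : E₁}
    (h : 𝒢.usrc A = 𝒢.utgt B) : 𝒢.dual.src (coad G₁ x A) = 𝒢.dual.tgt (coad G₁ y B) := by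
  rw [𝒢.coad_composable_iff hxy, h, sub_self]
  simp

/-- The linear algebra behind coisotropy of the graph of the multiplication. -/
theorem coad_of_annihilates {X Y Z : E₁}
    (H : ∀ A B, 𝒢.usrc A = 𝒢.utgt B → x (bracket G₁ A X) + y (bracket G₁ B Y) =
      𝒢.dual.mul x y (bracket G₁ (A + B - 𝒢.utgt B) Z)) :
    𝒢.dual.src (coad G₁ x X) = 𝒢.dual.tgt (coad G₁ y Y) ∧
      coad G₁ (𝒢.dual.mul x y) Z = 𝒢.dual.mul (coad G₁ x X) (coad G₁ y Y) := by
  constructor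
  · rw [dual_src_eq_tgt_iff]
    intro h hh
    -- This composable pair has product `A ∗ B = 0`, so the right-hand side drops out.
    have e := H (-(h - 𝒢.utgt h)) h (by
      have := 𝒢.mem_core_iff.1 hh
      simp [this])
    have e0 : -(h - 𝒢.utgt h) + h - 𝒢.utgt h = 0 := by abel
    rw [e0, map_zero, LinearMap.zero_apply, map_zero, bracket_skew G₁, bracket_skew G₁ (X := Y),
      map_neg, map_neg, map_neg, map_neg] at e
    rw [coad_apply, coad_apply]
    linarith
  · ext W
    -- The product of this pair is `W` itself.
    have e := H W (𝒢.usrc W) (by simp)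
    rw [utgt_usrc, add_sub_cancel_right, bracket_skew G₁, bracket_skew G₁ (X := Y), bracket_skew G₁ (X := Z),
      map_neg, map_neg, map_neg] at e
    simp only [dual_mul, coad_apply, add_apply,
      ContinuousLinearMap.comp_apply] at e ⊢
    linarith

/-- On the orbit of a unit, composable infinitesimal coadjoint vectors come from composable
elements of the Lie 2-algebra. -/
theorem exists_coad_eq_zero {α : 𝒢.core →L[ℝ] ℝ} {g : G₁} (hx : x = coAd (𝒢.dual.unit α) g)
    (hxy : 𝒢.dual.src x = 𝒢.dual.tgt y) {A B : E₁}
    (h : 𝒢.dual.src (coad G₁ x A) = 𝒢.dual.tgt (coad G₁ y B)) :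
    ∃ C, coad G₁ x C = 0 ∧ 𝒢.usrc (A + C) = 𝒢.utgt B := by
  rw [𝒢.coad_composable_iff hxy] at h
  set k := 𝒢.utgt B - 𝒢.usrc A with hk
  set a := 𝒢.unit (𝒢.src g) with ha
  have hsa : 𝒢.src a = 𝒢.src g := by rw [ha, src_unit]
  have hky : 𝒢.usrc k = k := by simp [hk]
  -- The defect `k` stabilizes `t(y) = s(x) = α · s(g)`. `Ad a` carries it to the stabilizer of `α`,
  -- hence of `1_α` because `k` is a unit element; `Ad g⁻¹` carries that to the stabilizer of `x`.
  -- The source of the result is again `k`, which repairs the defect.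
  refine ⟨Ad g⁻¹ (Ad a k), ?_, ?_⟩
  · have e1 : coad G₁ (𝒢.dual.unit α) (Ad a k) = 0 := by
      ext W
      rw [coad_apply, dual_unit_apply, zero_apply]
      have e2 : Ad a⁻¹ (W - 𝒢.usrc W) ∈ 𝒢.core := by
        rw [mem_core_iff, usrc_Ad]; simp
      have e3 := h _ e2
      have hc : bracket G₁ k (Ad a⁻¹ (W - 𝒢.usrc W)) ∈ 𝒢.core := by
        rw [mem_core_iff, usrc_bracket, 𝒢.mem_core_iff.1 e2, map_zero]
      have e4 := DFunLike.congr_fun hxy (⟨_, hc⟩ : 𝒢.core)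
      rw [dual_tgt_apply, e3, hx, dual_src_coAd, 𝒢.dual_isGroupoid.src_unit,
        coreCoAct_apply] at e4
      rw [← e4]
      congr 1
      ext
      rw [coe_coreAct, coe_proj, usrc_bracket, usrc_Ad, hsa, hky]
      show _ = Ad a (bracket G₁ k (Ad a⁻¹ (W - 𝒢.usrc W)))
      rw [Ad_bracket, ← ContinuousLinearMap.comp_apply (Ad a) (Ad a⁻¹), ← Ad_mul, mul_inv_cancel,
        Ad_one, ContinuousLinearMap.id_apply]
      exact (map_sub (bracket G₁ (Ad a k)) _ _).symm
    rw [hx, coad_coAd, ← ContinuousLinearMap.comp_apply, ← Ad_mul, mul_inv_cancel, Ad_one,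
      ContinuousLinearMap.id_apply, e1]
    ext
    simp
  · rw [map_add, usrc_Ad, usrc_Ad, hky, src_inv_mul, ha, src_unit, unit_inv,
      ← ContinuousLinearMap.comp_apply, ← Ad_mul, inv_mul_cancel, Ad_one,
      ContinuousLinearMap.id_apply, hk]
    abel

end Infinitesimal

end LieTwo.LieTwoGroup

/-! ### The constant rank theorem. -/

section ConstantRank

variable {E F : Type*} [NormedAddCommGroup E] [NormedSpace ℝ E] [FiniteDimensional ℝ E]
  [NormedAddCommGroup F] [NormedSpace ℝ F] [FiniteDimensional ℝ F]

omit [FiniteDimensional ℝ F] in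
/-- A linear map `A` of rank `d` has a left factor `L` onto `ℝᵈ` that is injective on the range of
`A`, and together with a projection `π` to the kernel of `A` this gives an isomorphism. -/
theorem exists_linear_splitting (A : E →L[ℝ] F) {d : ℕ} (hA : Module.finrank ℝ A.range = d) :
    ∃ (L : F →L[ℝ] EuclideanSpace ℝ (Fin d)) (π : E →L[ℝ] A.ker)
      (e : E ≃L[ℝ] EuclideanSpace ℝ (Fin d) × A.ker),
      (e : E →L[ℝ] EuclideanSpace ℝ (Fin d) × A.ker) = (L.comp A).prod π := by
  obtain ⟨P, hP⟩ := Submodule.ClosedComplemented.of_finiteDimensional (𝕜 := ℝ) A.range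
  obtain ⟨π, hπ⟩ := Submodule.ClosedComplemented.of_finiteDimensional (𝕜 := ℝ) A.ker
  have hdim : Module.finrank ℝ A.range = Module.finrank ℝ (EuclideanSpace ℝ (Fin d)) := by
    rw [hA, finrank_euclideanSpace_fin]
  let ε : A.range ≃L[ℝ] EuclideanSpace ℝ (Fin d) := ContinuousLinearEquiv.ofFinrankEq hdim
  let L : F →L[ℝ] EuclideanSpace ℝ (Fin d) := (ε : A.range →L[ℝ] EuclideanSpace ℝ (Fin d)).comp P
  have hinj : Function.Injective ((L.comp A).prod π) := by
    rw [injective_iff_map_eq_zero]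
    intro u hu
    have h1 : ε (P (A u)) = 0 := congrArg Prod.fst hu
    have h2 : π u = 0 := congrArg Prod.snd hu
    have h3 : P (A u) = ⟨A u, LinearMap.mem_range_self _ u⟩ :=
      hP ⟨A u, LinearMap.mem_range_self _ u⟩
    rw [h3, map_eq_zero_iff ε ε.injective] at h1
    have h4 : A u = 0 := congrArg Subtype.val h1
    have h5 : π u = ⟨u, LinearMap.mem_ker.2 h4⟩ := hπ ⟨u, LinearMap.mem_ker.2 h4⟩
    rw [h5] at h2
    exact congrArg Subtype.val h2
  have hfr : Module.finrank ℝ E = Module.finrank ℝ (EuclideanSpace ℝ (Fin d) × A.ker) := by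
    rw [Module.finrank_prod, ← hdim]
    exact (LinearMap.finrank_range_add_finrank_ker (A : E →ₗ[ℝ] F)).symm
  refine ⟨L, π, (LinearEquiv.ofInjectiveOfFinrankEq
    (((L.comp A).prod π : E →L[ℝ] _) : E →ₗ[ℝ] _) hinj hfr).toContinuousLinearEquiv, ?_⟩
  ext u <;> rfl

omit [FiniteDimensional ℝ F] in
/-- The constant rank theorem, in the form of a section of `L ∘ f` through which `f` factors. -/
theorem exists_section_of_constant_rank {f : E → F} {U : Set E} {e₀ : E} {d : ℕ} (hU : IsOpen U)
    (he₀ : e₀ ∈ U) (hf : ContDiffOn ℝ ∞ f U)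
    (hd : ∀ e ∈ U, Module.finrank ℝ (fderiv ℝ f e).range = d) :
    ∃ (L : F →L[ℝ] EuclideanSpace ℝ (Fin d)) (σ : EuclideanSpace ℝ (Fin d) → E) (N : Set E)
      (B : Set (EuclideanSpace ℝ (Fin d))), IsOpen N ∧ e₀ ∈ N ∧ N ⊆ U ∧ IsOpen B ∧
      (∀ e ∈ N, L (f e) ∈ B) ∧ ContDiffOn ℝ ∞ σ B ∧ (∀ v ∈ B, σ v ∈ N) ∧
      (∀ v ∈ B, L (f (σ v)) = v) ∧ (∀ e ∈ N, f (σ (L (f e))) = f e) ∧ σ (L (f e₀)) = e₀ := by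
  obtain ⟨L, π, ε, hε⟩ := exists_linear_splitting (fderiv ℝ f e₀) (hd e₀ he₀)
  have hfa : ∀ e ∈ U, ContDiffAt ℝ ∞ f e := fun e he => hf.contDiffAt (hU.mem_nhds he)
  have hfd : ∀ e ∈ U, HasFDerivAt f (fderiv ℝ f e) e := fun e he =>
    ((hfa e he).differentiableAt (by simp)).hasFDerivAt
  -- The kernel component `π` completes `L ∘ f` to a local diffeomorphism at `e₀`.
  set Ψ : E → EuclideanSpace ℝ (Fin d) × (fderiv ℝ f e₀).ker := fun e => (L (f e), π e) with hΨ
  have hΨa : ∀ e ∈ U, ContDiffAt ℝ ∞ Ψ e := fun e he =>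
    (L.contDiff.contDiffAt.comp e (hfa e he)).prodMk π.contDiff.contDiffAt
  have hΨd : ∀ e ∈ U, HasFDerivAt Ψ ((L.comp (fderiv ℝ f e)).prod π) e := fun e he =>
    (L.hasFDerivAt.comp e (hfd e he)).prodMk π.hasFDerivAt
  have hΨ0 : HasFDerivAt Ψ (ε : E →L[ℝ] _) e₀ := by rw [hε]; exact hΨd e₀ he₀
  have hne : (∞ : ℕ∞ω) ≠ 0 := by simp
  -- Restricting to the points where the derivative of `Ψ` is invertible makes the local inverse
  -- smooth on its whole domain and keeps `L` onto on the range of `Df`.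
  set W : Set E := U ∩ (fun e => (L.comp (fderiv ℝ f e)).prod π) ⁻¹'
    Set.range ((↑) : (E ≃L[ℝ] EuclideanSpace ℝ (Fin d) × (fderiv ℝ f e₀).ker) → E →L[ℝ] _) with hW
  have hWo : IsOpen W := by
    refine ContinuousOn.isOpen_inter_preimage ?_ hU ContinuousLinearEquiv.isOpen
    have h1 : ContinuousOn (fderiv ℝ f) U := hf.continuousOn_fderiv_of_isOpen hU (by simp)
    have h2 : Continuous fun A : E →L[ℝ] F => (L.comp A).prod π := by
      have h3 : (fun A : E →L[ℝ] F => (L.comp A).prod π) = fun A =>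
          (ContinuousLinearMap.inl ℝ _ _).comp (L.comp A) +
            (ContinuousLinearMap.inr ℝ _ _).comp π := by
        funext A
        ext u <;> simp
      rw [h3]
      fun_prop
    exact h2.comp_continuousOn h1
  have hW0 : e₀ ∈ W := ⟨he₀, ε, hε⟩
  let Φ := ((hΨa e₀ he₀).toOpenPartialHomeomorph Ψ hΨ0 hne).restr W
  have hΦs : ∀ e ∈ Φ.source, e ∈ W := fun e he => by
    have := he.2
    rwa [hWo.interior_eq] at this
  have hΦ0 : e₀ ∈ Φ.source := by
    refine ⟨(hΨa e₀ he₀).mem_toOpenPartialHomeomorph_source hΨ0 hne, ?_⟩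
    rwa [hWo.interior_eq]
  have hΦc : ∀ e, Φ e = Ψ e := fun e => rfl
  have hsymm : ∀ p ∈ Φ.target, ContDiffAt ℝ ∞ Φ.symm p := fun p hp => by
    obtain ⟨hU', ε', hε'⟩ := hΦs _ (Φ.map_target hp)
    refine Φ.contDiffAt_symm (f₀' := ε') hp ?_ (hΨa _ hU')
    rw [hε']
    exact hΨd _ hU'
  obtain ⟨r, hr, hball⟩ := Metric.isOpen_iff.1 Φ.open_target (Φ e₀) (Φ.map_source hΦ0)
  set v₀ := L (f e₀)
  set k₀ := π e₀
  have hprod : ∀ v ∈ Metric.ball v₀ r, ∀ k ∈ Metric.ball k₀ r, (v, k) ∈ Φ.target :=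
    fun v hv k hk => hball (by
      rw [hΦc, Metric.mem_ball, Prod.dist_eq]
      exact max_lt hv hk)
  have hk₀ : k₀ ∈ Metric.ball k₀ r := Metric.mem_ball_self hr
  have hv₀ : v₀ ∈ Metric.ball v₀ r := Metric.mem_ball_self hr
  have hLf : ∀ v ∈ Metric.ball v₀ r, ∀ k ∈ Metric.ball k₀ r, L (f (Φ.symm (v, k))) = v :=
    fun v hv k hk => congrArg Prod.fst (Φ.right_inv (hprod v hv k hk))
  have hπ' : ∀ v ∈ Metric.ball v₀ r, ∀ k ∈ Metric.ball k₀ r, π (Φ.symm (v, k)) = k :=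
    fun v hv k hk => congrArg Prod.snd (Φ.right_inv (hprod v hv k hk))
  -- In the coordinates `(v, k)` the function `L ∘ f` is `v`, so `L` kills the `k`-derivative of
  -- `f`. The rank of `Df` is still `d`, so `L` is injective on its range and that derivative
  -- vanishes. Balls are connected, hence `f` depends on `v` alone.
  have hconst : ∀ v ∈ Metric.ball v₀ r, ∀ k ∈ Metric.ball k₀ r,
      f (Φ.symm (v, k)) = f (Φ.symm (v, k₀)) := by
    intro v hv k hk
    have hder : ∀ k ∈ Metric.ball k₀ r, HasFDerivAt (fun k => f (Φ.symm (v, k)))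
        ((fderiv ℝ f (Φ.symm (v, k))).comp ((fderiv ℝ Φ.symm (v, k)).comp
          (ContinuousLinearMap.inr ℝ _ _))) k := fun k hk => by
      have hp := hprod v hv k hk
      have h1 := ((hsymm _ hp).differentiableAt hne).hasFDerivAt
      have h2 := HasFDerivAt.comp k (f := fun k => (v, k)) h1 (hasFDerivAt_prodMk_right v k)
      exact (hfd _ (hΦs _ (Φ.map_target hp)).1).comp k h2
    refine Metric.isOpen_ball.is_const_of_fderiv_eq_zero (𝕜 := ℝ) (f := fun k => f (Φ.symm (v, k)))
      (convex_ball _ _).isPreconnected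
      (fun k hk => (hder k hk).differentiableAt.differentiableWithinAt) (fun k hk => ?_) hk hk₀
    obtain ⟨hU', ε', hε'⟩ := hΦs _ (Φ.map_target (hprod v hv k hk))
    have hLinj : ∀ u, L (fderiv ℝ f (Φ.symm (v, k)) u) = 0 → fderiv ℝ f (Φ.symm (v, k)) u = 0 := by
      set A := fderiv ℝ f (Φ.symm (v, k))
      have hsurj : Function.Surjective ((L : F →ₗ[ℝ] _).comp A.range.subtype) := fun w => by
        obtain ⟨u, hu⟩ := ε'.surjective (w, 0)
        refine ⟨⟨A u, LinearMap.mem_range_self _ u⟩, ?_⟩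
        have := congrArg (fun T : E →L[ℝ] _ => (T u).1) hε'
        exact this.symm.trans (congrArg Prod.fst hu)
      have hinj := (LinearMap.injective_iff_surjective_of_finrank_eq_finrank (by
        rw [hd _ hU', finrank_euclideanSpace_fin])).2 hsurj
      intro u hu
      have := (injective_iff_map_eq_zero _).1 hinj ⟨A u, LinearMap.mem_range_self _ u⟩ hu
      exact congrArg Subtype.val this
    rw [(hder k hk).fderiv]
    ext w
    refine hLinj _ ?_
    have h3 := L.hasFDerivAt.comp k (hder k hk)
    have h4 : (fun k => L (f (Φ.symm (v, k)))) =ᶠ[𝓝 k] fun _ => v :=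
      Filter.eventuallyEq_of_mem (Metric.isOpen_ball.mem_nhds hk) fun k hk => hLf v hv k hk
    have h5 := h3.unique ((hasFDerivAt_const v k).congr_of_eventuallyEq h4)
    exact DFunLike.congr_fun h5 w
  refine ⟨L, fun v => Φ.symm (v, k₀),
    Φ.source ∩ Φ ⁻¹' (Metric.ball v₀ r ×ˢ Metric.ball k₀ r), Metric.ball v₀ r,
    Φ.isOpen_inter_preimage (Metric.isOpen_ball.prod Metric.isOpen_ball), ⟨hΦ0, hv₀, hk₀⟩,
    fun e he => (hΦs e he.1).1, Metric.isOpen_ball, fun e he => he.2.1, ?_, ?_,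
    fun v hv => hLf v hv k₀ hk₀, ?_, Φ.left_inv hΦ0⟩
  · intro v hv
    have h1 : ContDiffAt ℝ ∞ (fun v : EuclideanSpace ℝ (Fin d) => (v, k₀)) v :=
      contDiffAt_id.prodMk contDiffAt_const
    exact ((hsymm _ (hprod v hv k₀ hk₀)).comp v h1).contDiffWithinAt
  · intro v hv
    refine ⟨Φ.map_target (hprod v hv k₀ hk₀), ?_⟩
    rw [Set.mem_preimage, Φ.right_inv (hprod v hv k₀ hk₀)]
    exact ⟨hv, hk₀⟩
  · intro e he
    have h1 := hconst _ he.2.1 _ he.2.2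
    have h2 : Φ.symm ((Φ e).1, (Φ e).2) = e := Φ.left_inv he.1
    rw [h2] at h1
    exact h1.symm

end ConstantRank

/-! ### Orbits of smooth actions as immersed manifolds. -/

section OrbitManifolds

variable {E G F : Type*} [NormedAddCommGroup E] [NormedSpace ℝ E]
  [TopologicalSpace G] [ChartedSpace E G] [Group G] [LieGroup 𝓘(ℝ, E) ∞ G]
  [NormedAddCommGroup F] [NormedSpace ℝ F]

/-- Smooth right actions of a Lie group on a normed space. -/
structure IsSmoothRightAction {E G F : Type*} [NormedAddCommGroup E] [NormedSpace ℝ E]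
    [TopologicalSpace G] [ChartedSpace E G] [Group G]
    [NormedAddCommGroup F] [NormedSpace ℝ F] (act : F → G → F) : Prop where
  one : ∀ x, act x 1 = x
  mul : ∀ x g h, act x (g * h) = act (act x g) h
  smooth : ContMDiff (𝓘(ℝ, F).prod 𝓘(ℝ, E)) 𝓘(ℝ, F) ∞ (fun p : F × G => act p.1 p.2)

variable {act : F → G → F} {x₀ : F}

namespace IsSmoothRightAction

omit [LieGroup 𝓘(ℝ, E) ∞ G]

theorem smooth_left (h : IsSmoothRightAction (E := E) act) (g : G) :
    ContMDiff 𝓘(ℝ, F) 𝓘(ℝ, F) ∞ (fun x => act x g) :=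
  h.smooth.comp (contMDiff_id.prodMk contMDiff_const)

theorem smooth_right (h : IsSmoothRightAction (E := E) act) (x : F) :
    ContMDiff 𝓘(ℝ, E) 𝓘(ℝ, F) ∞ (fun g => act x g) :=
  h.smooth.comp (contMDiff_const.prodMk contMDiff_id)

theorem act_inv_act (h : IsSmoothRightAction (E := E) act) (x : F) (g : G) :
    act (act x g) g⁻¹ = x := by
  rw [← h.mul, mul_inv_cancel, h.one]

theorem tder_act_injective (h : IsSmoothRightAction (E := E) act) (x : F) (g : G) :
    Function.Injective (tder 𝓘(ℝ, F) 𝓘(ℝ, F) (fun x => act x g) x) := by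
  have h1 := tder_comp (x := x) rfl ((h.smooth_left g⁻¹).mdAt _) ((h.smooth_left g).mdAt _)
  simp only [h.act_inv_act, tder_id] at h1
  exact Function.LeftInverse.injective fun v => (DFunLike.congr_fun h1 v).symm

end IsSmoothRightAction

theorem tder_mulRight_surjective (g : G) :
    Function.Surjective (tder 𝓘(ℝ, E) 𝓘(ℝ, E) (fun x : G => x * g) 1) := by
  have hR : ∀ g : G, ContMDiff 𝓘(ℝ, E) 𝓘(ℝ, E) ∞ (fun x : G => x * g) := fun g =>
    contMDiff_id.mul contMDiff_const
  have h1 := tder_comp (x := g) (f := fun x : G => x * g⁻¹) (g := fun x : G => x * g)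
    (mul_inv_cancel g) ((hR g).mdAt _) ((hR g⁻¹).mdAt _)
  simp only [inv_mul_cancel_right, tder_id] at h1
  exact Function.RightInverse.surjective fun v => (DFunLike.congr_fun h1 v).symm

theorem range_comp_of_surjective {E' : Type*} [NormedAddCommGroup E'] [NormedSpace ℝ E']
    (T : E →L[ℝ] F) {A : E' →L[ℝ] E} (hA : Function.Surjective A) :
    (T.comp A).range = T.range := by
  ext v
  constructor
  · rintro ⟨u, rfl⟩; exact ⟨A u, rfl⟩
  · rintro ⟨u, rfl⟩
    obtain ⟨w, rfl⟩ := hA u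
    exact ⟨w, rfl⟩

/-- Equivariance: right translation by `g` on the group corresponds to the diffeomorphism `x ↦ x ·
g`, so the orbit map has constant rank. -/
theorem IsSmoothRightAction.finrank_range (h : IsSmoothRightAction (E := E) act) (x₀ : F) (g : G) :
    Module.finrank ℝ (tder 𝓘(ℝ, E) 𝓘(ℝ, F) (fun g => act x₀ g) g).range =
      Module.finrank ℝ (tder 𝓘(ℝ, E) 𝓘(ℝ, F) (fun g => act x₀ g) 1).range := by
  have h1 := tder_comp (x := (1 : G)) (f := fun x : G => x * g) (g := fun g => act x₀ g)
    (one_mul g) ((h.smooth_right x₀).mdAt _)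
    ((contMDiff_id.mul contMDiff_const : ContMDiff 𝓘(ℝ, E) 𝓘(ℝ, E) ∞ _).mdAt _)
  have h2 := tder_comp (x := (1 : G)) (f := fun x : G => act x₀ x) (g := fun x => act x g)
    rfl ((h.smooth_left g).mdAt _) ((h.smooth_right x₀).mdAt _)
  simp only [h.mul] at h1
  rw [h2] at h1
  rw [← range_comp_of_surjective _ (tder_mulRight_surjective g), ← h1]
  have h3 : ((tder 𝓘(ℝ, F) 𝓘(ℝ, F) (fun x => act x g) (act x₀ 1)).comp
      (tder 𝓘(ℝ, E) 𝓘(ℝ, F) (fun g => act x₀ g) 1)).range =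
      (tder 𝓘(ℝ, E) 𝓘(ℝ, F) (fun g => act x₀ g) 1).range.map
        (tder 𝓘(ℝ, F) 𝓘(ℝ, F) (fun x => act x g) (act x₀ 1) : F →ₗ[ℝ] F) :=
    LinearMap.range_comp _ _
  rw [h3]
  exact (LinearEquiv.finrank_eq (Submodule.equivMapOfInjective _
    (h.tder_act_injective (act x₀ 1) g) _)).symm

/-- A slice for the orbit map at `1`: near `1`, the orbit map factors through a smooth section `τ`
of a linear coordinate map `L`. -/
structure OrbitSlice (E : Type*) {G F : Type*} [NormedAddCommGroup E] [NormedSpace ℝ E]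
    [TopologicalSpace G] [ChartedSpace E G] [Group G]
    [NormedAddCommGroup F] [NormedSpace ℝ F] (act : F → G → F) (x₀ : F) (d : ℕ) where
  L : F →L[ℝ] EuclideanSpace ℝ (Fin d)
  τ : EuclideanSpace ℝ (Fin d) → G
  N : Set G
  B : Set (EuclideanSpace ℝ (Fin d))
  isOpen_N : IsOpen N
  one_mem : (1 : G) ∈ N
  isOpen_B : IsOpen B
  mapsTo : ∀ g ∈ N, L (act x₀ g) ∈ B
  smooth : ContMDiffOn 𝓘(ℝ, EuclideanSpace ℝ (Fin d)) 𝓘(ℝ, E) ∞ τ B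
  τ_mem : ∀ v ∈ B, τ v ∈ N
  L_τ : ∀ v ∈ B, L (act x₀ (τ v)) = v
  act_τ : ∀ g ∈ N, act x₀ (τ (L (act x₀ g))) = act x₀ g
  τ_one : τ (L (act x₀ 1)) = 1

theorem IsSmoothRightAction.exists_slice [FiniteDimensional ℝ E]
    (h : IsSmoothRightAction (E := E) act) (x₀ : F) : ∃ d, Nonempty (OrbitSlice E act x₀ d) := by
  set e := extChartAt 𝓘(ℝ, E) (1 : G) with he
  set f : G → F := fun g => act x₀ g with hf
  have hfs : ContMDiff 𝓘(ℝ, E) 𝓘(ℝ, F) ∞ f := h.smooth_right x₀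
  have hsm : ContDiffOn ℝ ∞ (f ∘ e.symm) e.target := by
    rw [← contMDiffOn_iff_contDiffOn]
    exact hfs.comp_contMDiffOn (contMDiffOn_extChartAt_symm (1 : G))
  have hUo : IsOpen e.target := isOpen_extChartAt_target (1 : G)
  obtain ⟨L, σ, N, B, hN, h1N, hNU, hB, hmaps, hσ, hσN, hLσ, hfσ, hσ1⟩ :=
    exists_section_of_constant_rank (f := f ∘ e.symm) (U := e.target) (e₀ := e 1)
      (d := Module.finrank ℝ (tder 𝓘(ℝ, E) 𝓘(ℝ, F) f 1).range) hUo
      (mem_extChartAt_target (1 : G)) hsm (fun x hx => by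
        have hs : MDifferentiableAt 𝓘(ℝ, E) 𝓘(ℝ, E) e.symm x :=
          (contMDiffAt_symm_one hx).mdifferentiableAt (by simp)
        have h1 : tder 𝓘(ℝ, E) 𝓘(ℝ, F) (fun z => f (e.symm z)) x = _ :=
          tder_comp (x := x) rfl (hfs.mdAt _) hs
        rw [← tder_eq_fderiv, Function.comp_def, h1, range_comp_of_surjective,
          h.finrank_range x₀]
        have h2 := mfderivWithin_extChartAt_symm_comp_mfderiv_extChartAt (I := 𝓘(ℝ, E)) hx
        rw [modelWithCornersSelf_coe, Set.range_id, mfderivWithin_univ] at h2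
        exact fun v => ⟨_, DFunLike.congr_fun h2 v⟩)
  refine ⟨_, ⟨⟨L, fun v => e.symm (σ v), e.source ∩ e ⁻¹' N, B, ?_, ?_, hB, ?_, ?_, ?_, hLσ, ?_, ?_⟩⟩⟩
  · exact (continuousOn_extChartAt (1 : G)).isOpen_inter_preimage (isOpen_extChartAt_source _) hN
  · exact ⟨mem_extChartAt_source _, h1N⟩
  · intro g hg
    have := hmaps _ hg.2
    rwa [Function.comp_apply, e.left_inv hg.1] at this
  · exact (contMDiffOn_extChartAt_symm (1 : G)).comp hσ.contMDiffOn fun v hv => hNU (hσN v hv)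
  · intro v hv
    have := hNU (hσN v hv)
    refine ⟨e.map_target this, ?_⟩
    rw [Set.mem_preimage, e.right_inv this]
    exact hσN v hv
  · intro g hg
    have := hfσ _ hg.2
    rwa [Function.comp_apply, Function.comp_apply, e.left_inv hg.1] at this
  · rw [Function.comp_apply, e.left_inv (mem_extChartAt_source _)] at hσ1
    show e.symm (σ (L (f 1))) = 1
    rw [hσ1, e.left_inv (mem_extChartAt_source _)]

omit [ChartedSpace E G] [LieGroup 𝓘(ℝ, E) ∞ G] [NormedAddCommGroup E] [NormedSpace ℝ E] in
theorem Orbit.ext_val {X A : Type*} {act : X → A → X} {x₀ : X} {y z : Orbit act x₀}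
    (h : y.val = z.val) : y = z := by
  cases y; cases z; cases h; rfl

/-- The quotient topology of the orbit. -/
@[reducible] def orbitTopology {G F : Type*} [TopologicalSpace G] (act : F → G → F) (x₀ : F) :
    TopologicalSpace (Orbit act x₀) :=
  TopologicalSpace.coinduced (orbitMap act x₀) inferInstance

attribute [local instance] orbitTopology

omit [ChartedSpace E G] [LieGroup 𝓘(ℝ, E) ∞ G] [NormedAddCommGroup E] [NormedSpace ℝ E]
  [Group G] [NormedAddCommGroup F] [NormedSpace ℝ F] in
theorem continuous_orbitMap : Continuous (orbitMap act x₀) := continuous_coinduced_rng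

/-- The saturation of an open set is a union of its left translates by elements of the stabilizer.
-/
theorem IsSmoothRightAction.isOpenMap_orbitMap (h : IsSmoothRightAction (E := E) act) :
    IsOpenMap (orbitMap act x₀) := by
  have : IsTopologicalGroup G := topologicalGroup_of_lieGroup 𝓘(ℝ, E) ∞
  intro U hU
  rw [isOpen_coinduced]
  have h1 : orbitMap act x₀ ⁻¹' (orbitMap act x₀ '' U) =
      ⋃ k ∈ {k : G | act x₀ k = x₀}, (fun g => k * g) ⁻¹' U := by
    ext g
    simp only [Set.mem_preimage, Set.mem_image, Set.mem_iUnion, Set.mem_ofPred_eq, exists_prop]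
    constructor
    · rintro ⟨u, hu, hug⟩
      have h2 : act x₀ u = act x₀ g := congrArg Orbit.val hug
      refine ⟨u * g⁻¹, ?_, by simpa using hu⟩
      rw [h.mul, h2, h.act_inv_act]
    · rintro ⟨k, hk, hkg⟩
      refine ⟨_, hkg, Orbit.ext_val ?_⟩
      show act x₀ (k * g) = act x₀ g
      rw [h.mul, hk]
  rw [h1]
  exact isOpen_biUnion fun k _ => hU.preimage (continuous_const_mul k)

omit [LieGroup 𝓘(ℝ, E) ∞ G] in
theorem IsSmoothRightAction.continuous_val (h : IsSmoothRightAction (E := E) act) :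
    Continuous (Orbit.val : Orbit act x₀ → F) :=
  continuous_coinduced_dom.2 (h.smooth_right x₀).continuous

namespace OrbitSlice

variable {d : ℕ} (S : OrbitSlice E act x₀ d) (h : IsSmoothRightAction (E := E) act)

include h in
omit [LieGroup 𝓘(ℝ, E) ∞ G] in
theorem act_mul_inv (n g : G) : act (act x₀ (n * g)) g⁻¹ = act x₀ n := by
  rw [h.mul, h.act_inv_act]

/-- The chart of the orbit around `x₀ · g`. -/
def chart (g : G) : OpenPartialHomeomorph (Orbit act x₀) (EuclideanSpace ℝ (Fin d)) where
  -- The slice at `1` is moved to `g` by the action. The coordinate is the restriction of a smooth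
  -- function on `F`, so smoothness of transition maps is checked in `F`.
  toFun y := S.L (act y.val g⁻¹)
  invFun v := orbitMap act x₀ (S.τ v * g)
  source := orbitMap act x₀ '' ((fun n => n * g) '' S.N)
  target := S.B
  map_source' := by
    rintro _ ⟨_, ⟨n, hn, rfl⟩, rfl⟩
    show S.L (act (act x₀ (n * g)) g⁻¹) ∈ S.B
    rw [act_mul_inv h]
    exact S.mapsTo n hn
  map_target' v hv := ⟨_, ⟨_, S.τ_mem v hv, rfl⟩, rfl⟩
  left_inv' := by
    rintro _ ⟨_, ⟨n, hn, rfl⟩, rfl⟩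
    refine Orbit.ext_val ?_
    show act x₀ (S.τ (S.L (act (act x₀ (n * g)) g⁻¹)) * g) = act x₀ (n * g)
    rw [act_mul_inv h, h.mul, S.act_τ n hn, h.mul]
  right_inv' v hv := by
    show S.L (act (act x₀ (S.τ v * g)) g⁻¹) = v
    rw [act_mul_inv h, S.L_τ v hv]
  open_source := by
    have : IsTopologicalGroup G := topologicalGroup_of_lieGroup 𝓘(ℝ, E) ∞
    exact h.isOpenMap_orbitMap _ (isOpenMap_mul_right g _ S.isOpen_N)
  open_target := S.isOpen_B
  continuousOn_toFun :=
    (S.L.continuous.comp ((h.smooth_left g⁻¹).continuous.comp h.continuous_val)).continuousOn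
  continuousOn_invFun := by
    have : IsTopologicalGroup G := topologicalGroup_of_lieGroup 𝓘(ℝ, E) ∞
    exact continuous_orbitMap.comp_continuousOn
      ((continuous_mul_const g).comp_continuousOn S.smooth.continuousOn)

theorem mem_chart_source (g : G) : orbitMap act x₀ g ∈ (S.chart h g).source :=
  ⟨g, ⟨1, S.one_mem, one_mul g⟩, rfl⟩

/-- The manifold structure of the orbit. -/
@[reducible] noncomputable def chartedSpace :
    ChartedSpace (EuclideanSpace ℝ (Fin d)) (Orbit act x₀) where
  atlas := Set.range (S.chart h)
  chartAt y := S.chart h y.mem.choose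
  mem_chart_source y := by
    have h1 : orbitMap act x₀ y.mem.choose = y := Orbit.ext_val y.mem.choose_spec
    have := S.mem_chart_source h y.mem.choose
    rwa [h1] at this
  chart_mem_atlas y := ⟨_, rfl⟩

theorem contMDiffOn_chart_symm_val (g : G) : ContMDiffOn (𝓡 d) 𝓘(ℝ, F) ∞
    (fun v => ((S.chart h g).symm v).val) S.B :=
  (h.smooth_right x₀).comp_contMDiffOn (S.smooth.mul contMDiffOn_const)

theorem isManifold : letI := S.chartedSpace h; IsManifold (𝓡 d) ∞ (Orbit act x₀) := by
  let _ := S.chartedSpace h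
  refine isManifold_of_contDiffOn _ _ _ ?_
  rintro _ _ ⟨g, rfl⟩ ⟨g', rfl⟩
  rw [← contMDiffOn_iff_contDiffOn]
  have h1 := (S.L.contMDiff.comp (h.smooth_left g'⁻¹)).comp_contMDiffOn
    (S.contMDiffOn_chart_symm_val h g)
  exact h1.mono fun v hv => hv.1.1

theorem contMDiff_val : letI := S.chartedSpace h;
    ContMDiff (𝓡 d) 𝓘(ℝ, F) ∞ (Orbit.val : Orbit act x₀ → F) := by
  let _ := S.chartedSpace h
  have := S.isManifold h
  intro y
  obtain ⟨g, hg⟩ := y.mem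
  have hy : y ∈ (S.chart h g).source := by
    rw [← show orbitMap act x₀ g = y from Orbit.ext_val hg]
    exact S.mem_chart_source h g
  have hc : ContMDiffAt (𝓡 d) (𝓡 d) ∞ (S.chart h g) y :=
    contMDiffAt_of_mem_maximalAtlas (IsManifold.subset_maximalAtlas ⟨g, rfl⟩) hy
  have h1 := ((S.contMDiffOn_chart_symm_val h g).contMDiffAt
    (S.isOpen_B.mem_nhds ((S.chart h g).map_source hy))).comp y hc
  refine h1.congr_of_eventuallyEq ?_
  filter_upwards [(S.chart h g).open_source.mem_nhds hy] with z hz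
  exact congrArg Orbit.val ((S.chart h g).left_inv hz).symm

theorem contMDiff_orbitMap : letI := S.chartedSpace h;
    ContMDiff 𝓘(ℝ, E) (𝓡 d) ∞ (orbitMap act x₀) := by
  let _ := S.chartedSpace h
  have := S.isManifold h
  intro g
  have hg := S.mem_chart_source h g
  have hc : ContMDiffAt (𝓡 d) (𝓡 d) ∞ (S.chart h g).symm (S.chart h g (orbitMap act x₀ g)) :=
    contMDiffAt_symm_of_mem_maximalAtlas (IsManifold.subset_maximalAtlas ⟨g, rfl⟩)
      ((S.chart h g).map_source hg)
  have h0 : ContMDiff 𝓘(ℝ, E) (𝓡 d) ∞ (fun g' => S.chart h g (orbitMap act x₀ g')) :=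
    S.L.contMDiff.comp ((h.smooth_left g⁻¹).comp (h.smooth_right x₀))
  have h1 := hc.comp g (h0 g)
  refine h1.congr_of_eventuallyEq ?_
  filter_upwards [continuous_orbitMap.continuousAt.preimage_mem_nhds
    ((S.chart h g).open_source.mem_nhds hg)] with z hz
  exact ((S.chart h g).left_inv hz).symm

include S h in
/-- Local sections of the orbit map, defined near the orbit in the ambient space. -/
theorem exists_ambient_section (g : G) : ∃ s : F → G,
    ContMDiffAt 𝓘(ℝ, F) 𝓘(ℝ, E) ∞ s (act x₀ g) ∧ s (act x₀ g) = g ∧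
      ∀ᶠ y in 𝓝 (orbitMap act x₀ g), orbitMap act x₀ (s y.val) = y := by
  refine ⟨fun w => S.τ (S.L (act w g⁻¹)) * g, ?_, ?_, ?_⟩
  · have h0 : S.L (act (act x₀ g) g⁻¹) ∈ S.B := by
      have := S.mapsTo 1 S.one_mem
      rw [h.one] at this
      rwa [h.act_inv_act]
    have h1 := ContMDiffAt.comp (act x₀ g) (g := S.τ) (f := fun w => S.L (act w g⁻¹))
      (S.smooth.contMDiffAt (S.isOpen_B.mem_nhds h0))
      ((S.L.contMDiff.comp (h.smooth_left g⁻¹)) (act x₀ g))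
    exact h1.mul contMDiffAt_const
  · show S.τ (S.L (act (act x₀ g) g⁻¹)) * g = g
    have := S.τ_one
    rw [h.one] at this
    rw [h.act_inv_act, this, one_mul]
  · filter_upwards [(S.chart h g).open_source.mem_nhds (S.mem_chart_source h g)] with z hz
    exact (S.chart h g).left_inv hz

end OrbitSlice

end OrbitManifolds

/-- Local smooth sections of the orbit map through every group element. -/
def HasLocalSections {E G F : Type*} [NormedAddCommGroup E] [NormedSpace ℝ E]
    [TopologicalSpace G] [ChartedSpace E G] (act : F → G → F) (x₀ : F) (d : ℕ)
    [TopologicalSpace (Orbit act x₀)]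
    [ChartedSpace (EuclideanSpace ℝ (Fin d)) (Orbit act x₀)] : Prop :=
  ∀ g : G, ∃ s : Orbit act x₀ → G, ContMDiffAt (𝓡 d) 𝓘(ℝ, E) ∞ s (orbitMap act x₀ g) ∧
    s (orbitMap act x₀ g) = g ∧ ∀ᶠ y in 𝓝 (orbitMap act x₀ g), orbitMap act x₀ (s y) = y

section

variable {E G F : Type*} [NormedAddCommGroup E] [NormedSpace ℝ E] [FiniteDimensional ℝ E]
  [TopologicalSpace G] [ChartedSpace E G] [Group G] [LieGroup 𝓘(ℝ, E) ∞ G]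
  [NormedAddCommGroup F] [NormedSpace ℝ F]

/-- Orbits of smooth actions are manifolds. -/
theorem IsSmoothRightAction.exists_isOrbitManifold {act : F → G → F}
    (h : IsSmoothRightAction (E := E) act) (x₀ : F) :
    ∃ (d : ℕ) (_ : TopologicalSpace (Orbit act x₀))
      (_ : ChartedSpace (EuclideanSpace ℝ (Fin d)) (Orbit act x₀)),
      IsOrbitManifold (E := E) act x₀ d ∧ HasLocalSections (E := E) act x₀ d := by
  obtain ⟨d, ⟨S⟩⟩ := h.exists_slice x₀
  let _ := orbitTopology act x₀
  let _ := S.chartedSpace h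
  have hv : ContMDiff (𝓡 d) 𝓘(ℝ, F) ∞ (Orbit.val : Orbit act x₀ → F) := S.contMDiff_val h
  have ho : ContMDiff 𝓘(ℝ, E) (𝓡 d) ∞ (orbitMap act x₀) := S.contMDiff_orbitMap h
  have hsec : HasLocalSections (E := E) act x₀ d := fun g => by
    obtain ⟨s, hs, hsg, hev⟩ := S.exists_ambient_section h g
    exact ⟨fun y => s y.val, hs.comp (orbitMap act x₀ g) (hv _), hsg, hev⟩
  -- A section of the orbit map makes its derivative surjective. A section that extends to the
  -- ambient space gives a left inverse of the derivative of the inclusion. Local sections are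
  -- returned separately because later smoothness proofs use them.
  refine ⟨d, _, _, ⟨S.isManifold h, ?_, ⟨ho, fun g => ?_⟩, ⟨hv, fun y => ?_⟩⟩, hsec⟩
  · exact T2Space.of_injective_continuous (f := Orbit.val) (fun _ _ => Orbit.ext_val)
      h.continuous_val
  · obtain ⟨s, hs, hsg, hev⟩ := hsec g
    have h1 := tder_comp (I := 𝓡 d) (x := orbitMap act x₀ g) hsg (ho.mdAt _)
      (hs.mdifferentiableAt (by simp))
    rw [tder_congr hev, tder_id] at h1
    exact Function.RightInverse.surjective fun v => (DFunLike.congr_fun h1 v).symm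
  · obtain ⟨g, hg⟩ := y.mem
    obtain rfl : orbitMap act x₀ g = y := Orbit.ext_val hg
    obtain ⟨s, hs, hsg, hev⟩ := S.exists_ambient_section h g
    have h2 : MDifferentiableAt 𝓘(ℝ, F) (𝓡 d) (fun w => orbitMap act x₀ (s w)) (act x₀ g) :=
      MDifferentiableAt.comp (act x₀ g) (ho.mdAt _) (hs.mdifferentiableAt (by simp))
    have h1 := tder_comp (I := 𝓡 d) (I'' := 𝓡 d) (x := orbitMap act x₀ g) (f := Orbit.val)
      (g := fun w => orbitMap act x₀ (s w)) rfl h2 (hv.mdAt _)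
    rw [tder_congr hev, tder_id] at h1
    exact Function.LeftInverse.injective fun v => (DFunLike.congr_fun h1 v).symm

end

/-! ### Smoothness and closedness of the Kostant–Kirillov–Souriau form. -/

section ImmersedForms

variable {V : Type*} [NormedAddCommGroup V] [NormedSpace ℝ V] [FiniteDimensional ℝ V]

omit [FiniteDimensional ℝ V] in
theorem twoForm_sub_left (η : V [⋀^Fin 2]→L[ℝ] ℝ) (p q r : V) :
    η ![p - q, r] = η ![p, r] - η ![q, r] := by
  have e : ∀ w, Function.update ![p, r] 0 w = ![w, r] := fun w => by
    funext i; fin_cases i <;> rfl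
  have := η.map_update_sub ![p, r] 0 p q
  rwa [e, e, e] at this

omit [FiniteDimensional ℝ V] in
theorem twoForm_swap (η : V [⋀^Fin 2]→L[ℝ] ℝ) (p q : V) : η ![q, p] = -η ![p, q] := by
  have e : ![p, q] ∘ Equiv.swap (0 : Fin 2) 1 = ![q, p] := by
    funext i; fin_cases i <;> rfl
  have := η.toAlternatingMap.map_swap ![p, q] (i := 0) (j := 1) (by decide)
  rwa [e] at this

omit [FiniteDimensional ℝ V] in
theorem twoForm_sub_right (η : V [⋀^Fin 2]→L[ℝ] ℝ) (p q r : V) :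
    η ![r, p - q] = η ![r, p] - η ![r, q] := by
  rw [twoForm_swap, twoForm_sub_left, twoForm_swap η r p, twoForm_swap η r q]
  ring

/-- A 2-form is recovered linearly from its values on pairs of basis vectors. -/
theorem contDiffAt_twoForm {Ω : V → V [⋀^Fin 2]→L[ℝ] ℝ} {y₀ : V}
    (h : ∀ u v, ContDiffAt ℝ ∞ (fun y => Ω y ![u, v]) y₀) : ContDiffAt ℝ ∞ Ω y₀ := by
  let b := Module.finBasis ℝ V
  let T : (V [⋀^Fin 2]→L[ℝ] ℝ) →ₗ[ℝ] ((Fin 2 → Fin (Module.finrank ℝ V)) → ℝ) :=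
    { toFun := fun η k => η fun i => b (k i)
      map_add' := fun _ _ => rfl
      map_smul' := fun _ _ => rfl }
  have hT : LinearMap.ker T = ⊥ := by
    rw [LinearMap.ker_eq_bot']
    intro η hη
    have h1 : η.toMultilinearMap = 0 := Module.Basis.ext_multilinear (fun _ => b) fun k =>
      congrFun hη k
    ext v
    exact DFunLike.congr_fun h1 v
  obtain ⟨g, hg⟩ := T.exists_leftInverse_of_injective hT
  have h2 : Ω = fun y => LinearMap.toContinuousLinearMap g (T (Ω y)) := by
    funext y
    exact (DFunLike.congr_fun hg (Ω y)).symm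
  rw [h2]
  refine (LinearMap.toContinuousLinearMap g).contDiff.contDiffAt.comp y₀ ?_
  refine contDiffAt_pi.2 fun k => ?_
  have e : (fun i => b (k i)) = ![b (k 0), b (k 1)] := by
    funext i; fin_cases i <;> rfl
  exact (h (b (k 0)) (b (k 1))).congr_of_eventuallyEq
    (Filter.Eventually.of_forall fun y => congrArg (Ω y) e)

variable {E G : Type*} [NormedAddCommGroup E] [NormedSpace ℝ E] [FiniteDimensional ℝ E]
  [TopologicalSpace G] [ChartedSpace E G] [Group G] [LieGroup 𝓘(ℝ, E) ∞ G]

variable (G) in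
/-- A parametrization `c` of an immersed submanifold of `𝔤^*` whose tangent spaces are those of the
coadjoint orbits. -/
structure IsCoadParam (c : V → E →L[ℝ] ℝ) (T : Set V) : Prop where
  isOpen : IsOpen T
  smooth : ContDiffOn ℝ ∞ c T
  injective : ∀ y ∈ T, Function.Injective (fderiv ℝ c y)
  range : ∀ y ∈ T, Set.range (fderiv ℝ c y) = Set.range (coad G (c y))

variable (G) in
/-- The pullback of the Kostant–Kirillov–Souriau form. -/
def IsPullbackKKS (c : V → E →L[ℝ] ℝ) (T : Set V) (Ω : V → V [⋀^Fin 2]→L[ℝ] ℝ) : Prop :=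
  ∀ y ∈ T, ∀ u v X Y, fderiv ℝ c y u = coad G (c y) X → fderiv ℝ c y v = coad G (c y) Y →
    Ω y ![u, v] = c y (bracket G X Y)

theorem contDiff_coad (X : E) : ContDiff ℝ ∞ fun ξ : E →L[ℝ] ℝ => coad G ξ X :=
  ((ContinuousLinearMap.compL ℝ E E ℝ).flip
    (LinearMap.toContinuousLinearMap (bracket G X))).contDiff

theorem fderiv_coad (X : E) (ξ η : E →L[ℝ] ℝ) :
    fderiv ℝ (fun ξ : E →L[ℝ] ℝ => coad G ξ X) ξ η = coad G η X := by
  have := ((ContinuousLinearMap.compL ℝ E E ℝ).flip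
    (LinearMap.toContinuousLinearMap (bracket G X))).fderiv (x := ξ)
  exact DFunLike.congr_fun this η

namespace IsCoadParam

variable {c : V → E →L[ℝ] ℝ} {T : Set V}

omit [FiniteDimensional ℝ V] in
theorem contDiffAt (h : IsCoadParam G c T) {y : V} (hy : y ∈ T) : ContDiffAt ℝ ∞ c y :=
  h.smooth.contDiffAt (h.isOpen.mem_nhds hy)

omit [FiniteDimensional ℝ V] in
theorem contDiffAt_fderiv (h : IsCoadParam G c T) {y : V} (hy : y ∈ T) :
    ContDiffAt ℝ ∞ (fderiv ℝ c) y :=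
  (h.contDiffAt hy).fderiv_right (by simp)

/-- The infinitesimal coadjoint action lifts to smooth vector fields. -/
theorem exists_field (h : IsCoadParam G c T) {y₀ : V} (hy₀ : y₀ ∈ T) (X : E) :
    ∃ A : V → V, ContDiffAt ℝ ∞ A y₀ ∧ ∀ᶠ y in 𝓝 y₀, fderiv ℝ c y (A y) = coad G (c y) X := by
  obtain ⟨g, hg⟩ := (fderiv ℝ c y₀ : V →ₗ[ℝ] E →L[ℝ] ℝ).exists_leftInverse_of_injective
    (LinearMap.ker_eq_bot.2 (h.injective y₀ hy₀))
  set L := LinearMap.toContinuousLinearMap g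
  have hL : L.comp (fderiv ℝ c y₀) = (ContinuousLinearEquiv.refl ℝ V : V →L[ℝ] V) := by
    ext u
    exact DFunLike.congr_fun hg u
  have hLs : ContDiffAt ℝ ∞ (fun y => L.comp (fderiv ℝ c y)) y₀ :=
    contDiffAt_const.clm_comp (h.contDiffAt_fderiv hy₀)
  have hopen : ∀ᶠ y in 𝓝 y₀, (L.comp (fderiv ℝ c y)) ∈
      Set.range ((↑) : (V ≃L[ℝ] V) → V →L[ℝ] V) :=
    hLs.continuousAt.eventually_mem (ContinuousLinearEquiv.isOpen.mem_nhds ⟨_, hL.symm⟩)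
  -- `L ∘ Dc` is the identity at `y₀`, hence invertible nearby. As `coad G (c y) X` lies in the
  -- range of `Dc`, inverting after applying `L` solves the equation exactly.
  refine ⟨fun y => (L.comp (fderiv ℝ c y)).inverse (L (coad G (c y) X)), ?_, ?_⟩
  · refine ContDiffAt.clm_apply ?_ ?_
    · refine ContDiffAt.comp y₀ (g := ContinuousLinearMap.inverse)
        (f := fun y => L.comp (fderiv ℝ c y)) ?_ hLs
      rw [hL]
      exact contDiffAt_map_inverse _
    · exact L.contDiff.contDiffAt.comp y₀ ((contDiff_coad X).contDiffAt.comp y₀ (h.contDiffAt hy₀))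
  · filter_upwards [hopen, h.isOpen.mem_nhds hy₀] with y hy hyT
    obtain ⟨e, he⟩ := hy
    obtain ⟨w, hw⟩ : coad G (c y) X ∈ Set.range (fderiv ℝ c y) := by
      rw [h.range y hyT]; exact ⟨X, rfl⟩
    rw [← hw, ← ContinuousLinearMap.comp_apply L, ← he, ContinuousLinearMap.inverse_equiv]
    simp

omit [FiniteDimensional ℝ V] in
-- Only the second vector needs an explicit generator; this makes the value depend smoothly on `u`
-- without a choice of lift.
theorem apply_field (h : IsCoadParam G c T) {Ω : V → V [⋀^Fin 2]→L[ℝ] ℝ}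
    (hΩ : IsPullbackKKS G c T Ω) {y : V} (hy : y ∈ T) (u : V) {v : V} {Y : E}
    (hv : fderiv ℝ c y v = coad G (c y) Y) : Ω y ![u, v] = fderiv ℝ c y u Y := by
  obtain ⟨X, hX⟩ : fderiv ℝ c y u ∈ Set.range (coad G (c y)) := by
    rw [← h.range y hy]; exact ⟨u, rfl⟩
  rw [hΩ y hy u v X Y hX.symm hv, ← hX, coad_apply]

/-- Lifts `A i` of generators equal a basis at `y₀`, hence form a frame nearby. The constant vector
`v` has smooth coefficients in this frame, and `apply_field` evaluates the form on each `A i`. -/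
theorem contDiffAt_form (h : IsCoadParam G c T) {Ω : V → V [⋀^Fin 2]→L[ℝ] ℝ}
    (hΩ : IsPullbackKKS G c T Ω) {y₀ : V} (hy₀ : y₀ ∈ T) : ContDiffAt ℝ ∞ Ω y₀ := by
  refine contDiffAt_twoForm fun u v => ?_
  let b := Module.finBasis ℝ V
  have hX : ∀ i, ∃ X, coad G (c y₀) X = fderiv ℝ c y₀ (b i) := fun i => by
    have : fderiv ℝ c y₀ (b i) ∈ Set.range (coad G (c y₀)) := by
      rw [← h.range y₀ hy₀]; exact ⟨_, rfl⟩
    exact this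
  choose X hX using hX
  choose A hAs hA using fun i => h.exists_field hy₀ (X i)
  have hA0 : ∀ i, A i y₀ = b i := fun i =>
    h.injective y₀ hy₀ ((hA i).self_of_nhds.trans (hX i))
  let β : Fin (Module.finrank ℝ V) → V →L[ℝ] ℝ := fun i => LinearMap.toContinuousLinearMap (b.coord i)
  have hβ : ∀ w : V, ∑ i, β i w • b i = w := fun w => b.sum_repr w
  let M : V → V →L[ℝ] V := fun y => ∑ i, (β i).smulRight (A i y)
  have hM0 : M y₀ = (ContinuousLinearEquiv.refl ℝ V : V →L[ℝ] V) := by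
    ext w
    simp only [M, hA0, sum_apply, ContinuousLinearMap.smulRight_apply, hβ]
    rfl
  have hMs : ContDiffAt ℝ ∞ M y₀ :=
    ContDiffAt.sum fun i _ => contDiffAt_const.smulRight (hAs i)
  have hopen : ∀ᶠ y in 𝓝 y₀, M y ∈ Set.range ((↑) : (V ≃L[ℝ] V) → V →L[ℝ] V) :=
    hMs.continuousAt.eventually_mem (ContinuousLinearEquiv.isOpen.mem_nhds ⟨_, hM0.symm⟩)
  have hinv : ContDiffAt ℝ ∞ (fun y => (M y).inverse) y₀ := by
    refine ContDiffAt.comp y₀ (g := ContinuousLinearMap.inverse) (f := M) ?_ hMs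
    rw [hM0]
    exact contDiffAt_map_inverse _
  have hfin : ContDiffAt ℝ ∞ (fun y => ∑ i, β i ((M y).inverse v) * fderiv ℝ c y u (X i)) y₀ := by
    refine ContDiffAt.sum fun i _ => ContDiffAt.mul ?_ ?_
    · exact (β i).contDiff.contDiffAt.comp y₀ (hinv.clm_apply contDiffAt_const)
    · exact ((h.contDiffAt_fderiv hy₀).clm_apply contDiffAt_const).clm_apply contDiffAt_const
  refine hfin.congr_of_eventuallyEq ?_
  filter_upwards [hopen, h.isOpen.mem_nhds hy₀, Filter.eventually_all.2 hA] with y hy hyT hAy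
  obtain ⟨e, he⟩ := hy
  have hv : M y ((M y).inverse v) = v := by
    rw [← he, ContinuousLinearMap.inverse_equiv]; simp
  have hv' : fderiv ℝ c y v = coad G (c y) (∑ i, β i ((M y).inverse v) • X i) := by
    conv_lhs => rw [← hv]
    have h1 : coad G (c y) (∑ i, β i ((M y).inverse v) • X i) =
        ∑ i, β i ((M y).inverse v) • coad G (c y) (X i) := by
      ext W; simp
    rw [h1]
    simp only [M, sum_apply, ContinuousLinearMap.smulRight_apply, map_sum, map_smul, hAy]
  rw [h.apply_field hΩ hyT u hv']
  simp

/-- Lift generators of the three vectors to fields `A`, `B`, `C`. Then `Ω(B, C) = c [Y, Z]` near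
`y₀`, which is easy to differentiate; passing back to constant vectors costs derivatives of the
fields. These combine into commutators, which lift the brackets of the generators, and the total is
a combination of Jacobi identities. -/
theorem extDeriv_eq_zero (h : IsCoadParam G c T) {Ω : V → V [⋀^Fin 2]→L[ℝ] ℝ}
    (hΩ : IsPullbackKKS G c T Ω) {y₀ : V} (hy₀ : y₀ ∈ T) : extDeriv Ω y₀ = 0 := by
  have hΩd : DifferentiableAt ℝ Ω y₀ := (h.contDiffAt_form hΩ hy₀).differentiableAt (by simp)
  have hcd : HasFDerivAt c (fderiv ℝ c y₀) y₀ :=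
    ((h.contDiffAt hy₀).differentiableAt (by simp)).hasFDerivAt
  have hc2 : HasFDerivAt (fderiv ℝ c) (fderiv ℝ (fderiv ℝ c) y₀) y₀ :=
    ((h.contDiffAt_fderiv hy₀).differentiableAt (by simp)).hasFDerivAt
  have hsymm : ∀ u v, fderiv ℝ (fderiv ℝ c) y₀ u v = fderiv ℝ (fderiv ℝ c) y₀ v u := fun u v =>
    (h.contDiffAt hy₀).isSymmSndFDerivAt (by simpa using natCast_le_infty 2) u v
  have hX : ∀ u, ∃ X, coad G (c y₀) X = fderiv ℝ c y₀ u := fun u => by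
    have : fderiv ℝ c y₀ u ∈ Set.range (coad G (c y₀)) := by
      rw [← h.range y₀ hy₀]; exact ⟨_, rfl⟩
    exact this
  -- the derivative of the form along a vector, evaluated on constant vectors
  have key : ∀ a b d X Y Z, coad G (c y₀) X = fderiv ℝ c y₀ a → ∀ B C : V → V,
      DifferentiableAt ℝ B y₀ → DifferentiableAt ℝ C y₀ → B y₀ = b → C y₀ = d →
      (∀ᶠ y in 𝓝 y₀, fderiv ℝ c y (B y) = coad G (c y) Y) →
      (∀ᶠ y in 𝓝 y₀, fderiv ℝ c y (C y) = coad G (c y) Z) →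
      fderiv ℝ (fun y => Ω y ![b, d]) y₀ a = c y₀ (bracket G X (bracket G Y Z)) -
        Ω y₀ ![fderiv ℝ B y₀ a, d] - Ω y₀ ![b, fderiv ℝ C y₀ a] := by
    intro a b d X Y Z hXa B C hB hC hBb hCd hB' hC'
    have h1 : (fun y => Ω y fun i => (![B, C] i) y) =ᶠ[𝓝 y₀] fun y => c y (bracket G Y Z) := by
      filter_upwards [hB', hC', h.isOpen.mem_nhds hy₀] with y hBy hCy hyT
      have e : (fun i => (![B, C] i) y) = ![B y, C y] := by
        funext i; fin_cases i <;> rfl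
      rw [e, hΩ y hyT _ _ Y Z hBy hCy]
    have h2 := fderiv_continuousAlternatingMap_apply_apply hΩd (g := ![B, C])
      (fun i => by fin_cases i <;> assumption) a
    rw [h1.fderiv_eq, (hcd.clm_apply (hasFDerivAt_const _ _)).fderiv, Fin.sum_univ_two] at h2
    rw [fderiv_continuousAlternatingMap_apply_const_apply hΩd]
    have e0 : (fun i => (![B, C] i) y₀) = ![b, d] := by
      funext i; fin_cases i <;> simp [hBb, hCd]
    have e1 : Function.update ![b, d] 0 (fderiv ℝ (![B, C] 0) y₀ a) =
        ![fderiv ℝ B y₀ a, d] := by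
      funext i; fin_cases i <;> simp
    have e2 : Function.update ![b, d] 1 (fderiv ℝ (![B, C] 1) y₀ a) =
        ![b, fderiv ℝ C y₀ a] := by
      funext i; fin_cases i <;> simp
    rw [e0, e1, e2] at h2
    simp only [ContinuousLinearMap.comp_zero, zero_add, ContinuousLinearMap.flip_apply, ← hXa,
      coad_apply] at h2
    linarith
  -- the bracket of the lifted fields
  have brk : ∀ a b X Y, ∀ A B : V → V, coad G (c y₀) X = fderiv ℝ c y₀ a →
      coad G (c y₀) Y = fderiv ℝ c y₀ b → DifferentiableAt ℝ A y₀ → DifferentiableAt ℝ B y₀ →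
      A y₀ = a → B y₀ = b →
      (∀ᶠ y in 𝓝 y₀, fderiv ℝ c y (A y) = coad G (c y) X) →
      (∀ᶠ y in 𝓝 y₀, fderiv ℝ c y (B y) = coad G (c y) Y) →
      fderiv ℝ c y₀ (fderiv ℝ B y₀ a - fderiv ℝ A y₀ b) = coad G (c y₀) (bracket G X Y) := by
    intro a b X Y A B hXa hYb hA hB hAa hBb hA' hB'
    have half : ∀ (a : V) (B : V → V) (Y : E), DifferentiableAt ℝ B y₀ →
        (∀ᶠ y in 𝓝 y₀, fderiv ℝ c y (B y) = coad G (c y) Y) →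
        fderiv ℝ c y₀ (fderiv ℝ B y₀ a) = coad G (fderiv ℝ c y₀ a) Y -
          fderiv ℝ (fderiv ℝ c) y₀ a (B y₀) := by
      intro a B Y hB hB'
      have h1 : (fun y => fderiv ℝ c y (B y)) =ᶠ[𝓝 y₀] fun y => coad G (c y) Y := hB'
      have h2 := DFunLike.congr_fun (h1.fderiv_eq (𝕜 := ℝ)) a
      have h3 := DFunLike.congr_fun (hc2.clm_apply hB.hasFDerivAt).fderiv a
      have h4' : HasFDerivAt (fun ξ : E →L[ℝ] ℝ => coad G ξ Y)
          (fderiv ℝ (fun ξ : E →L[ℝ] ℝ => coad G ξ Y) (c y₀)) (c y₀) :=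
        (((contDiff_coad (G := G) Y).differentiable (by simp)) (c y₀)).hasFDerivAt
      have h4 := (h4'.comp y₀ hcd).fderiv
      have h5 := DFunLike.congr_fun h4 a
      rw [ContinuousLinearMap.comp_apply, fderiv_coad] at h5
      rw [h3] at h2
      refine eq_sub_of_add_eq ?_
      exact h2.trans h5
    rw [map_sub, half a B Y hB hB', half b A X hA hA', hAa, hBb, hsymm b a, ← hXa, ← hYb]
    ext W
    have := congrArg (c y₀) (bracket_jacobi G X Y W)
    simp only [map_add] at this
    simp only [sub_apply, coad_apply]
    linarith
  ext v
  rw [extDeriv_apply hΩd, Fin.sum_univ_three]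
  obtain ⟨X, hXa⟩ := hX (v 0)
  obtain ⟨Y, hYb⟩ := hX (v 1)
  obtain ⟨Z, hZd⟩ := hX (v 2)
  obtain ⟨A, hAs, hA⟩ := h.exists_field hy₀ X
  obtain ⟨B, hBs, hB⟩ := h.exists_field hy₀ Y
  obtain ⟨C, hCs, hC⟩ := h.exists_field hy₀ Z
  have hA0 : A y₀ = v 0 := h.injective y₀ hy₀ (hA.self_of_nhds.trans hXa)
  have hB0 : B y₀ = v 1 := h.injective y₀ hy₀ (hB.self_of_nhds.trans hYb)
  have hC0 : C y₀ = v 2 := h.injective y₀ hy₀ (hC.self_of_nhds.trans hZd)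
  have hAd := hAs.differentiableAt (by simp : (∞ : ℕ∞ω) ≠ 0)
  have hBd := hBs.differentiableAt (by simp : (∞ : ℕ∞ω) ≠ 0)
  have hCd := hCs.differentiableAt (by simp : (∞ : ℕ∞ω) ≠ 0)
  have r0 : (0 : Fin 3).removeNth v = ![v 1, v 2] := by
    funext i; fin_cases i <;> rfl
  have r1 : (1 : Fin 3).removeNth v = ![v 0, v 2] := by
    funext i; fin_cases i <;> rfl
  have r2 : (2 : Fin 3).removeNth v = ![v 0, v 1] := by
    funext i; fin_cases i <;> rfl
  rw [r0, r1, r2, key _ _ _ X Y Z hXa B C hBd hCd hB0 hC0 hB hC,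
    key _ _ _ Y X Z hYb A C hAd hCd hA0 hC0 hA hC,
    key _ _ _ Z X Y hZd A B hAd hBd hA0 hB0 hA hB]
  have b1 := hΩ y₀ hy₀ _ _ _ Z (brk _ _ X Y A B hXa hYb hAd hBd hA0 hB0 hA hB) hZd.symm
  have b2 := hΩ y₀ hy₀ _ _ Y _ hYb.symm (brk _ _ X Z A C hXa hZd hAd hCd hA0 hC0 hA hC)
  have b3 := hΩ y₀ hy₀ _ _ X _ hXa.symm (brk _ _ Y Z B C hYb hZd hBd hCd hB0 hC0 hB hC)
  rw [twoForm_sub_left] at b1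
  rw [twoForm_sub_right] at b2 b3
  have j1 := congrArg (c y₀) (bracket_jacobi G X Y Z)
  have j2 : bracket G Z (bracket G X Y) = -bracket G (bracket G X Y) Z := bracket_skew G _ _
  rw [map_add] at j1
  rw [j2, map_neg]
  rw [twoForm_swap (Ω y₀) (fderiv ℝ A y₀ (v 2)) (v 1)] at b2
  simp
  linarith
end IsCoadParam

end ImmersedForms

/-! ### Straight curves and the Lie–Poisson structure. -/

section VectorSpaces

variable {V : Type*} [NormedAddCommGroup V] [NormedSpace ℝ V]

theorem hasVelocity_line (x v : V) : HasVelocity 𝓘(ℝ, V) (fun τ : ℝ => x + τ • v) x v := by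
  refine ⟨?_, by simp, ?_⟩
  · exact (contDiff_const.add (contDiff_id.smul contDiff_const)).contMDiff.contMDiffAt
  · have h : HasDerivAt (fun τ : ℝ => x + τ • v) v 0 := by
      simpa using ((hasDerivAt_id (0 : ℝ)).smul_const v).const_add x
    have h' : tder 𝓘(ℝ, ℝ) 𝓘(ℝ, V) (fun τ : ℝ => x + τ • v) 0 1 = v := by
      rw [tder_eq_fderiv, h.hasFDerivAt.fderiv]
      simp
    exact h'

theorem graphTangent_add (x y u v : V) :
    GraphTangent 𝓘(ℝ, V) (· + ·) Set.univ x y u v (u + v) := by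
  refine ⟨_, _, hasVelocity_line x u, hasVelocity_line y v, Filter.Eventually.of_forall fun _ =>
    Set.mem_univ _, ?_⟩
  have e : (fun τ : ℝ => (x + τ • u) + (y + τ • v)) = fun τ => (x + y) + τ • (u + v) := by
    funext τ
    simp only [smul_add]
    abel
  exact (congrArg (fun γ => HasVelocity 𝓘(ℝ, V) γ (x + y) (u + v)) e).mpr (hasVelocity_line _ _)

end VectorSpaces

section LiePoisson

variable {E G : Type*} [NormedAddCommGroup E] [NormedSpace ℝ E] [FiniteDimensional ℝ E]
  [TopologicalSpace G] [ChartedSpace E G] [Group G] [LieGroup 𝓘(ℝ, E) ∞ G]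

/-- The differential of a function on `𝔤^*`, as an element of `𝔤`. -/
noncomputable def dualGradient (f : (E →L[ℝ] ℝ) → ℝ) (x : E →L[ℝ] ℝ) : E := predual E (fderiv ℝ f x)

theorem apply_dualGradient (f : (E →L[ℝ] ℝ) → ℝ) (x v : E →L[ℝ] ℝ) :
    v (dualGradient f x) = fderiv ℝ f x v := predual_spec _ _

theorem poissonBracket_liePoisson (f g : (E →L[ℝ] ℝ) → ℝ) (x : E →L[ℝ] ℝ) :
    poissonBracket (I := 𝓘(ℝ, E →L[ℝ] ℝ)) (liePoisson G) f g x =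
      x (bracket G (dualGradient f x) (dualGradient g x)) := by
  rw [← coad_apply, apply_dualGradient, ← mfderiv_eq_fderiv, dualGradient, ← mfderiv_eq_fderiv]
  rfl

variable (G) in
/-- The bracket as a continuous bilinear map. -/
noncomputable def bracketL : E →L[ℝ] E →L[ℝ] E :=
  LinearMap.toContinuousLinearMap
    ((LinearMap.toContinuousLinearMap : (E →ₗ[ℝ] E) ≃ₗ[ℝ] E →L[ℝ] E).toLinearMap ∘ₗ bracket G)

theorem bracketL_apply (X Y : E) : bracketL G X Y = bracket G X Y := rfl

theorem contDiff_dualGradient {f : (E →L[ℝ] ℝ) → ℝ} (hf : ContDiff ℝ ∞ f) :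
    ContDiff ℝ ∞ (dualGradient f) :=
  (LinearMap.toContinuousLinearMap (predual E).toLinearMap).contDiff.comp
    (hf.fderiv_right (by simp))

theorem fderiv_dualGradient {f : (E →L[ℝ] ℝ) → ℝ} (hf : ContDiff ℝ ∞ f) (x v w : E →L[ℝ] ℝ) :
    w (fderiv ℝ (dualGradient f) x v) = fderiv ℝ (fderiv ℝ f) x v w := by
  have h1 : DifferentiableAt ℝ (fderiv ℝ f) x :=
    ((hf.fderiv_right (m := ∞) (by simp)).differentiable (by simp)) x
  have h2 := ((contDiff_dualGradient hf).differentiable (by simp) x).hasFDerivAt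
  have h3 : (fun y => w (dualGradient f y)) = fun y => fderiv ℝ f y w :=
    funext fun y => apply_dualGradient f y w
  have h4 : HasFDerivAt (fun y => w (dualGradient f y)) (w.comp (fderiv ℝ (dualGradient f) x)) x :=
    w.hasFDerivAt.comp x h2
  have h5 := DFunLike.congr_fun (h4.unique (h3 ▸ h1.hasFDerivAt.clm_apply (hasFDerivAt_const w x))) v
  simpa using h5

variable (G) in
theorem contDiff_bracket_dualGradient {f g : (E →L[ℝ] ℝ) → ℝ} (hf : ContDiff ℝ ∞ f)
    (hg : ContDiff ℝ ∞ g) :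
    ContDiff ℝ ∞ fun x : E →L[ℝ] ℝ => x (bracket G (dualGradient f x) (dualGradient g x)) :=
  contDiff_id.clm_apply
    (((bracketL (E := E) G).contDiff.comp (contDiff_dualGradient hf)).clm_apply (contDiff_dualGradient hg))

/-- Product rule for `x [dg, dh]`: besides the Lie algebra term there are Hessian terms, which
cancel in the cyclic sum since Hessians are symmetric. -/
theorem poissonBracket_poissonBracket {f g h : (E →L[ℝ] ℝ) → ℝ}
    (hg : ContDiff ℝ ∞ g) (hh : ContDiff ℝ ∞ h) (x : E →L[ℝ] ℝ) :
    poissonBracket (I := 𝓘(ℝ, E →L[ℝ] ℝ)) (liePoisson G) f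
        (poissonBracket (I := 𝓘(ℝ, E →L[ℝ] ℝ)) (liePoisson G) g h) x =
      x (bracket G (dualGradient f x) (bracket G (dualGradient g x) (dualGradient h x)))
      - fderiv ℝ (fderiv ℝ g) x (coad G x (dualGradient f x)) (coad G x (dualGradient h x))
      + fderiv ℝ (fderiv ℝ h) x (coad G x (dualGradient f x)) (coad G x (dualGradient g x)) := by
  have e1 : poissonBracket (I := 𝓘(ℝ, E →L[ℝ] ℝ)) (liePoisson G) g h =
      fun x => x (bracketL G (dualGradient g x) (dualGradient h x)) :=
    funext fun x => poissonBracket_liePoisson g h x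
  have dg := ((contDiff_dualGradient hg).differentiable (by simp) x).hasFDerivAt
  have dh := ((contDiff_dualGradient hh).differentiable (by simp) x).hasFDerivAt
  have db : HasFDerivAt (fun x => bracketL G (dualGradient g x))
      ((bracketL G).comp (fderiv ℝ (dualGradient g) x)) x :=
    HasFDerivAt.comp x (g := bracketL G) (ContinuousLinearMap.hasFDerivAt _) dg
  have d := ((hasFDerivAt_id x).clm_apply (db.clm_apply dh)).fderiv
  rw [poissonBracket_liePoisson, ← coad_apply, apply_dualGradient, e1]
  refine (DFunLike.congr_fun d _).trans ?_
  have s := bracket_skew G (dualGradient h x)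
    (fderiv ℝ (dualGradient g) x (coad G x (dualGradient f x)))
  rw [← fderiv_dualGradient hg, ← fderiv_dualGradient hh]
  simp only [add_apply, ContinuousLinearMap.comp_apply,
    ContinuousLinearMap.flip_apply, ContinuousLinearMap.id_apply, bracketL_apply, id_eq, coad_apply,
    map_add, s, map_neg]
  ring

variable (G) in
theorem isPoisson_liePoisson : IsPoisson 𝓘(ℝ, E →L[ℝ] ℝ) (liePoisson (E := E) G) where
  skew x ξ η := by
    have h1 : ∀ (Φ Ψ : (E →L[ℝ] ℝ) →L[ℝ] ℝ),
        Ψ (coad G x (predual E Φ)) = x (bracket G (predual E Φ) (predual E Ψ)) := fun Φ Ψ => by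
      rw [← coad_apply, predual_spec]
    refine (h1 ξ η).trans ((congrArg x (bracket_skew G _ _)).trans ?_)
    rw [map_neg]
    exact congrArg Neg.neg (h1 η ξ).symm
  smooth f g hf hg := by
    have e1 : poissonBracket (I := 𝓘(ℝ, E →L[ℝ] ℝ)) (liePoisson G) f g = _ :=
      funext fun x => poissonBracket_liePoisson f g x
    rw [e1]
    exact (contDiff_bracket_dualGradient G hf.contDiff hg.contDiff).contMDiff
  jacobi f g h hf hg hh x := by
    have sy : ∀ {f : (E →L[ℝ] ℝ) → ℝ}, ContMDiff 𝓘(ℝ, E →L[ℝ] ℝ) 𝓘(ℝ, ℝ) ∞ f → ∀ u v,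
        fderiv ℝ (fderiv ℝ f) x u v = fderiv ℝ (fderiv ℝ f) x v u := fun hf u v =>
      hf.contDiff.contDiffAt.isSymmSndFDerivAt (by simpa using natCast_le_infty 2) u v
    rw [poissonBracket_poissonBracket hg.contDiff hh.contDiff,
      poissonBracket_poissonBracket hh.contDiff hf.contDiff,
      poissonBracket_poissonBracket hf.contDiff hg.contDiff,
      sy hf (coad G x (dualGradient h x)), sy hg (coad G x (dualGradient h x)),
      sy hh (coad G x (dualGradient g x))]
    have j1 := congrArg x (bracket_jacobi G (dualGradient f x) (dualGradient g x) (dualGradient h x))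
    have j2 := bracket_skew G (bracket G (dualGradient f x) (dualGradient g x)) (dualGradient h x)
    have j3 := bracket_skew G (dualGradient f x) (dualGradient h x)
    rw [map_add] at j1
    rw [j2, j3, map_neg, map_neg, map_neg]
    linarith

variable (G) in
-- Covectors annihilating the graph have the form `(-ζ, -ζ, ζ)`, and the Lie–Poisson bivector is
-- linear in the base point.
theorem isCoisotropicGraph_add_liePoisson :
    IsCoisotropicGraph 𝓘(ℝ, E →L[ℝ] ℝ) (liePoisson (E := E) G) (· + ·) Set.univ := by
  have key : ∀ (x y : E →L[ℝ] ℝ) (ξ η ζ : (E →L[ℝ] ℝ) →L[ℝ] ℝ),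
      (∀ u v, ξ u + η v + ζ (u + v) = 0) →
      coad G x (predual E ξ) + coad G y (predual E η) = -coad G (x + y) (predual E ζ) := by
    intro x y ξ η ζ H
    have hξ : ξ = -ζ := by
      ext u
      have := H u 0
      simp only [map_zero, add_zero] at this
      exact eq_neg_of_add_eq_zero_left this
    have hη : η = -ζ := by
      ext v
      have := H 0 v
      simp only [map_zero, zero_add] at this
      exact eq_neg_of_add_eq_zero_left this
    ext W
    have hn : predual E (-ζ) = -predual E ζ := (predual E).map_neg ζ
    simp only [hξ, hη, hn, map_neg, add_apply, neg_apply, coad_apply, LinearMap.neg_apply]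
    ring
  intro x y _ ξ η ζ H
  have h1 := graphTangent_add x y (coad G x (predual E ξ)) (coad G y (predual E η))
  rw [key x y ξ η ζ fun u v => H u v (u + v) (graphTangent_add x y u v)] at h1
  exact h1

end LiePoisson

theorem contMDiff_precomp {A B : Type*} [NormedAddCommGroup A] [NormedSpace ℝ A]
    [NormedAddCommGroup B] [NormedSpace ℝ B] (T : A →L[ℝ] B) :
    ContMDiff 𝓘(ℝ, B →L[ℝ] ℝ) 𝓘(ℝ, A →L[ℝ] ℝ) ∞ (fun ξ : B →L[ℝ] ℝ => ξ.comp T) :=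
  ((ContinuousLinearMap.compL ℝ A B ℝ).flip T).contMDiff

theorem tder_precomp {A B : Type*} [NormedAddCommGroup A] [NormedSpace ℝ A]
    [NormedAddCommGroup B] [NormedSpace ℝ B] (T : A →L[ℝ] B) (ξ u : B →L[ℝ] ℝ) :
    tder 𝓘(ℝ, B →L[ℝ] ℝ) 𝓘(ℝ, A →L[ℝ] ℝ) (fun ξ : B →L[ℝ] ℝ => ξ.comp T) ξ u = u.comp T := by
  rw [tder_eq_fderiv]
  exact DFunLike.congr_fun ((ContinuousLinearMap.compL ℝ A B ℝ).flip T).fderiv u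

/-! ### The dual groupoid as a Poisson 2-group. -/

namespace LieTwo.LieTwoGroup

variable {E₁ G₁ E₀ G₀ : Type*}
  [NormedAddCommGroup E₁] [NormedSpace ℝ E₁] [TopologicalSpace G₁] [ChartedSpace E₁ G₁]
  [Group G₁] [LieGroup 𝓘(ℝ, E₁) ∞ G₁]
  [NormedAddCommGroup E₀] [NormedSpace ℝ E₀] [TopologicalSpace G₀] [ChartedSpace E₀ G₀]
  [Group G₀] [LieGroup 𝓘(ℝ, E₀) ∞ G₀]
  (𝒢 : LieTwoGroup E₁ G₁ E₀ G₀)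

theorem dual_src_eq : 𝒢.dual.src = fun ξ : E₁ →L[ℝ] ℝ =>
    ξ.comp (𝒢.core.subtypeL - 𝒢.utgt.comp 𝒢.core.subtypeL) :=
  funext fun ξ => ContinuousLinearMap.ext fun h => 𝒢.dual_src_apply ξ h

theorem dual_unit_eq : 𝒢.dual.unit = fun α : 𝒢.core →L[ℝ] ℝ => α.comp 𝒢.proj :=
  funext fun α => ContinuousLinearMap.ext fun X => 𝒢.dual_unit_apply α X

theorem contMDiff_dual_src :
    ContMDiff 𝓘(ℝ, E₁ →L[ℝ] ℝ) 𝓘(ℝ, 𝒢.core →L[ℝ] ℝ) ∞ 𝒢.dual.src := by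
  rw [dual_src_eq]; exact contMDiff_precomp _

theorem contMDiff_dual_tgt :
    ContMDiff 𝓘(ℝ, E₁ →L[ℝ] ℝ) 𝓘(ℝ, 𝒢.core →L[ℝ] ℝ) ∞ 𝒢.dual.tgt :=
  contMDiff_precomp _

theorem contMDiff_dual_unit :
    ContMDiff 𝓘(ℝ, 𝒢.core →L[ℝ] ℝ) 𝓘(ℝ, E₁ →L[ℝ] ℝ) ∞ 𝒢.dual.unit := by
  rw [dual_unit_eq]; exact contMDiff_precomp _

theorem tder_dual_src (ξ u : E₁ →L[ℝ] ℝ) :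
    tder 𝓘(ℝ, E₁ →L[ℝ] ℝ) 𝓘(ℝ, 𝒢.core →L[ℝ] ℝ) 𝒢.dual.src ξ u = 𝒢.dual.src u := by
  rw [dual_src_eq, tder_precomp]

theorem tder_dual_tgt (ξ u : E₁ →L[ℝ] ℝ) :
    tder 𝓘(ℝ, E₁ →L[ℝ] ℝ) 𝓘(ℝ, 𝒢.core →L[ℝ] ℝ) 𝒢.dual.tgt ξ u = 𝒢.dual.tgt u :=
  tder_precomp _ _ _

theorem dual_src_smul (c : ℝ) (ξ : E₁ →L[ℝ] ℝ) :
    𝒢.dual.src (c • ξ) = c • 𝒢.dual.src ξ := by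
  rw [dual_src_eq]; exact ContinuousLinearMap.smul_comp _ _ _

theorem contMDiff_dual_mul :
    ContMDiff (𝓘(ℝ, E₁ →L[ℝ] ℝ).prod 𝓘(ℝ, E₁ →L[ℝ] ℝ)) 𝓘(ℝ, E₁ →L[ℝ] ℝ) ∞
      (fun p : (E₁ →L[ℝ] ℝ) × (E₁ →L[ℝ] ℝ) => 𝒢.dual.mul p.1 p.2) := by
  have e : (fun p : (E₁ →L[ℝ] ℝ) × (E₁ →L[ℝ] ℝ) => 𝒢.dual.mul p.1 p.2) =
      fun p => p.1 + p.2.comp 𝒢.usrc :=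
    funext fun p => 𝒢.dual_mul p.1 p.2
  rw [e]
  exact contMDiff_fst.add
    ((contMDiff_precomp 𝒢.usrc).comp contMDiff_snd)

theorem contMDiff_dual_inv :
    ContMDiff 𝓘(ℝ, E₁ →L[ℝ] ℝ) 𝓘(ℝ, E₁ →L[ℝ] ℝ) ∞ 𝒢.dual.inv := by
  have e : 𝒢.dual.inv =
      fun ξ : E₁ →L[ℝ] ℝ => ξ.comp (ContinuousLinearMap.id ℝ E₁ - 𝒢.utgt - 𝒢.usrc) :=
    funext fun ξ => ContinuousLinearMap.ext fun X => 𝒢.dual_inv_apply ξ X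
  rw [e]
  exact contMDiff_precomp _

theorem dual_isLieGroupoid :
    IsLieGroupoid 𝓘(ℝ, E₁ →L[ℝ] ℝ) 𝓘(ℝ, 𝒢.core →L[ℝ] ℝ) 𝒢.dual where
  isGroupoid := 𝒢.dual_isGroupoid
  manifold_arrows := inferInstance
  manifold_objects := inferInstance
  src_submersion := ⟨𝒢.contMDiff_dual_src, fun ξ α =>
    ⟨𝒢.dual.unit α, (𝒢.tder_dual_src ξ _).trans (𝒢.dual_isGroupoid.src_unit α)⟩⟩
  smooth_tgt := 𝒢.contMDiff_dual_tgt
  smooth_unit := 𝒢.contMDiff_dual_unit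
  smooth_mul := 𝒢.contMDiff_dual_mul.contMDiffOn
  smooth_inv := 𝒢.contMDiff_dual_inv
  hausdorff_base := inferInstance
  hausdorff_fibres := fun _ => inferInstance

/-- Composability is a linear condition and the product is linear, so straight lines stay in the
graph. -/
theorem dual_graphTangent {x y u v : E₁ →L[ℝ] ℝ} (hxy : 𝒢.dual.src x = 𝒢.dual.tgt y)
    (huv : 𝒢.dual.src u = 𝒢.dual.tgt v) :
    GraphTangent 𝓘(ℝ, E₁ →L[ℝ] ℝ) 𝒢.dual.mul 𝒢.dual.composable x y u v (𝒢.dual.mul u v) := by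
  refine ⟨_, _, hasVelocity_line x u, hasVelocity_line y v, Filter.Eventually.of_forall fun τ => ?_,
    ?_⟩
  · show 𝒢.dual.src (x + τ • u) = 𝒢.dual.tgt (y + τ • v)
    rw [dual_src_add, dual_src_smul, hxy, huv]
    rfl
  · have e : (fun τ : ℝ => 𝒢.dual.mul (x + τ • u) (y + τ • v)) =
        fun τ => 𝒢.dual.mul x y + τ • 𝒢.dual.mul u v := by
      funext τ
      ext X
      simp only [dual_mul, add_apply, smul_apply, ContinuousLinearMap.comp_apply, smul_eq_mul]
      ring
    exact (congrArg (fun γ => HasVelocity 𝓘(ℝ, E₁ →L[ℝ] ℝ) γ _ (𝒢.dual.mul u v)) e).mpr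
      (hasVelocity_line _ _)

theorem dual_isAddPoissonTwoGroup [FiniteDimensional ℝ E₁] :
    IsAddPoissonTwoGroup 𝓘(ℝ, E₁ →L[ℝ] ℝ) 𝓘(ℝ, 𝒢.core →L[ℝ] ℝ) 𝒢.dual (liePoisson G₁) where
  lieGroup_arrows := inferInstance
  lieGroup_objects := inferInstance
  preserves_add := 𝒢.dual_preservesOp_add
  poissonGroup := isCoisotropicGraph_add_liePoisson G₁
  poissonGroupoid :=
    { lie := 𝒢.dual_isLieGroupoid
      poisson := isPoisson_liePoisson G₁
      coisotropic := by
        intro x y hxy ξ η ζ H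
        have key : ∀ (ξ η ζ : (E₁ →L[ℝ] ℝ) →L[ℝ] ℝ),
            (∀ u v, 𝒢.dual.src u = 𝒢.dual.tgt v → ξ u + η v + ζ (𝒢.dual.mul u v) = 0) →
            𝒢.dual.src (coad G₁ x (predual E₁ ξ)) = 𝒢.dual.tgt (coad G₁ y (predual E₁ η)) ∧
              -coad G₁ (𝒢.dual.mul x y) (predual E₁ ζ) =
                𝒢.dual.mul (coad G₁ x (predual E₁ ξ)) (coad G₁ y (predual E₁ η)) := by
          intro ξ η ζ H
          -- It suffices to test the annihilation hypothesis on coadjoint vectors of composable `A`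
          -- and `B`. The sign of `ζ` comes from moving its term across, and it matches the reversed
          -- structure on the third factor.
          have h1 := 𝒢.coad_of_annihilates (x := x) (y := y) (X := predual E₁ ξ) (Y := predual E₁ η)
            (Z := -predual E₁ ζ) fun A B hAB => by
              have h2 := H _ _ (𝒢.coad_composable hxy hAB)
              rw [← 𝒢.coad_dual_mul hxy hAB, ← predual_spec ξ, ← predual_spec η,
                ← predual_spec ζ, coad_apply, coad_apply, coad_apply] at h2
              rw [map_neg, map_neg]
              linarith
          refine ⟨h1.1, h1.2 ▸ ?_⟩
          ext W
          simp
        obtain ⟨h1, h2⟩ := key ξ η ζ fun u v huv =>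
          H u v (𝒢.dual.mul u v) (𝒢.dual_graphTangent hxy huv)
        have h3 := 𝒢.dual_graphTangent hxy h1
        rw [← h2] at h3
        exact h3 }

/-! ### The double groupoid -/

/-- The action on `𝔥^*` is the coadjoint action of units on units, read off by the target map. -/
theorem contMDiff_coreCoAct [FiniteDimensional ℝ E₁] :
    ContMDiff (𝓘(ℝ, 𝒢.core →L[ℝ] ℝ).prod 𝓘(ℝ, E₀)) 𝓘(ℝ, 𝒢.core →L[ℝ] ℝ) ∞
      (fun p : (𝒢.core →L[ℝ] ℝ) × G₀ => 𝒢.coreCoAct p.1 p.2) := by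
  have e : (fun p : (𝒢.core →L[ℝ] ℝ) × G₀ => 𝒢.coreCoAct p.1 p.2) =
      fun p => 𝒢.dual.tgt (coAd (𝒢.dual.unit p.1) (𝒢.unit p.2)) := by
    funext p
    rw [dual_unit_coAd, 𝒢.dual_isGroupoid.tgt_unit]
  rw [e]
  exact 𝒢.contMDiff_dual_tgt.comp (contMDiff_coAd.comp
    ((𝒢.contMDiff_dual_unit.comp contMDiff_fst).prodMk (𝒢.contMDiff_unit.comp contMDiff_snd)))

end LieTwo.LieTwoGroup

/-! ### Action groupoids, product groupoids and the double groupoid. -/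

section ActionGroupoids

variable {E G F : Type*} [NormedAddCommGroup E] [NormedSpace ℝ E]
  [TopologicalSpace G] [ChartedSpace E G] [Group G] [LieGroup 𝓘(ℝ, E) ∞ G]
  [NormedAddCommGroup F] [NormedSpace ℝ F] {act : F → G → F}

theorem action_isGroupoid {X A : Type*} [Group A] {act : X → A → X} (h1 : ∀ x, act x 1 = x)
    (h2 : ∀ x g h, act x (g * h) = act (act x g) h) : (GroupoidData.action act).IsGroupoid where
  src_unit _ := rfl
  tgt_unit a := h1 a
  src_mul _ _ _ := rfl
  tgt_mul x y h := by
    have h : x.1 = act y.1 y.2 := h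
    show act y.1 (y.2 * x.2) = act x.1 x.2
    rw [h2, h]
  mul_assoc x y z _ _ := by
    show (z.1, z.2 * (y.2 * x.2)) = (z.1, z.2 * y.2 * x.2)
    rw [mul_assoc]
  unit_mul x := by
    show (x.1, x.2 * 1) = x
    rw [mul_one]
  mul_unit x := by
    show (x.1, 1 * x.2) = x
    rw [one_mul]
  src_inv _ := rfl
  tgt_inv x := by
    show act (act x.1 x.2) x.2⁻¹ = x.1
    rw [← h2, mul_inv_cancel, h1]
  inv_mul x := by
    show (x.1, x.2 * x.2⁻¹) = (x.1, 1)
    rw [mul_inv_cancel]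
  mul_inv x := by
    show (act x.1 x.2, x.2⁻¹ * x.2) = (act x.1 x.2, 1)
    rw [inv_mul_cancel]

theorem surjective_tder_fst {E E' H H' M M' : Type*} [NormedAddCommGroup E] [NormedSpace ℝ E]
    [NormedAddCommGroup E'] [NormedSpace ℝ E'] [TopologicalSpace H] [TopologicalSpace H']
    [TopologicalSpace M] [ChartedSpace H M] [TopologicalSpace M'] [ChartedSpace H' M']
    {I : ModelWithCorners ℝ E H} {I' : ModelWithCorners ℝ E' H'} (p : M × M') :
    Function.Surjective (mfderiv (I.prod I') I Prod.fst p) := by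
  rw [mfderiv_fst]
  exact fun u => ⟨(u, 0), rfl⟩

theorem IsSmoothRightAction.isSmoothGroupoid (h : IsSmoothRightAction (E := E) act) :
    IsSmoothGroupoid (𝓘(ℝ, F).prod 𝓘(ℝ, E)) 𝓘(ℝ, F) (GroupoidData.action act) := by
  have : IsManifold 𝓘(ℝ, E) ∞ G :=
    (‹LieGroup 𝓘(ℝ, E) ∞ G›).toContMDiffMul.toIsManifold
  exact
  { isGroupoid := action_isGroupoid h.one h.mul
    manifold_arrows := inferInstance
    manifold_objects := inferInstance
    src_submersion := ⟨contMDiff_fst, surjective_tder_fst⟩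
    smooth_tgt := h.smooth
    smooth_unit := contMDiff_id.prodMk contMDiff_const
    smooth_mul := ((contMDiff_fst.comp contMDiff_snd).prodMk
      ((contMDiff_snd.comp contMDiff_snd).mul (contMDiff_snd.comp contMDiff_fst))).contMDiffOn
    smooth_inv := h.smooth.prodMk contMDiff_snd.inv }

theorem isSmoothRightAction_coAd [FiniteDimensional ℝ E] :
    IsSmoothRightAction (E := E) (coAd (E := E) (G := G)) :=
  ⟨coAd_one, coAd_mul, contMDiff_coAd⟩

end ActionGroupoids

section ProductGroupoids

theorem prod_isGroupoid {M₁ M₀ N₁ N₀ : Type*} {𝒢 : GroupoidData M₁ M₀} {ℋ : GroupoidData N₁ N₀}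
    (hG : 𝒢.IsGroupoid) (hH : ℋ.IsGroupoid) : (𝒢.prod ℋ).IsGroupoid where
  src_unit _ := Prod.ext (hG.src_unit _) (hH.src_unit _)
  tgt_unit _ := Prod.ext (hG.tgt_unit _) (hH.tgt_unit _)
  src_mul _ _ h := Prod.ext (hG.src_mul _ _ (Prod.ext_iff.1 h).1) (hH.src_mul _ _ (Prod.ext_iff.1 h).2)
  tgt_mul _ _ h := Prod.ext (hG.tgt_mul _ _ (Prod.ext_iff.1 h).1) (hH.tgt_mul _ _ (Prod.ext_iff.1 h).2)
  mul_assoc _ _ _ h h' := Prod.ext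
    (hG.mul_assoc _ _ _ (Prod.ext_iff.1 h).1 (Prod.ext_iff.1 h').1)
    (hH.mul_assoc _ _ _ (Prod.ext_iff.1 h).2 (Prod.ext_iff.1 h').2)
  unit_mul _ := Prod.ext (hG.unit_mul _) (hH.unit_mul _)
  mul_unit _ := Prod.ext (hG.mul_unit _) (hH.mul_unit _)
  src_inv _ := Prod.ext (hG.src_inv _) (hH.src_inv _)
  tgt_inv _ := Prod.ext (hG.tgt_inv _) (hH.tgt_inv _)
  inv_mul _ := Prod.ext (hG.inv_mul _) (hH.inv_mul _)
  mul_inv _ := Prod.ext (hG.mul_inv _) (hH.mul_inv _)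

theorem prod_isSmoothGroupoid {E₁ H₁ M₁ E₀ H₀ M₀ E₃ H₃ M₃ E₂ H₂ M₂ : Type*}
    [NormedAddCommGroup E₁] [NormedSpace ℝ E₁] [TopologicalSpace H₁]
    [TopologicalSpace M₁] [ChartedSpace H₁ M₁]
    [NormedAddCommGroup E₀] [NormedSpace ℝ E₀] [TopologicalSpace H₀]
    [TopologicalSpace M₀] [ChartedSpace H₀ M₀]
    [NormedAddCommGroup E₂] [NormedSpace ℝ E₂] [TopologicalSpace H₂]
    [TopologicalSpace M₂] [ChartedSpace H₂ M₂]
    [NormedAddCommGroup E₃] [NormedSpace ℝ E₃] [TopologicalSpace H₃]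
    [TopologicalSpace M₃] [ChartedSpace H₃ M₃]
    {I₁ : ModelWithCorners ℝ E₁ H₁} {I₀ : ModelWithCorners ℝ E₀ H₀}
    {I₃ : ModelWithCorners ℝ E₃ H₃} {I₂ : ModelWithCorners ℝ E₂ H₂}
    {𝒢 : GroupoidData M₁ M₀} {ℋ : GroupoidData M₃ M₂}
    (hG : IsSmoothGroupoid I₁ I₀ 𝒢) (hH : IsSmoothGroupoid I₃ I₂ ℋ) :
    IsSmoothGroupoid (I₁.prod I₃) (I₀.prod I₂) (𝒢.prod ℋ) where
  isGroupoid := prod_isGroupoid hG.isGroupoid hH.isGroupoid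
  manifold_arrows := by
    have := hG.manifold_arrows
    have := hH.manifold_arrows
    infer_instance
  manifold_objects := by
    have := hG.manifold_objects
    have := hH.manifold_objects
    infer_instance
  src_submersion := by
    refine ⟨hG.src_submersion.1.prodMap hH.src_submersion.1, fun x => ?_⟩
    have e : mfderiv (I₁.prod I₃) (I₀.prod I₂) (𝒢.prod ℋ).src x = _ :=
      mfderiv_prodMap (hG.src_submersion.1.mdAt x.1) (hH.src_submersion.1.mdAt x.2)
    rw [e]
    rintro ⟨u, v⟩
    obtain ⟨u', hu⟩ := hG.src_submersion.2 x.1 u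
    obtain ⟨v', hv⟩ := hH.src_submersion.2 x.2 v
    exact ⟨(u', v'), Prod.ext hu hv⟩
  smooth_tgt := hG.smooth_tgt.prodMap hH.smooth_tgt
  smooth_unit := hG.smooth_unit.prodMap hH.smooth_unit
  smooth_mul := by
    refine ContMDiffOn.prodMk ?_ ?_
    · exact hG.smooth_mul.comp (f := fun p : (M₁ × M₃) × (M₁ × M₃) => (p.1.1, p.2.1))
        ((contMDiff_fst.comp contMDiff_fst).prodMk
          (contMDiff_fst.comp contMDiff_snd)).contMDiffOn fun p hp => (Prod.ext_iff.1 hp).1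
    · exact hH.smooth_mul.comp (f := fun p : (M₁ × M₃) × (M₁ × M₃) => (p.1.2, p.2.2))
        ((contMDiff_snd.comp contMDiff_fst).prodMk
          (contMDiff_snd.comp contMDiff_snd)).contMDiffOn fun p hp => (Prod.ext_iff.1 hp).2
  smooth_inv := hG.smooth_inv.prodMap hH.smooth_inv

end ProductGroupoids

namespace LieTwo.LieTwoGroup

variable {E₁ G₁ E₀ G₀ : Type*}
  [NormedAddCommGroup E₁] [NormedSpace ℝ E₁] [FiniteDimensional ℝ E₁]
  [TopologicalSpace G₁] [ChartedSpace E₁ G₁]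
  [Group G₁] [LieGroup 𝓘(ℝ, E₁) ∞ G₁]
  [NormedAddCommGroup E₀] [NormedSpace ℝ E₀] [TopologicalSpace G₀] [ChartedSpace E₀ G₀]
  [Group G₀] [LieGroup 𝓘(ℝ, E₀) ∞ G₀]
  (𝒢 : LieTwoGroup E₁ G₁ E₀ G₀)

theorem isSmoothRightAction_coreCoAct : IsSmoothRightAction (E := E₀) 𝒢.coreCoAct :=
  ⟨𝒢.coreCoAct_one, 𝒢.coreCoAct_mul, 𝒢.contMDiff_coreCoAct⟩

/-- The substance is `coAd_isMorphism`, the compatibility of the horizontal target. The other axioms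
restate that the structure maps of `𝒢` are group homomorphisms. -/
theorem coadjoint_isDoubleLieGroupoid :
    IsDoubleLieGroupoid (𝓘(ℝ, E₁ →L[ℝ] ℝ).prod 𝓘(ℝ, E₁)) 𝓘(ℝ, E₁ →L[ℝ] ℝ)
      (𝓘(ℝ, 𝒢.core →L[ℝ] ℝ).prod 𝓘(ℝ, E₀)) 𝓘(ℝ, 𝒢.core →L[ℝ] ℝ)
      (GroupoidData.action (coAd (G := G₁))) (𝒢.dual.prod 𝒢.toGroupoidData)
      𝒢.dual (GroupoidData.action 𝒢.coreCoAct) := by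
  have hM := 𝒢.coAd_isMorphism
  have hd := 𝒢.dual_isGroupoid
  have hg := 𝒢.lie.isGroupoid
  have hT : T2Space G₀ := 𝒢.lie.hausdorff_base
  refine
  { top_smooth := isSmoothRightAction_coAd.isSmoothGroupoid
    left_smooth := prod_isSmoothGroupoid 𝒢.dual_isLieGroupoid.toIsSmoothGroupoid
      𝒢.lie.toIsSmoothGroupoid
    right_lie := 𝒢.dual_isLieGroupoid
    bottom_lie :=
      { toIsSmoothGroupoid := 𝒢.isSmoothRightAction_coreCoAct.isSmoothGroupoid
        hausdorff_base := inferInstance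
        hausdorff_fibres := fun _ => inferInstance }
    src_morphism := ⟨fun _ => rfl, fun _ => rfl, fun _ => rfl, fun _ _ _ => rfl, fun _ => rfl⟩
    tgt_morphism := hM
    unit_morphism :=
      { src := fun x => Prod.ext rfl 𝒢.src_one
        tgt := fun x => Prod.ext rfl 𝒢.tgt_one
        unit := fun a => Prod.ext rfl 𝒢.unit_one.symm
        mul := fun x y _ => Prod.ext rfl (𝒢.mul_one_one_of_src 𝒢.src_one).symm
        inv := fun x => Prod.ext rfl (by
          show 1 = 𝒢.inv 1
          rw [unit_src_mul_inv_inv, src_one, tgt_one, unit_one]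
          simp) }
    inv_morphism :=
      { src := fun x => Prod.ext (hM.src x) (𝒢.src_inv_mul _)
        tgt := fun x => Prod.ext (hM.tgt x) (𝒢.tgt_inv _)
        unit := fun a => Prod.ext (hM.unit a) (𝒢.unit_inv _).symm
        mul := fun x y h => Prod.ext (hM.mul x y h) ?_
        inv := fun x => Prod.ext (hM.inv x) ?_ }
    mul_src := fun p q h => Prod.ext rfl (𝒢.src_mul _ _)
    mul_tgt := fun p q h => Prod.ext rfl (𝒢.tgt_mul _ _)
    mul_unit := fun a b h => Prod.ext rfl (𝒢.unit_mul _ _)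
    -- The action groupoid multiplies group components in reverse order, hence `q` before `p`.
    interchange := fun p q p' q' h h' hl hl' => Prod.ext rfl
      (𝒢.preserves_mul.mul q.2 q'.2 p.2 p'.2 (Prod.ext_iff.1 hl').2 (Prod.ext_iff.1 hl).2)
    double_source := ?_ }
  · have hxy : 𝒢.src x.2 = 𝒢.tgt y.2 := (Prod.ext_iff.1 h).2
    have hxy' : 𝒢.src x.2⁻¹ = 𝒢.tgt y.2⁻¹ := by rw [src_inv_mul, tgt_inv, hxy]
    have e := 𝒢.preserves_mul.mul _ _ _ _ hxy hxy'
    simp only [mul_inv_cancel] at e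
    rw [𝒢.mul_one_one_of_src 𝒢.src_one] at e
    exact inv_eq_of_mul_eq_one_right e.symm
  · have e := 𝒢.preserves_mul.inv x.2 x.2⁻¹
    have e1 : 𝒢.inv 1 = 1 := by
      rw [unit_src_mul_inv_inv, src_one, tgt_one, unit_one]
      simp
    rw [mul_inv_cancel, e1] at e
    exact inv_eq_of_mul_eq_one_right e.symm
  · intro q u v huv
    obtain ⟨w, hw⟩ := 𝒢.lie.src_submersion.2 q.2 v.2
    -- The first component is forced to be `u`, and `huv` makes it agree with `v`; only the group
    -- component has to be lifted, through the submersion `s`.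
    refine ⟨(u, w), ?_, ?_⟩
    · exact DFunLike.congr_fun mfderiv_fst _
    · have e := mfderiv_prodMap (p := q) (𝒢.contMDiff_dual_src.mdAt q.1) (𝒢.contMDiff_src.mdAt q.2)
      refine (DFunLike.congr_fun e (u, w)).trans (Prod.ext ?_ hw)
      have e1 : (mfderiv (𝓘(ℝ, 𝒢.core →L[ℝ] ℝ).prod 𝓘(ℝ, E₀)) 𝓘(ℝ, 𝒢.core →L[ℝ] ℝ)
        (GroupoidData.action 𝒢.coreCoAct).src ((𝒢.dual.prod 𝒢.toGroupoidData).src q) v) = v.1 :=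
        DFunLike.congr_fun mfderiv_fst v
      exact huv.trans e1

end LieTwo.LieTwoGroup

/-! ### Groupoid structures on orbits. -/

section OrbitGroupoid

variable {X Y A B : Type*} {act₁ : X → A → X} {act₀ : Y → B → Y} {x₀ : X} {y₀ : Y}

open Classical in
/-- The groupoid structure on orbits that form a subgroupoid. -/
noncomputable def orbitGroupoid {𝒢 : GroupoidData X Y}
    (h : 𝒢.IsSubgroupoid (Set.range (act₁ x₀)) (Set.range (act₀ y₀))) :
    GroupoidData (Orbit act₁ x₀) (Orbit act₀ y₀) where
  src x := ⟨𝒢.src x.val, h.src_mem _ x.mem⟩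
  tgt x := ⟨𝒢.tgt x.val, h.tgt_mem _ x.mem⟩
  unit a := ⟨𝒢.unit a.val, h.unit_mem _ a.mem⟩
  mul x y := if hm : 𝒢.mul x.val y.val ∈ Set.range (act₁ x₀) then ⟨_, hm⟩ else x
  inv x := ⟨𝒢.inv x.val, h.inv_mem _ x.mem⟩

variable {𝒢 : GroupoidData X Y} (h : 𝒢.IsSubgroupoid (Set.range (act₁ x₀)) (Set.range (act₀ y₀)))

theorem orbitGroupoid_composable_iff {x y : Orbit act₁ x₀} :
    (orbitGroupoid h).src x = (orbitGroupoid h).tgt y ↔ 𝒢.src x.val = 𝒢.tgt y.val :=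
  ⟨fun e => congrArg Orbit.val e, fun e => Orbit.ext_val e⟩

theorem orbitGroupoid_mul_val {x y : Orbit act₁ x₀}
    (hxy : (orbitGroupoid h).src x = (orbitGroupoid h).tgt y) :
    ((orbitGroupoid h).mul x y).val = 𝒢.mul x.val y.val := by
  have hm := h.mul_mem _ x.mem _ y.mem ((orbitGroupoid_composable_iff h).1 hxy)
  simp [orbitGroupoid, hm]

theorem orbitGroupoid_isMorphism : (orbitGroupoid h).IsMorphism 𝒢 Orbit.val Orbit.val :=
  ⟨fun _ => rfl, fun _ => rfl, fun _ => rfl, fun _ _ hxy => orbitGroupoid_mul_val h hxy,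
    fun _ => rfl⟩

theorem orbitGroupoid_isGroupoid (hG : 𝒢.IsGroupoid) : (orbitGroupoid h).IsGroupoid := by
  have hm := @orbitGroupoid_mul_val _ _ _ _ _ _ _ _ _ h
  have su : ∀ a, (orbitGroupoid h).src ((orbitGroupoid h).unit a) = a :=
    fun a => Orbit.ext_val (hG.src_unit a.val)
  have tu : ∀ a, (orbitGroupoid h).tgt ((orbitGroupoid h).unit a) = a :=
    fun a => Orbit.ext_val (hG.tgt_unit a.val)
  have si : ∀ x, (orbitGroupoid h).src ((orbitGroupoid h).inv x) = (orbitGroupoid h).tgt x :=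
    fun x => Orbit.ext_val (hG.src_inv x.val)
  have ti : ∀ x, (orbitGroupoid h).tgt ((orbitGroupoid h).inv x) = (orbitGroupoid h).src x :=
    fun x => Orbit.ext_val (hG.tgt_inv x.val)
  have sm : ∀ x y, (orbitGroupoid h).src x = (orbitGroupoid h).tgt y →
      (orbitGroupoid h).src ((orbitGroupoid h).mul x y) = (orbitGroupoid h).src y := fun x y e =>
    Orbit.ext_val ((congrArg 𝒢.src (hm e)).trans (hG.src_mul _ _ (congrArg Orbit.val e)))
  have tm : ∀ x y, (orbitGroupoid h).src x = (orbitGroupoid h).tgt y →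
      (orbitGroupoid h).tgt ((orbitGroupoid h).mul x y) = (orbitGroupoid h).tgt x := fun x y e =>
    Orbit.ext_val ((congrArg 𝒢.tgt (hm e)).trans (hG.tgt_mul _ _ (congrArg Orbit.val e)))
  exact
  { src_unit := su
    tgt_unit := tu
    src_mul := sm
    tgt_mul := tm
    mul_assoc := fun x y z e e' => Orbit.ext_val (by
      rw [hm ((sm x y e).trans e'), hm e, hm (e.trans (tm y z e').symm), hm e']
      exact hG.mul_assoc _ _ _ (congrArg Orbit.val e) (congrArg Orbit.val e'))
    unit_mul := fun x => Orbit.ext_val ((hm (su _)).trans (hG.unit_mul _))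
    mul_unit := fun x => Orbit.ext_val ((hm (tu _).symm).trans (hG.mul_unit _))
    src_inv := si
    tgt_inv := ti
    inv_mul := fun x => Orbit.ext_val ((hm (si x)).trans (hG.inv_mul _))
    mul_inv := fun x => Orbit.ext_val ((hm (ti x).symm).trans (hG.mul_inv _)) }

end OrbitGroupoid

section OrbitMaps

variable {E G F : Type*} [NormedAddCommGroup E] [NormedSpace ℝ E]
  [TopologicalSpace G] [ChartedSpace E G]
  {act : F → G → F} {x₀ : F} {d : ℕ}
  [TopologicalSpace (Orbit act x₀)] [ChartedSpace (EuclideanSpace ℝ (Fin d)) (Orbit act x₀)]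

theorem LieTwo.Orbit.exists_eq_orbitMap {X A : Type*} {act : X → A → X} {x₀ : X} (x : Orbit act x₀) :
    ∃ g, orbitMap act x₀ g = x := by
  obtain ⟨g, hg⟩ := x.mem
  exact ⟨g, Orbit.ext_val hg⟩

/-- The quotient property of the orbit map: smoothness on the orbit is tested on the group. -/
theorem HasLocalSections.contMDiff [NormedAddCommGroup F] [NormedSpace ℝ F]
    (hs : HasLocalSections (E := E) act x₀ d)
    {E' H' M' : Type*} [NormedAddCommGroup E'] [NormedSpace ℝ E'] [TopologicalSpace H']
    [TopologicalSpace M'] [ChartedSpace H' M'] {I' : ModelWithCorners ℝ E' H'}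
    {f : Orbit act x₀ → M'} (hf : ContMDiff 𝓘(ℝ, E) I' ∞ fun g => f (orbitMap act x₀ g)) :
    ContMDiff (𝓡 d) I' ∞ f := by
  intro x
  obtain ⟨g, rfl⟩ := x.exists_eq_orbitMap
  obtain ⟨s, h1, -, h3⟩ := hs g
  refine ((hf _).comp _ h1).congr_of_eventuallyEq ?_
  filter_upwards [h3] with y hy
  rw [Function.comp_apply, hy]

end OrbitMaps

/-! ### The Lie groupoid on the coadjoint orbit of a unit. -/

namespace LieTwo.LieTwoGroup

variable {E₁ G₁ E₀ G₀ : Type*}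
  [NormedAddCommGroup E₁] [NormedSpace ℝ E₁] [TopologicalSpace G₁] [ChartedSpace E₁ G₁]
  [Group G₁] [LieGroup 𝓘(ℝ, E₁) ∞ G₁]
  [NormedAddCommGroup E₀] [NormedSpace ℝ E₀] [TopologicalSpace G₀] [ChartedSpace E₀ G₀]
  [Group G₀] [LieGroup 𝓘(ℝ, E₀) ∞ G₀]
  (𝒢 : LieTwoGroup E₁ G₁ E₀ G₀) (α : 𝒢.core →L[ℝ] ℝ)

theorem dual_mul_unit_self : 𝒢.dual.mul (𝒢.dual.unit α) (𝒢.dual.unit α) = 𝒢.dual.unit α := by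
  have := 𝒢.dual_isGroupoid.unit_mul (𝒢.dual.unit α)
  rwa [𝒢.dual_isGroupoid.tgt_unit] at this

theorem dual_inv_unit : 𝒢.dual.inv (𝒢.dual.unit α) = 𝒢.dual.unit α := by
  have h := 𝒢.dual_isGroupoid
  have h1 := h.mul_unit (𝒢.dual.inv (𝒢.dual.unit α))
  rw [h.src_inv, h.tgt_unit] at h1
  rw [← h1, h.inv_mul, h.src_unit]

variable {α}

theorem src_coAd_unit (g : G₁) :
    𝒢.dual.src (coAd (𝒢.dual.unit α) g) = 𝒢.coreCoAct α (𝒢.src g) := by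
  rw [dual_src_coAd, 𝒢.dual_isGroupoid.src_unit]

theorem tgt_coAd_unit (g : G₁) :
    𝒢.dual.tgt (coAd (𝒢.dual.unit α) g) = 𝒢.coreCoAct α (𝒢.tgt g) := by
  rw [dual_tgt_coAd, 𝒢.dual_isGroupoid.tgt_unit]

theorem inv_coAd_unit (g : G₁) :
    𝒢.dual.inv (coAd (𝒢.dual.unit α) g) = coAd (𝒢.dual.unit α) (𝒢.inv g) := by
  rw [← dual_inv_coAd, dual_inv_unit]

/-- Composable points of the orbit are represented by composable group elements. -/
theorem exists_composable {g h : G₁}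
    (hgh : 𝒢.coreCoAct α (𝒢.src g) = 𝒢.coreCoAct α (𝒢.tgt h)) :
    ∃ k : G₀, 𝒢.src g = 𝒢.tgt (𝒢.unit k * h) ∧
      coAd (𝒢.dual.unit α) (𝒢.unit k * h) = coAd (𝒢.dual.unit α) h := by
  -- This `k` fixes `α` by `hgh`, so its unit fixes `1_α`.
  refine ⟨𝒢.src g * (𝒢.tgt h)⁻¹, by rw [tgt_mul, tgt_unit]; group, ?_⟩
  rw [coAd_mul, dual_unit_coAd, coreCoAct_mul, hgh, ← coreCoAct_mul, mul_inv_cancel, coreCoAct_one]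

/-- After replacing `h` by `u(k) h` the pair is composable in `G₁`, and `k` cancels from the
product. The formula therefore holds for arbitrary representatives, composable or not. -/
theorem mul_coAd_unit {g h : G₁}
    (hgh : 𝒢.coreCoAct α (𝒢.src g) = 𝒢.coreCoAct α (𝒢.tgt h)) :
    𝒢.dual.mul (coAd (𝒢.dual.unit α) g) (coAd (𝒢.dual.unit α) h) =
      coAd (𝒢.dual.unit α) (g * (𝒢.unit (𝒢.tgt h))⁻¹ * h) := by
  obtain ⟨k, hk, hk'⟩ := 𝒢.exists_composable hgh
  have hu : 𝒢.dual.src (𝒢.dual.unit α) = 𝒢.dual.tgt (𝒢.dual.unit α) := by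
    rw [𝒢.dual_isGroupoid.src_unit, 𝒢.dual_isGroupoid.tgt_unit]
  rw [← hk', ← 𝒢.dual_mul_coAd hu hk, dual_mul_unit_self, 𝒢.mul_eq hk, tgt_mul, tgt_unit, unit_mul]
  congr 1
  group

variable (α) in
theorem orbit_isSubgroupoid :
    𝒢.dual.IsSubgroupoid (Set.range (coAd (G := G₁) (𝒢.dual.unit α)))
      (Set.range (𝒢.coreCoAct α)) where
  src_mem := by
    rintro _ ⟨g, rfl⟩
    exact ⟨_, (𝒢.src_coAd_unit g).symm⟩
  tgt_mem := by
    rintro _ ⟨g, rfl⟩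
    exact ⟨_, (𝒢.tgt_coAd_unit g).symm⟩
  unit_mem := by
    rintro _ ⟨g, rfl⟩
    exact ⟨_, 𝒢.dual_unit_coAd α g⟩
  mul_mem := by
    rintro _ ⟨g, rfl⟩ _ ⟨h, rfl⟩ hgh
    rw [src_coAd_unit, tgt_coAd_unit] at hgh
    exact ⟨_, (𝒢.mul_coAd_unit hgh).symm⟩
  inv_mem := by
    rintro _ ⟨g, rfl⟩
    exact ⟨_, (𝒢.inv_coAd_unit g).symm⟩

variable (α) in
/-- The groupoid structure on the coadjoint orbit of a unit. -/
noncomputable abbrev coadOrbitGroupoid :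
    GroupoidData (Orbit (coAd (G := G₁)) (𝒢.dual.unit α)) (Orbit 𝒢.coreCoAct α) :=
  orbitGroupoid (𝒢.orbit_isSubgroupoid α)

theorem coadOrbitGroupoid_src (g : G₁) :
    (𝒢.coadOrbitGroupoid α).src (orbitMap coAd (𝒢.dual.unit α) g) =
      orbitMap 𝒢.coreCoAct α (𝒢.src g) := Orbit.ext_val (𝒢.src_coAd_unit g)

theorem coadOrbitGroupoid_tgt (g : G₁) :
    (𝒢.coadOrbitGroupoid α).tgt (orbitMap coAd (𝒢.dual.unit α) g) =
      orbitMap 𝒢.coreCoAct α (𝒢.tgt g) := Orbit.ext_val (𝒢.tgt_coAd_unit g)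

theorem coadOrbitGroupoid_inv (g : G₁) :
    (𝒢.coadOrbitGroupoid α).inv (orbitMap coAd (𝒢.dual.unit α) g) =
      orbitMap coAd (𝒢.dual.unit α) (𝒢.inv g) := Orbit.ext_val (𝒢.inv_coAd_unit g)

theorem coadOrbitGroupoid_unit (g : G₀) :
    (𝒢.coadOrbitGroupoid α).unit (orbitMap 𝒢.coreCoAct α g) =
      orbitMap coAd (𝒢.dual.unit α) (𝒢.unit g) := Orbit.ext_val (𝒢.dual_unit_coAd α g).symm

theorem coadOrbitGroupoid_mul {g h : G₁}
    (hgh : (𝒢.coadOrbitGroupoid α).src (orbitMap coAd (𝒢.dual.unit α) g) =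
      (𝒢.coadOrbitGroupoid α).tgt (orbitMap coAd (𝒢.dual.unit α) h)) :
    (𝒢.coadOrbitGroupoid α).mul (orbitMap coAd (𝒢.dual.unit α) g)
        (orbitMap coAd (𝒢.dual.unit α) h) =
      orbitMap coAd (𝒢.dual.unit α) (g * (𝒢.unit (𝒢.tgt h))⁻¹ * h) := by
  refine Orbit.ext_val ((orbitGroupoid_mul_val _ hgh).trans (𝒢.mul_coAd_unit ?_))
  rw [coadOrbitGroupoid_src, coadOrbitGroupoid_tgt] at hgh
  exact congrArg Orbit.val hgh

section Smooth

variable {d₁ d₀ : ℕ}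
  [TopologicalSpace (Orbit (coAd (G := G₁)) (𝒢.dual.unit α))]
  [ChartedSpace (EuclideanSpace ℝ (Fin d₁)) (Orbit (coAd (G := G₁)) (𝒢.dual.unit α))]
  [TopologicalSpace (Orbit 𝒢.coreCoAct α)]
  [ChartedSpace (EuclideanSpace ℝ (Fin d₀)) (Orbit 𝒢.coreCoAct α)]

/-- Each structure map is covered by a smooth map of the groups. For the product, any two local
sections will do, because `coadOrbitGroupoid_mul` does not ask for composable representatives. -/
theorem coadOrbitGroupoid_isLieGroupoid
    (h₁ : IsOrbitManifold (E := E₁) (coAd (G := G₁)) (𝒢.dual.unit α) d₁)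
    (h₀ : IsOrbitManifold (E := E₀) 𝒢.coreCoAct α d₀)
    (s₁ : HasLocalSections (E := E₁) (coAd (G := G₁)) (𝒢.dual.unit α) d₁)
    (s₀ : HasLocalSections (E := E₀) 𝒢.coreCoAct α d₀) :
    IsLieGroupoid (𝓡 d₁) (𝓡 d₀) (𝒢.coadOrbitGroupoid α) := by
  have o₁ := h₁.orbitMap_submersion.1
  have o₀ := h₀.orbitMap_submersion.1
  have hsrc : ContMDiff (𝓡 d₁) (𝓡 d₀) ∞ (𝒢.coadOrbitGroupoid α).src := s₁.contMDiff (by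
    simp_rw [coadOrbitGroupoid_src]
    exact o₀.comp 𝒢.contMDiff_src)
  have hinv : ContMDiff 𝓘(ℝ, E₁) 𝓘(ℝ, E₁) ∞ 𝒢.inv := 𝒢.lie.smooth_inv
  exact
  { isGroupoid := orbitGroupoid_isGroupoid _ 𝒢.dual_isGroupoid
    manifold_arrows := h₁.manifold
    manifold_objects := h₀.manifold
    src_submersion := by
      refine ⟨hsrc, fun x => ?_⟩
      obtain ⟨g, rfl⟩ := x.exists_eq_orbitMap
      have e1 := tder_comp (x := g) rfl (hsrc.mdAt _) (o₁.mdAt g)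
      have e2 := tder_comp (x := g) rfl (o₀.mdAt _) (𝒢.contMDiff_src.mdAt g)
      simp_rw [coadOrbitGroupoid_src] at e1
      intro w
      obtain ⟨v, hv⟩ := h₀.orbitMap_submersion.2 (𝒢.src g) w
      obtain ⟨u, hu⟩ := 𝒢.lie.src_submersion.2 g v
      refine ⟨tder 𝓘(ℝ, E₁) (𝓡 d₁) (orbitMap coAd (𝒢.dual.unit α)) g u, ?_⟩
      refine (DFunLike.congr_fun (e1.symm.trans e2) u).trans ?_
      subst hu
      exact hv
    smooth_tgt := s₁.contMDiff (by
      simp_rw [coadOrbitGroupoid_tgt]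
      exact o₀.comp 𝒢.contMDiff_tgt)
    smooth_unit := s₀.contMDiff (by
      simp_rw [coadOrbitGroupoid_unit]
      exact o₁.comp 𝒢.contMDiff_unit)
    smooth_mul := by
      rintro ⟨x, y⟩ hxy
      obtain ⟨g, rfl⟩ := x.exists_eq_orbitMap
      obtain ⟨h, rfl⟩ := y.exists_eq_orbitMap
      obtain ⟨s, hs, -, hs'⟩ := s₁ g
      obtain ⟨t, ht, -, ht'⟩ := s₁ h
      have hs2 : ContMDiffAt ((𝓡 d₁).prod (𝓡 d₁)) 𝓘(ℝ, E₁) ∞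
          (fun p : Orbit (coAd (G := G₁)) (𝒢.dual.unit α) ×
            Orbit (coAd (G := G₁)) (𝒢.dual.unit α) => s p.1)
          (orbitMap coAd (𝒢.dual.unit α) g, orbitMap coAd (𝒢.dual.unit α) h) :=
        ContMDiffAt.comp _ hs contMDiffAt_fst
      have ht2 : ContMDiffAt ((𝓡 d₁).prod (𝓡 d₁)) 𝓘(ℝ, E₁) ∞
          (fun p : Orbit (coAd (G := G₁)) (𝒢.dual.unit α) ×
            Orbit (coAd (G := G₁)) (𝒢.dual.unit α) => t p.2)
          (orbitMap coAd (𝒢.dual.unit α) g, orbitMap coAd (𝒢.dual.unit α) h) :=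
        ContMDiffAt.comp _ ht contMDiffAt_snd
      have hm := (o₁ _).comp _ ((hs2.mul ((𝒢.contMDiff_unit.comp 𝒢.contMDiff_tgt).contMDiffAt.comp _
        ht2).inv).mul ht2)
      have hev : ∀ᶠ p : Orbit (coAd (G := G₁)) (𝒢.dual.unit α) ×
            Orbit (coAd (G := G₁)) (𝒢.dual.unit α) in
          𝓝 (orbitMap coAd (𝒢.dual.unit α) g, orbitMap coAd (𝒢.dual.unit α) h),
          orbitMap coAd (𝒢.dual.unit α) (s p.1) = p.1 ∧
          orbitMap coAd (𝒢.dual.unit α) (t p.2) = p.2 :=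
        (hs'.prod_inl_nhds _).and (ht'.prod_inr_nhds _)
      have heq : ∀ p : Orbit (coAd (G := G₁)) (𝒢.dual.unit α) ×
            Orbit (coAd (G := G₁)) (𝒢.dual.unit α), p ∈ (𝒢.coadOrbitGroupoid α).composable →
          orbitMap coAd (𝒢.dual.unit α) (s p.1) = p.1 ∧
          orbitMap coAd (𝒢.dual.unit α) (t p.2) = p.2 →
          (𝒢.coadOrbitGroupoid α).mul p.1 p.2 = orbitMap coAd (𝒢.dual.unit α)
            (s p.1 * (𝒢.unit (𝒢.tgt (t p.2)))⁻¹ * t p.2) := fun p hp hp' => by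
        have hp : (𝒢.coadOrbitGroupoid α).src p.1 = (𝒢.coadOrbitGroupoid α).tgt p.2 := hp
        rw [← hp'.1, ← hp'.2] at hp
        rw [← 𝒢.coadOrbitGroupoid_mul hp, hp'.1, hp'.2]
      refine hm.contMDiffWithinAt.congr_of_eventuallyEq ?_ (heq _ hxy hev.self_of_nhds)
      filter_upwards [self_mem_nhdsWithin, mem_nhdsWithin_of_mem_nhds hev] with p hp hp'
      exact heq p hp hp'
    smooth_inv := s₁.contMDiff (by
      simp_rw [coadOrbitGroupoid_inv]
      exact o₁.comp hinv)
    hausdorff_base := h₀.hausdorff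
    hausdorff_fibres := fun _ => by
      have := h₁.hausdorff
      infer_instance }

end Smooth

end LieTwo.LieTwoGroup

/-- Used to choose generators of coadjoint tangent vectors linearly, although `X ↦ ξ ∘ ad_X` may
have a kernel. -/
theorem LinearMap.exists_pseudoInverse {V W : Type*} [AddCommGroup V] [Module ℝ V]
    [AddCommGroup W] [Module ℝ W] (f : V →ₗ[ℝ] W) : ∃ g : W →ₗ[ℝ] V, ∀ x, f (g (f x)) = f x := by
  obtain ⟨r, hr⟩ := f.rangeRestrict.exists_rightInverse_of_surjective f.range_rangeRestrict
  obtain ⟨g, hg⟩ := r.exists_extend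
  refine ⟨g, fun x => ?_⟩
  have h1 : g (f x) = r (f.rangeRestrict x) := DFunLike.congr_fun hg (f.rangeRestrict x)
  rw [h1]
  exact congrArg Subtype.val (DFunLike.congr_fun hr (f.rangeRestrict x))

/-! ### The symplectic structure of a coadjoint orbit. -/

section Charts

variable {V H M : Type*} [NormedAddCommGroup V] [NormedSpace ℝ V]
  [TopologicalSpace M] [ChartedSpace V M] [IsManifold 𝓘(ℝ, V) ∞ M]

theorem contMDiffAt_extChartAt_symm (x₀ : M) {y : V} (hy : y ∈ (extChartAt 𝓘(ℝ, V) x₀).target) :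
    ContMDiffAt 𝓘(ℝ, V) 𝓘(ℝ, V) ∞ (extChartAt 𝓘(ℝ, V) x₀).symm y :=
  (contMDiffOn_extChartAt_symm x₀).contMDiffAt ((isOpen_extChartAt_target x₀).mem_nhds hy)

theorem tder_extChartAt_symm_bijective (x₀ : M) {y : V}
    (hy : y ∈ (extChartAt 𝓘(ℝ, V) x₀).target) :
    Function.Bijective (tder 𝓘(ℝ, V) 𝓘(ℝ, V) (extChartAt 𝓘(ℝ, V) x₀).symm y) := by
  set e := extChartAt 𝓘(ℝ, V) x₀
  have hs : MDifferentiableAt 𝓘(ℝ, V) 𝓘(ℝ, V) e.symm y :=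
    (contMDiffAt_extChartAt_symm x₀ hy).mdifferentiableAt (by simp)
  have hx : e.symm y ∈ (chartAt V x₀).source := by
    rw [← extChartAt_source 𝓘(ℝ, V)]
    exact e.map_target hy
  have he : MDifferentiableAt 𝓘(ℝ, V) 𝓘(ℝ, V) e (e.symm y) :=
    (contMDiffAt_extChartAt' (n := ∞) hx).mdifferentiableAt (by simp)
  have h1 := tder_comp (I'' := 𝓘(ℝ, V)) rfl he hs
  have h2 := tder_comp (I'' := 𝓘(ℝ, V)) (e.right_inv hy) hs he
  have h1' : (fun z => e (e.symm z)) =ᶠ[𝓝 y] fun z => z := by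
    filter_upwards [(isOpen_extChartAt_target (I := 𝓘(ℝ, V)) x₀).mem_nhds hy] with z hz
    exact e.right_inv hz
  have h2' : (fun z => e.symm (e z)) =ᶠ[𝓝 (e.symm y)] fun z => z := by
    filter_upwards [(isOpen_extChartAt_source (I := 𝓘(ℝ, V)) x₀).mem_nhds (e.map_target hy)]
      with z hz
    exact e.left_inv hz
  rw [tder_congr h1', tder_id] at h1
  rw [tder_congr h2', tder_id] at h2
  exact ⟨Function.LeftInverse.injective fun v => (DFunLike.congr_fun h1 v).symm,
    Function.RightInverse.surjective fun v => (DFunLike.congr_fun h2 v).symm⟩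

end Charts

section CoadjointOrbits

variable {E G : Type*} [NormedAddCommGroup E] [NormedSpace ℝ E] [FiniteDimensional ℝ E]
  [TopologicalSpace G] [ChartedSpace E G] [Group G] [LieGroup 𝓘(ℝ, E) ∞ G]

variable (G) in
/-- The alternating form `(X, Y) ↦ x [X, Y]` on the Lie algebra. -/
noncomputable def bracketForm (x : E →L[ℝ] ℝ) : E [⋀^Fin 2]→L[ℝ] ℝ where
  toFun v := x (bracket G (v 0) (v 1))
  map_update_add' v i X Y := by
    fin_cases i <;> simp
  map_update_smul' v i c X := by
    fin_cases i <;> simp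
  cont := x.continuous.comp
    (((bracketL (E := E) G).continuous.comp (continuous_apply 0)).clm_apply (continuous_apply 1))
  map_eq_zero_of_eq' v i j hij h := by
    have h01 : v 0 = v 1 := by
      fin_cases i <;> fin_cases j <;> first | exact absurd rfl h | exact hij | exact hij.symm
    simp only [h01, bracket_self, map_zero]

variable {ξ₀ : E →L[ℝ] ℝ} {d : ℕ}
  [TopologicalSpace (Orbit (coAd (G := G)) ξ₀)]
  [ChartedSpace (EuclideanSpace ℝ (Fin d)) (Orbit (coAd (G := G)) ξ₀)]

/-- The derivative of the inclusion of the orbit of `ξ₀`. -/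
noncomputable def dval (x : Orbit (coAd (G := G)) ξ₀) : EuclideanSpace ℝ (Fin d) →L[ℝ] E →L[ℝ] ℝ :=
  tder (𝓡 d) 𝓘(ℝ, E →L[ℝ] ℝ) Orbit.val x

variable (h : IsOrbitManifold (E := E) (coAd (G := G)) ξ₀ d)
include h

omit [FiniteDimensional ℝ E] [LieGroup 𝓘(ℝ, E) ∞ G] in
theorem dval_injective (x : Orbit (coAd (G := G)) ξ₀) : Function.Injective (dval (d := d) x) :=
  h.val_immersion.2 x

omit [FiniteDimensional ℝ E] [LieGroup 𝓘(ℝ, E) ∞ G] in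
theorem dval_orbitMap (g : G) : (dval (orbitMap coAd ξ₀ g)).comp
    (tder 𝓘(ℝ, E) (𝓡 d) (orbitMap coAd ξ₀) g) =
      tder 𝓘(ℝ, E) 𝓘(ℝ, E →L[ℝ] ℝ) (fun g : G => coAd ξ₀ g) g :=
  (tder_comp rfl (h.val_immersion.1.mdAt _) (h.orbitMap_submersion.1.mdAt g)).symm

theorem range_dval (x : Orbit (coAd (G := G)) ξ₀) :
    Set.range (dval (d := d) x) = Set.range (coad G x.val) := by
  obtain ⟨g, rfl⟩ := x.exists_eq_orbitMap
  refine Eq.trans ?_ (range_tder_coAd ξ₀ g)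
  rw [← dval_orbitMap h g]
  have hs : Function.Surjective (tder 𝓘(ℝ, E) (𝓡 d) (orbitMap coAd ξ₀) g) :=
    h.orbitMap_submersion.2 g
  exact (hs.range_comp _).symm

theorem exists_dval_eq (x : Orbit (coAd (G := G)) ξ₀) (X : E) :
    ∃ u, dval (d := d) x u = coad G x.val X := by
  have : coad G x.val X ∈ Set.range (dval (d := d) x) := by
    rw [range_dval h]; exact ⟨X, rfl⟩
  exact this

theorem exists_eq_coad (x : Orbit (coAd (G := G)) ξ₀) (u : EuclideanSpace ℝ (Fin d)) :
    ∃ X, dval x u = coad G x.val X := by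
  have : dval x u ∈ Set.range (coad G x.val) := by
    rw [← range_dval h]; exact ⟨u, rfl⟩
  exact this.imp fun _ => Eq.symm

omit h in
variable (G) in
/-- `coad G x` as a linear map. -/
noncomputable def coadLM (x : E →L[ℝ] ℝ) : E →ₗ[ℝ] E →L[ℝ] ℝ where
  toFun := coad G x
  map_add' X Y := by ext; simp
  map_smul' c X := by ext; simp

omit h in
variable (G) in
/-- The contraction with the Lie–Poisson bivector at `x`, conjugated by a linear map `L`. -/
noncomputable def sharpLM {V : Type*} [NormedAddCommGroup V] [NormedSpace ℝ V]
    (L : (E →L[ℝ] ℝ) →L[ℝ] V) (x : E →L[ℝ] ℝ) : (V →L[ℝ] ℝ) →ₗ[ℝ] V :=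
  L.toLinearMap ∘ₗ coadLM G x ∘ₗ (predual E).toLinearMap ∘ₗ
    ((ContinuousLinearMap.compL ℝ (E →L[ℝ] ℝ) V ℝ).flip L).toLinearMap

variable (ξ₀ d) in
/-- The properties that characterize the Kostant–Kirillov–Souriau form and the corresponding
Poisson structure, in terms of the model space. -/
structure IsKKS (Ω : Orbit (coAd (G := G)) ξ₀ → EuclideanSpace ℝ (Fin d) [⋀^Fin 2]→L[ℝ] ℝ)
    (P : Orbit (coAd (G := G)) ξ₀ → (EuclideanSpace ℝ (Fin d) →L[ℝ] ℝ) →ₗ[ℝ]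
      EuclideanSpace ℝ (Fin d)) : Prop where
  form : ∀ x X Y u v, dval x u = coad G x.val X → dval x v = coad G x.val Y →
    Ω x ![u, v] = x.val (bracket G X Y)
  sharp : ∀ x ξ, ∃ X, dval x (P x ξ) = coad G x.val X ∧ ∀ u, ξ u = dval x u X

/-- The form is `x [·, ·]` pulled back along a linear choice of generators, and its value is
independent of that choice. The choices are made pointwise without continuity; smoothness follows
later from the formula. -/
theorem exists_isKKS : ∃ Ω P, IsKKS (G := G) ξ₀ d Ω P := by
  choose L hL using fun x : Orbit (coAd (G := G)) ξ₀ =>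
    (dval (d := d) x : EuclideanSpace ℝ (Fin d) →ₗ[ℝ] E →L[ℝ] ℝ).exists_leftInverse_of_injective
      (LinearMap.ker_eq_bot.2 (dval_injective h x))
  have hL' : ∀ x u, L x (dval x u) = u := fun x u => DFunLike.congr_fun (hL x) u
  choose M hM using fun x : Orbit (coAd (G := G)) ξ₀ => (coadLM G x.val).exists_pseudoInverse
  have hM' : ∀ (x : Orbit (coAd (G := G)) ξ₀) X Y, x.val (bracket G (M x (coad G x.val X)) Y) = x.val (bracket G X Y) :=
    fun x X Y => DFunLike.congr_fun (hM x X) Y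
  refine ⟨fun x => (bracketForm G x.val).compContinuousLinearMap
    (LinearMap.toContinuousLinearMap (M x ∘ₗ (dval (d := d) x).toLinearMap)),
    fun x => sharpLM G (LinearMap.toContinuousLinearMap (L x)) x.val, ?_, ?_⟩
  · intro x X Y u v hu hv
    show x.val (bracket G (M x (dval x u)) (M x (dval x v))) = _
    rw [hu, hv, hM', bracket_skew, map_neg, hM', ← map_neg, ← bracket_skew]
  · intro x ξ
    refine ⟨predual E (ξ.comp (LinearMap.toContinuousLinearMap (L x))), ?_, fun u => ?_⟩
    · obtain ⟨w, hw⟩ := exists_dval_eq h x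
        (predual E (ξ.comp (LinearMap.toContinuousLinearMap (L x))))
      have hw' : L x (coad G x.val (predual E (ξ.comp (LinearMap.toContinuousLinearMap (L x))))) = w := by
        rw [← hw, hL']
      exact (congrArg (dval x) hw').trans hw
    · rw [predual_spec]
      show ξ u = ξ (L x (dval x u))
      rw [hL']

namespace IsKKS

variable {Ω : Orbit (coAd (G := G)) ξ₀ → EuclideanSpace ℝ (Fin d) [⋀^Fin 2]→L[ℝ] ℝ}
  {P : Orbit (coAd (G := G)) ξ₀ → (EuclideanSpace ℝ (Fin d) →L[ℝ] ℝ) →ₗ[ℝ]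
    EuclideanSpace ℝ (Fin d)} (hK : IsKKS ξ₀ d Ω P)
include hK

theorem isKKSForm : IsKKSForm ξ₀ (d := d) Ω where
  tangent x := range_dval h x
  formula x X Y u v hu hv := hK.form x X Y u v hu hv

/-- The value of the Poisson structure is determined by any generator of the covector. -/
theorem dval_sharp {x : Orbit (coAd (G := G)) ξ₀} {ξ : EuclideanSpace ℝ (Fin d) →L[ℝ] ℝ} {Y : E}
    (hY : ∀ u, ξ u = dval x u Y) : dval x (P x ξ) = coad G x.val Y := by
  obtain ⟨X, hX, hX'⟩ := hK.sharp x ξ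
  rw [hX]
  ext Z
  obtain ⟨u, hu⟩ := exists_dval_eq h x Z
  have h1 := (hX' u).symm.trans (hY u)
  rw [hu, coad_apply, coad_apply] at h1
  rw [coad_apply, coad_apply, bracket_skew, map_neg, h1, ← map_neg, ← bracket_skew]

theorem isInverse : IsInverse (𝓡 d) Ω P := by
  have key : ∀ x (ξ : EuclideanSpace ℝ (Fin d) →L[ℝ] ℝ) v, Ω x ![P x ξ, v] = -(ξ v) := by
    intro x ξ v
    obtain ⟨X, hX, hX'⟩ := hK.sharp x ξ
    obtain ⟨V, hV⟩ := exists_eq_coad h x v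
    rw [hK.form x X V _ _ hX hV, hX' v, hV, coad_apply, bracket_skew, map_neg]
  exact key

theorem isPoissonMap_val :
    IsPoissonMap (𝓡 d) 𝓘(ℝ, E →L[ℝ] ℝ) P (liePoisson G) Orbit.val :=
  ⟨h.val_immersion.1, fun x η => hK.dval_sharp h (ξ := ContinuousLinearMap.comp
    (η : (E →L[ℝ] ℝ) →L[ℝ] ℝ) (dval x)) fun _ => (predual_spec _ _).symm⟩

/-- An inverse chart followed by the inclusion is an `IsCoadParam`, which gives smoothness and
closedness. If `u` pairs to zero with every coadjoint vector, its image as a functional on the Lie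
algebra vanishes, and the inclusion is an immersion. -/
theorem isSymplectic : IsSymplectic (𝓡 d) Ω := by
  have := h.manifold
  have hpar : ∀ x₀ : Orbit (coAd (G := G)) ξ₀,
      IsCoadParam G (fun y => ((extChartAt (𝓡 d) x₀).symm y).val) (extChartAt (𝓡 d) x₀).target ∧
      IsPullbackKKS G (fun y => ((extChartAt (𝓡 d) x₀).symm y).val) (extChartAt (𝓡 d) x₀).target
        (chartForm (𝓡 d) Ω x₀) := by
    intro x₀
    have hD : ∀ y ∈ (extChartAt (𝓡 d) x₀).target,
        fderiv ℝ (fun y => ((extChartAt (𝓡 d) x₀).symm y).val) y =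
          (dval ((extChartAt (𝓡 d) x₀).symm y)).comp
            (tder (𝓡 d) (𝓡 d) (extChartAt (𝓡 d) x₀).symm y) := fun y hy => by
      rw [← tder_eq_fderiv]
      exact tder_comp rfl (h.val_immersion.1.mdAt _)
        ((contMDiffAt_extChartAt_symm x₀ hy).mdifferentiableAt (by simp))
    refine ⟨⟨isOpen_extChartAt_target x₀, ?_, fun y hy => ?_, fun y hy => ?_⟩, ?_⟩
    · exact (h.val_immersion.1.comp_contMDiffOn (contMDiffOn_extChartAt_symm x₀)).contDiffOn
    · rw [hD y hy]
      exact (dval_injective h _).comp (tder_extChartAt_symm_bijective x₀ hy).1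
    · rw [hD y hy, ← range_dval h]
      exact (tder_extChartAt_symm_bijective x₀ hy).2.range_comp _
    · intro y hy u v X Y hu hv
      rw [hD y hy] at hu hv
      have e : chartForm (𝓡 d) Ω x₀ y ![u, v] = Ω ((extChartAt (𝓡 d) x₀).symm y)
          ![tder (𝓡 d) (𝓡 d) (extChartAt (𝓡 d) x₀).symm y u,
            tder (𝓡 d) (𝓡 d) (extChartAt (𝓡 d) x₀).symm y v] := by
        refine congrArg (Ω ((extChartAt (𝓡 d) x₀).symm y)) ?_
        funext i
        fin_cases i <;> rfl
      rw [e]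
      exact hK.form _ X Y _ _ hu hv
  have key : ∀ x u, (∀ v, Ω x ![u, v] = 0) → u = 0 := by
    intro x u hu
    apply dval_injective h x
    rw [map_zero]
    obtain ⟨X, hX⟩ := exists_eq_coad h x u
    ext Y
    obtain ⟨v, hv⟩ := exists_dval_eq h x Y
    have := hu v
    rw [hK.form x X Y u v hX hv] at this
    rw [hX, coad_apply, this, zero_apply]
  exact
  { smooth := fun x₀ y hy =>
      ((hpar x₀).1.contDiffAt_form (hpar x₀).2 hy).contDiffWithinAt
    closed := fun x₀ y hy => (hpar x₀).1.extDeriv_eq_zero (hpar x₀).2 hy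
    nondegenerate := key }

end IsKKS

end CoadjointOrbits

/-! ### Velocities of curves and the symplectic groupoid. -/

section Velocities

variable {E H M E' H' M' : Type*}
  [NormedAddCommGroup E] [NormedSpace ℝ E] [TopologicalSpace H]
  [TopologicalSpace M] [ChartedSpace H M]
  [NormedAddCommGroup E'] [NormedSpace ℝ E'] [TopologicalSpace H']
  [TopologicalSpace M'] [ChartedSpace H' M']
  {I : ModelWithCorners ℝ E H} {I' : ModelWithCorners ℝ E' H'}

theorem LieTwo.HasVelocity.comp {γ : ℝ → M} {x : M} {v : E} (h : HasVelocity I γ x v) {f : M → M'}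
    (hf : ContMDiffAt I I' ∞ f x) {y : M'} (hy : f x = y) {w : E'} (hw : tder I I' f x v = w) :
    HasVelocity I' (fun τ => f (γ τ)) y w := by
  obtain ⟨h1, rfl, h3⟩ := h
  refine ⟨hf.comp 0 h1, hy, ?_⟩
  have e := tder_comp (I'' := I') (f := γ) rfl (hf.mdifferentiableAt (by simp))
    (h1.mdifferentiableAt (by simp))
  refine (DFunLike.congr_fun e (1 : ℝ)).trans ?_
  have h3' : tder 𝓘(ℝ, ℝ) I γ 0 (1 : ℝ) = v := h3
  rw [ContinuousLinearMap.comp_apply, h3', hw]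

theorem LieTwo.HasVelocity.hasDerivAt {γ : ℝ → E} {x v : E} (h : HasVelocity 𝓘(ℝ, E) γ x v) :
    HasDerivAt γ v 0 := by
  have h1 : DifferentiableAt ℝ γ 0 := (h.1.mdifferentiableAt (by simp)).differentiableAt
  have h2 : tder 𝓘(ℝ, ℝ) 𝓘(ℝ, E) γ 0 (1 : ℝ) = v := h.2.2
  rw [tder_eq_fderiv, fderiv_apply_one_eq_deriv] at h2
  exact h2 ▸ h1.hasDerivAt

theorem LieTwo.HasVelocity.prodMk {γ : ℝ → M} {δ : ℝ → M'} {x : M} {y : M'} {u : E} {v : E'}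
    (h : HasVelocity I γ x u) (h' : HasVelocity I' δ y v) :
    HasVelocity (I.prod I') (fun τ => (γ τ, δ τ)) (x, y) ((u, v) : E × E') := by
  refine ⟨h.1.prodMk h'.1, Prod.ext h.2.1 h'.2.1, ?_⟩
  have e := tder_prodMk (h.1.mdifferentiableAt (by simp)) (h'.1.mdifferentiableAt (by simp))
  exact (DFunLike.congr_fun e (1 : ℝ)).trans (Prod.ext h.2.2 h'.2.2)

theorem exists_hasVelocity_one {G : Type*} [TopologicalSpace G] [ChartedSpace E G] [Group G]
    [LieGroup 𝓘(ℝ, E) ∞ G] (X : E) : ∃ a : ℝ → G, HasVelocity 𝓘(ℝ, E) a 1 X := by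
  refine ⟨_, (hasVelocity_line (extChartAt 𝓘(ℝ, E) (1 : G) 1) X).comp
    (contMDiffAt_symm_one (mem_extChartAt_target (I := 𝓘(ℝ, E)) (1 : G)))
    ((extChartAt 𝓘(ℝ, E) (1 : G)).left_inv (mem_extChartAt_source _)) ?_⟩
  rw [tder_extChartAt_one_symm]
  rfl

end Velocities

namespace LieTwo.LieTwoGroup

variable {E₁ G₁ E₀ G₀ : Type*}
  [NormedAddCommGroup E₁] [NormedSpace ℝ E₁]
  [TopologicalSpace G₁] [ChartedSpace E₁ G₁]
  [Group G₁] [LieGroup 𝓘(ℝ, E₁) ∞ G₁]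
  [NormedAddCommGroup E₀] [NormedSpace ℝ E₀] [TopologicalSpace G₀] [ChartedSpace E₀ G₀]
  [Group G₀] [LieGroup 𝓘(ℝ, E₀) ∞ G₀]
  (𝒢 : LieTwoGroup E₁ G₁ E₀ G₀)

/-- Composable elements of the Lie 2-algebra are velocities of composable curves. -/
theorem exists_hasVelocity_composable {A B : E₁} (hAB : 𝒢.usrc A = 𝒢.utgt B) :
    ∃ a b : ℝ → G₁, HasVelocity 𝓘(ℝ, E₁) a 1 A ∧ HasVelocity 𝓘(ℝ, E₁) b 1 B ∧
      ∀ τ, 𝒢.src (a τ) = 𝒢.tgt (b τ) := by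
  obtain ⟨a, ha⟩ := exists_hasVelocity_one (G := G₁) A
  obtain ⟨b, hb⟩ := exists_hasVelocity_one (G := G₁) B
  have hs := 𝒢.contMDiff_unit.comp 𝒢.contMDiff_src
  have ht := 𝒢.contMDiff_unit.comp 𝒢.contMDiff_tgt
  have hq : ContMDiff 𝓘(ℝ, E₁) 𝓘(ℝ, E₁) ∞ fun q : G₁ => q * (𝒢.unit (𝒢.tgt q))⁻¹ :=
    contMDiff_id.mul ht.inv
  have hf : ContMDiff (𝓘(ℝ, E₁).prod 𝓘(ℝ, E₁)) 𝓘(ℝ, E₁) ∞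
      (fun p : G₁ × G₁ => p.2 * (𝒢.unit (𝒢.tgt p.2))⁻¹ * 𝒢.unit (𝒢.src p.1)) :=
    (hq.comp contMDiff_snd).mul (hs.comp contMDiff_fst)
  -- The curve `b` is corrected to `b u(t b)⁻¹ u(s a)`, with target `s a`. Its velocity is `B - utgt
  -- B + usrc A = B`.
  refine ⟨a, _, ha, (ha.prodMk hb).comp (hf _) ?_ ?_, fun τ => ?_⟩
  · simp [src_one, tgt_one, unit_one]
  · rw [tder_prod (hf.mdAt _)]
    have e1 := 𝒢.tder_unit_src
    have e2 := tder_mul_inv ht (by simp [tgt_one, unit_one])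
    have e3 := 𝒢.tder_unit_tgt
    simp only [src_one, tgt_one, unit_one, inv_one, mul_one, one_mul, e1]
    simp only [Function.comp_apply] at e2
    rw [e2]
    have e4 : tder 𝓘(ℝ, E₁) 𝓘(ℝ, E₁) (𝒢.unit ∘ 𝒢.tgt) 1 = 𝒢.utgt := e3
    rw [e4, sub_apply, ContinuousLinearMap.id_apply, hAB]
    abel
  · simp only [tgt_mul, tgt_inv, tgt_unit]
    group

variable [FiniteDimensional ℝ E₁] {α : 𝒢.core →L[ℝ] ℝ} {d₁ d₀ : ℕ}
  [TopologicalSpace (Orbit (coAd (G := G₁)) (𝒢.dual.unit α))]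
  [ChartedSpace (EuclideanSpace ℝ (Fin d₁)) (Orbit (coAd (G := G₁)) (𝒢.dual.unit α))]
  (h₁ : IsOrbitManifold (E := E₁) (coAd (G := G₁)) (𝒢.dual.unit α) d₁)
  {x y : Orbit (coAd (G := G₁)) (𝒢.dual.unit α)}
  {u v w : EuclideanSpace ℝ (Fin d₁)}
omit [FiniteDimensional ℝ E₁] in
theorem hasDerivAt_dual_mul {c₁ c₂ : ℝ → E₁ →L[ℝ] ℝ} {a b p q : E₁ →L[ℝ] ℝ}
    (hc₁ : HasVelocity 𝓘(ℝ, E₁ →L[ℝ] ℝ) c₁ p a) (hc₂ : HasVelocity 𝓘(ℝ, E₁ →L[ℝ] ℝ) c₂ q b) :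
    HasDerivAt (fun τ => 𝒢.dual.mul (c₁ τ) (c₂ τ)) (𝒢.dual.mul a b) 0 := by
  have h := hc₁.hasDerivAt.add
    (hc₂.comp (contMDiff_precomp 𝒢.usrc q) rfl (tder_precomp _ _ _)).hasDerivAt
  rw [dual_mul]
  refine h.congr_of_eventuallyEq (Filter.Eventually.of_forall fun τ => ?_)
  exact 𝒢.dual_mul _ _

include h₁

omit [FiniteDimensional ℝ E₁] in
-- Included into `𝔤₁^*`, a curve in the graph satisfies linear relations, which its velocities
-- inherit.
theorem dval_of_graphTangent
    (H : GraphTangent (𝓡 d₁) (𝒢.coadOrbitGroupoid α).mul (𝒢.coadOrbitGroupoid α).composable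
      x y u v w) :
    𝒢.dual.src (dval x u) = 𝒢.dual.tgt (dval y v) ∧
      dval ((𝒢.coadOrbitGroupoid α).mul x y) w = 𝒢.dual.mul (dval x u) (dval y v) := by
  obtain ⟨γ₁, γ₂, k₁, k₂, hc, hm⟩ := H
  have hv := h₁.val_immersion.1
  have c₁ : HasVelocity 𝓘(ℝ, E₁ →L[ℝ] ℝ) (fun τ => (γ₁ τ).val) x.val (dval x u) :=
    k₁.comp (hv _) rfl rfl
  have c₂ : HasVelocity 𝓘(ℝ, E₁ →L[ℝ] ℝ) (fun τ => (γ₂ τ).val) y.val (dval y v) :=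
    k₂.comp (hv _) rfl rfl
  have c₃ : HasVelocity 𝓘(ℝ, E₁ →L[ℝ] ℝ)
      (fun τ => ((𝒢.coadOrbitGroupoid α).mul (γ₁ τ) (γ₂ τ)).val)
      ((𝒢.coadOrbitGroupoid α).mul x y).val (dval ((𝒢.coadOrbitGroupoid α).mul x y) w) :=
    hm.comp (hv _) rfl rfl
  constructor
  · have e1 := (c₁.comp (𝒢.contMDiff_dual_src _) rfl (𝒢.tder_dual_src _ _)).hasDerivAt
    have e2 := (c₂.comp (𝒢.contMDiff_dual_tgt _) rfl (𝒢.tder_dual_tgt _ _)).hasDerivAt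
    refine e1.unique (e2.congr_of_eventuallyEq ?_)
    filter_upwards [hc] with τ hτ
    exact congrArg Orbit.val hτ
  · refine c₃.hasDerivAt.unique ((𝒢.hasDerivAt_dual_mul c₁ c₂).congr_of_eventuallyEq ?_)
    filter_upwards [hc] with τ hτ
    exact orbitGroupoid_mul_val _ hτ

theorem dval_tder_orbitMap_mul (g : G₁) (A : E₁) :
    dval (orbitMap coAd (𝒢.dual.unit α) g) (tder 𝓘(ℝ, E₁) (𝓡 d₁)
      (fun z => orbitMap coAd (𝒢.dual.unit α) (g * z)) 1 A) =
      coad G₁ (coAd (𝒢.dual.unit α) g) A := by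
  rw [tder_comp (f := fun z => g * z) (mul_one g) (h₁.orbitMap_submersion.1.mdAt g)
    ((contMDiff_mulLeft g).mdAt 1), ← tder_coAd_mulLeft, ← dval_orbitMap h₁]
  rfl

/-- Represent the two points by composable `g` and `h'`, and `A`, `B` by composable curves `a`, `b`
through `1`. As source and target are homomorphisms, `g a` and `h' b` stay composable, and their
images are a curve in the graph. -/
theorem graphTangent_of_dval
    [TopologicalSpace (Orbit 𝒢.coreCoAct α)]
    [ChartedSpace (EuclideanSpace ℝ (Fin d₀)) (Orbit 𝒢.coreCoAct α)]
    (hO : IsLieGroupoid (𝓡 d₁) (𝓡 d₀) (𝒢.coadOrbitGroupoid α))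
    (hxy : (𝒢.coadOrbitGroupoid α).src x = (𝒢.coadOrbitGroupoid α).tgt y)
    {A B : E₁} (hAB : 𝒢.usrc A = 𝒢.utgt B) (hu : dval x u = coad G₁ x.val A)
    (hv : dval y v = coad G₁ y.val B)
    (hw : dval ((𝒢.coadOrbitGroupoid α).mul x y) w = 𝒢.dual.mul (dval x u) (dval y v)) :
    GraphTangent (𝓡 d₁) (𝒢.coadOrbitGroupoid α).mul (𝒢.coadOrbitGroupoid α).composable
      x y u v w := by
  obtain ⟨g, rfl⟩ := x.exists_eq_orbitMap
  obtain ⟨h, rfl⟩ := y.exists_eq_orbitMap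
  obtain ⟨k, hk, hk'⟩ := 𝒢.exists_composable (g := g) (h := h) (by
    have e := hxy
    rw [coadOrbitGroupoid_src, coadOrbitGroupoid_tgt] at e
    exact congrArg Orbit.val e)
  have hk'' : orbitMap coAd (𝒢.dual.unit α) (𝒢.unit k * h) = orbitMap coAd (𝒢.dual.unit α) h :=
    Orbit.ext_val hk'
  generalize 𝒢.unit k * h = h' at hk hk' hk''
  rw [← hk''] at hxy hv hw ⊢
  obtain ⟨a, b, ha, hb, hab⟩ := 𝒢.exists_hasVelocity_composable hAB
  have ho := h₁.orbitMap_submersion.1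
  have hmul : ∀ g : G₁, ContMDiff 𝓘(ℝ, E₁) (𝓡 d₁) ∞
      fun z => orbitMap coAd (𝒢.dual.unit α) (g * z) := fun g => ho.comp (contMDiff_mulLeft g)
  have k₁ : HasVelocity (𝓡 d₁) (fun τ => orbitMap coAd (𝒢.dual.unit α) (g * a τ))
      (orbitMap coAd (𝒢.dual.unit α) g) u :=
    ha.comp (hmul g 1) (by rw [mul_one])
      (dval_injective h₁ _ ((𝒢.dval_tder_orbitMap_mul h₁ g A).trans hu.symm))
  have k₂ : HasVelocity (𝓡 d₁) (fun τ => orbitMap coAd (𝒢.dual.unit α) (h' * b τ))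
      (orbitMap coAd (𝒢.dual.unit α) h') v :=
    hb.comp (hmul h' 1) (by rw [mul_one])
      (dval_injective h₁ _ ((𝒢.dval_tder_orbitMap_mul h₁ h' B).trans hv.symm))
  have hc : ∀ τ, (orbitMap coAd (𝒢.dual.unit α) (g * a τ),
      orbitMap coAd (𝒢.dual.unit α) (h' * b τ)) ∈ (𝒢.coadOrbitGroupoid α).composable := fun τ => by
    show (𝒢.coadOrbitGroupoid α).src _ = (𝒢.coadOrbitGroupoid α).tgt _
    rw [coadOrbitGroupoid_src, coadOrbitGroupoid_tgt, src_mul, tgt_mul, hk, hab]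
  have hsm : ContMDiffAt 𝓘(ℝ, ℝ) (𝓡 d₁) ∞ (fun τ => (𝒢.coadOrbitGroupoid α).mul
      (orbitMap coAd (𝒢.dual.unit α) (g * a τ)) (orbitMap coAd (𝒢.dual.unit α) (h' * b τ))) 0 := by
    have e := (hO.smooth_mul _ (hc 0)).comp (s := Set.univ) (0 : ℝ)
      (k₁.1.prodMk k₂.1).contMDiffWithinAt fun τ _ => hc τ
    exact e.contMDiffAt Filter.univ_mem
  have k₃ : HasVelocity (𝓡 d₁) (fun τ => (𝒢.coadOrbitGroupoid α).mul
      (orbitMap coAd (𝒢.dual.unit α) (g * a τ)) (orbitMap coAd (𝒢.dual.unit α) (h' * b τ)))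
      ((𝒢.coadOrbitGroupoid α).mul (orbitMap coAd (𝒢.dual.unit α) g)
        (orbitMap coAd (𝒢.dual.unit α) h')) (tder 𝓘(ℝ, ℝ) (𝓡 d₁)
        (fun τ => (𝒢.coadOrbitGroupoid α).mul (orbitMap coAd (𝒢.dual.unit α) (g * a τ))
          (orbitMap coAd (𝒢.dual.unit α) (h' * b τ))) 0 (1 : ℝ)) :=
    ⟨hsm, congrArg₂ (𝒢.coadOrbitGroupoid α).mul k₁.2.1 k₂.2.1, rfl⟩
  refine ⟨_, _, k₁, k₂, Filter.Eventually.of_forall hc, ?_⟩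
  -- The third velocity satisfies the same relation as `w`, and the inclusion is an immersion, so
  -- the two agree.
  have e := (𝒢.dval_of_graphTangent h₁ ⟨_, _, k₁, k₂, Filter.Eventually.of_forall hc, k₃⟩).2
  rw [dval_injective h₁ _ (e.trans hw.symm)] at k₃
  exact k₃

/-- Tangent vectors of the graph of the multiplication of the orbit come from composable elements
of the Lie 2-algebra. -/
theorem exists_coad_of_composable
    (hxy : (𝒢.coadOrbitGroupoid α).src x = (𝒢.coadOrbitGroupoid α).tgt y)
    (huv : 𝒢.dual.src (dval x u) = 𝒢.dual.tgt (dval y v)) :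
    ∃ A B, 𝒢.usrc A = 𝒢.utgt B ∧ dval x u = coad G₁ x.val A ∧ dval y v = coad G₁ y.val B := by
  have hxy' := (orbitGroupoid_composable_iff _).1 hxy
  obtain ⟨A, hA⟩ := exists_eq_coad h₁ x u
  obtain ⟨B, hB⟩ := exists_eq_coad h₁ y v
  rw [hA, hB] at huv
  obtain ⟨g, hg⟩ := x.mem
  obtain ⟨C, hC, hC'⟩ := 𝒢.exists_coad_eq_zero hg.symm hxy' huv
  refine ⟨A + C, B, hC', hA.trans ?_, hB⟩
  have e : coad G₁ x.val (A + C) = coad G₁ x.val A + coad G₁ x.val C :=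
    (coadLM G₁ x.val).map_add A C
  rw [e, hC, add_zero]

/-- Tangent vectors of the graph correspond to composable elements of the Lie 2-algebra, so
multiplicativity is `dual_mul_bracket_star` and coisotropy is `coad_of_annihilates`. -/
theorem coadOrbitGroupoid_isSymplecticGroupoid
    [TopologicalSpace (Orbit 𝒢.coreCoAct α)]
    [ChartedSpace (EuclideanSpace ℝ (Fin d₀)) (Orbit 𝒢.coreCoAct α)]
   
    (hO : IsLieGroupoid (𝓡 d₁) (𝓡 d₀) (𝒢.coadOrbitGroupoid α))
    {Ω : Orbit (coAd (G := G₁)) (𝒢.dual.unit α) → EuclideanSpace ℝ (Fin d₁) [⋀^Fin 2]→L[ℝ] ℝ}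
    {P : Orbit (coAd (G := G₁)) (𝒢.dual.unit α) → (EuclideanSpace ℝ (Fin d₁) →L[ℝ] ℝ) →ₗ[ℝ]
      EuclideanSpace ℝ (Fin d₁)} (hK : IsKKS (𝒢.dual.unit α) d₁ Ω P) :
    IsSymplecticGroupoid (𝓡 d₁) (𝓡 d₀) (𝒢.coadOrbitGroupoid α) Ω P where
  lie := hO
  symplectic := hK.isSymplectic h₁
  inverse := hK.isInverse h₁
  coisotropic := by
    intro x y hxy ξ η ζ H
    have hxy' := (orbitGroupoid_composable_iff _).1 hxy
    have hm := orbitGroupoid_mul_val _ hxy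
    obtain ⟨X, hX, hX'⟩ := hK.sharp x ξ
    obtain ⟨Y, hY, hY'⟩ := hK.sharp y η
    obtain ⟨Z, hZ, hZ'⟩ := hK.sharp ((𝒢.coadOrbitGroupoid α).mul x y) ζ
    have hlin := 𝒢.coad_of_annihilates (x := x.val) (y := y.val) (X := X) (Y := Y) (Z := -Z)
      fun A B hAB => by
        obtain ⟨u, hu⟩ := exists_dval_eq h₁ x A
        obtain ⟨v, hv⟩ := exists_dval_eq h₁ y B
        obtain ⟨w, hw⟩ := exists_dval_eq h₁ ((𝒢.coadOrbitGroupoid α).mul x y) (A + B - 𝒢.utgt B)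
        have hw' : dval ((𝒢.coadOrbitGroupoid α).mul x y) w =
            𝒢.dual.mul (dval x u) (dval y v) := by
          rw [hw, hu, hv, hm, 𝒢.coad_dual_mul hxy' hAB]
        have e := H u v w (𝒢.graphTangent_of_dval h₁ hO hxy hAB hu hv hw')
        have e1 : ξ u = x.val (bracket G₁ A X) := (hX' u).trans (by rw [hu, coad_apply])
        have e2 : η v = y.val (bracket G₁ B Y) := (hY' v).trans (by rw [hv, coad_apply])
        have e3 : ζ w = 𝒢.dual.mul x.val y.val (bracket G₁ (A + B - 𝒢.utgt B) Z) :=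
          (hZ' w).trans (by rw [hw, coad_apply, hm])
        rw [map_neg, map_neg]
        linarith
    obtain ⟨hc, hmul⟩ := hlin
    have hc' : 𝒢.dual.src (dval x (P x ξ)) = 𝒢.dual.tgt (dval y (P y η)) := by rw [hX, hY, hc]
    obtain ⟨A, B, hAB, hA, hB⟩ := 𝒢.exists_coad_of_composable h₁ hxy hc'
    refine 𝒢.graphTangent_of_dval h₁ hO hxy hAB hA hB ?_
    have e : dval ((𝒢.coadOrbitGroupoid α).mul x y) (-(P ((𝒢.coadOrbitGroupoid α).mul x y) ζ)) =
        -coad G₁ ((𝒢.coadOrbitGroupoid α).mul x y).val Z := by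
      rw [map_neg, hZ]
    have e1 : -coad G₁ ((𝒢.coadOrbitGroupoid α).mul x y).val Z =
        coad G₁ (𝒢.dual.mul x.val y.val) (-Z) := by
      rw [hm]
      exact ((coadLM G₁ _).map_neg Z).symm
    exact (e.trans (e1.trans hmul)).trans (congrArg₂ 𝒢.dual.mul hX.symm hY.symm)
  multiplicative := by
    intro x y hxy u v w u' v' w' H H'
    have hxy' := (orbitGroupoid_composable_iff _).1 hxy
    have hm := orbitGroupoid_mul_val _ hxy
    obtain ⟨hc, hw⟩ := 𝒢.dval_of_graphTangent h₁ H
    obtain ⟨hc', hw'⟩ := 𝒢.dval_of_graphTangent h₁ H'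
    obtain ⟨A, B, hAB, hA, hB⟩ := 𝒢.exists_coad_of_composable h₁ hxy hc
    obtain ⟨A', B', hAB', hA', hB'⟩ := 𝒢.exists_coad_of_composable h₁ hxy hc'
    rw [hA, hB, ← 𝒢.coad_dual_mul hxy' hAB, ← hm] at hw
    rw [hA', hB', ← 𝒢.coad_dual_mul hxy' hAB', ← hm] at hw'
    refine (hK.form _ _ _ _ _ hw hw').trans ?_
    rw [hm, 𝒢.dual_mul_bracket_star hxy' hAB hAB']
    exact (congrArg₂ (· + ·) (hK.form _ _ _ _ _ hA hA') (hK.form _ _ _ _ _ hB hB')).symm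

/-- The target restricts functionals to the core, so the pullback of a covector `η` is generated by
an element of `𝔥`. Since `𝔥` is an ideal, the resulting bracket stays in the core, where the
projection is the identity. -/
theorem isPoissonMap_tgt
    {Ω : Orbit (coAd (G := G₁)) (𝒢.dual.unit α) → EuclideanSpace ℝ (Fin d₁) [⋀^Fin 2]→L[ℝ] ℝ}
    {P : Orbit (coAd (G := G₁)) (𝒢.dual.unit α) → (EuclideanSpace ℝ (Fin d₁) →L[ℝ] ℝ) →ₗ[ℝ]
      EuclideanSpace ℝ (Fin d₁)} (hK : IsKKS (𝒢.dual.unit α) d₁ Ω P) :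
    IsPoissonMap (𝓡 d₁) 𝓘(ℝ, 𝒢.core →L[ℝ] ℝ) P 𝒢.liePoissonCore
      (fun x => ((𝒢.coadOrbitGroupoid α).tgt x).val) := by
  have hs : ContMDiff (𝓡 d₁) 𝓘(ℝ, 𝒢.core →L[ℝ] ℝ) ∞
      (fun x => ((𝒢.coadOrbitGroupoid α).tgt x).val) :=
    𝒢.contMDiff_dual_tgt.comp h₁.val_immersion.1
  have hd : ∀ x u, tder (𝓡 d₁) 𝓘(ℝ, 𝒢.core →L[ℝ] ℝ)
      (fun x => ((𝒢.coadOrbitGroupoid α).tgt x).val) x u = 𝒢.dual.tgt (dval x u) := fun x u => by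
    rw [← 𝒢.tder_dual_tgt x.val]
    exact DFunLike.congr_fun (tder_comp rfl (𝒢.contMDiff_dual_tgt.mdAt _)
      (h₁.val_immersion.1.mdAt x)) u
  refine ⟨hs, fun x η => ?_⟩
  have key : ∀ η : (𝒢.core →L[ℝ] ℝ) →L[ℝ] ℝ,
      tder (𝓡 d₁) 𝓘(ℝ, 𝒢.core →L[ℝ] ℝ) (fun x => ((𝒢.coadOrbitGroupoid α).tgt x).val) x
        (P x (η.comp (tder (𝓡 d₁) 𝓘(ℝ, 𝒢.core →L[ℝ] ℝ)
          (fun x => ((𝒢.coadOrbitGroupoid α).tgt x).val) x))) =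
      𝒢.fstComp (coad G₁ ((𝒢.dual.tgt x.val).comp 𝒢.proj) (predual 𝒢.core η : E₁)) := by
    intro η
    rw [hd, hK.dval_sharp h₁ (Y := (predual 𝒢.core η : E₁)) fun u => ?_]
    · ext h
      have hc : bracket G₁ (predual 𝒢.core η : E₁) h ∈ 𝒢.core := by
        rw [mem_core_iff, usrc_bracket, usrc_core, map_zero, LinearMap.zero_apply]
      show x.val (bracket G₁ (predual 𝒢.core η : E₁) h) =
        x.val (𝒢.proj (bracket G₁ (predual 𝒢.core η : E₁) h) : E₁)
      rw [coe_proj, 𝒢.mem_core_iff.1 hc, sub_zero]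
    · rw [ContinuousLinearMap.comp_apply, hd]
      exact (predual_spec η _).symm
  exact key η

end LieTwo.LieTwoGroup

theorem mainTheorem6 {E₁ G₁ E₀ G₀ : Type*}
    [NormedAddCommGroup E₁] [NormedSpace ℝ E₁] [FiniteDimensional ℝ E₁]
    [TopologicalSpace G₁] [ChartedSpace E₁ G₁] [Group G₁] [LieGroup 𝓘(ℝ, E₁) ∞ G₁]
    [NormedAddCommGroup E₀] [NormedSpace ℝ E₀] [FiniteDimensional ℝ E₀]
    [TopologicalSpace G₀] [ChartedSpace E₀ G₀] [Group G₀] [LieGroup 𝓘(ℝ, E₀) ∞ G₀]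
    (𝒢 : LieTwoGroup E₁ G₁ E₀ G₀) :
    -- the dual of the Lie 2-algebra is a Poisson 2-group
    IsAddPoissonTwoGroup 𝓘(ℝ, E₁ →L[ℝ] ℝ) 𝓘(ℝ, 𝒢.core →L[ℝ] ℝ) 𝒢.dual (liePoisson G₁) ∧
    -- the coadjoint action defines a double Lie groupoid
    IsDoubleLieGroupoid (𝓘(ℝ, E₁ →L[ℝ] ℝ).prod 𝓘(ℝ, E₁)) 𝓘(ℝ, E₁ →L[ℝ] ℝ)
      (𝓘(ℝ, 𝒢.core →L[ℝ] ℝ).prod 𝓘(ℝ, E₀)) 𝓘(ℝ, 𝒢.core →L[ℝ] ℝ)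
      (GroupoidData.action (coAd (G := G₁))) (𝒢.dual.prod 𝒢.toGroupoidData)
      𝒢.dual (GroupoidData.action 𝒢.coreCoAct) ∧
    -- the coadjoint orbit of a unit is a symplectic groupoid
    ∀ α : 𝒢.core →L[ℝ] ℝ,
      𝒢.dual.IsSubgroupoid (Set.range (coAd (G := G₁) (𝒢.dual.unit α)))
        (Set.range (𝒢.coreCoAct α)) ∧
      ∃ (d₁ d₀ : ℕ)
        (_ : TopologicalSpace (Orbit (coAd (G := G₁)) (𝒢.dual.unit α)))
        (_ : ChartedSpace (EuclideanSpace ℝ (Fin d₁)) (Orbit (coAd (G := G₁)) (𝒢.dual.unit α)))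
        (_ : TopologicalSpace (Orbit 𝒢.coreCoAct α))
        (_ : ChartedSpace (EuclideanSpace ℝ (Fin d₀)) (Orbit 𝒢.coreCoAct α))
        (𝒪 : GroupoidData (Orbit (coAd (G := G₁)) (𝒢.dual.unit α)) (Orbit 𝒢.coreCoAct α))
        (Ω : TwoForm (𝓡 d₁) (Orbit (coAd (G := G₁)) (𝒢.dual.unit α)))
        (P : SharpField (𝓡 d₁) (Orbit (coAd (G := G₁)) (𝒢.dual.unit α))),
        IsOrbitManifold (E := E₁) (coAd (G := G₁)) (𝒢.dual.unit α) d₁ ∧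
        IsOrbitManifold (E := E₀) (G := G₀) 𝒢.coreCoAct α d₀ ∧
        𝒪.IsMorphism 𝒢.dual Orbit.val Orbit.val ∧
        IsKKSForm (𝒢.dual.unit α) Ω ∧
        IsSymplecticGroupoid (𝓡 d₁) (𝓡 d₀) 𝒪 Ω P ∧
        IsPoissonMap (𝓡 d₁) 𝓘(ℝ, E₁ →L[ℝ] ℝ) P (liePoisson G₁) Orbit.val ∧
        IsPoissonMap (𝓡 d₁) 𝓘(ℝ, 𝒢.core →L[ℝ] ℝ) P 𝒢.liePoissonCore
          (fun x => (𝒪.tgt x).val) := by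
  refine ⟨𝒢.dual_isAddPoissonTwoGroup, 𝒢.coadjoint_isDoubleLieGroupoid, fun α =>
    ⟨𝒢.orbit_isSubgroupoid α, ?_⟩⟩
  obtain ⟨d₁, t₁, c₁, h₁, s₁⟩ :=
    (isSmoothRightAction_coAd (E := E₁) (G := G₁)).exists_isOrbitManifold (𝒢.dual.unit α)
  obtain ⟨d₀, t₀, c₀, h₀, s₀⟩ := 𝒢.isSmoothRightAction_coreCoAct.exists_isOrbitManifold α
  obtain ⟨Ω, P, hK⟩ := exists_isKKS h₁
  exact ⟨d₁, d₀, t₁, c₁, t₀, c₀, 𝒢.coadOrbitGroupoid α, Ω, P, h₁, h₀, orbitGroupoid_isMorphism _,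
    hK.isKKSForm h₁, 𝒢.coadOrbitGroupoid_isSymplecticGroupoid h₁
      (𝒢.coadOrbitGroupoid_isLieGroupoid h₁ h₀ s₁ s₀) hK, hK.isPoissonMap_val h₁,
    𝒢.isPoissonMap_tgt h₁ hK⟩
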